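/- Let $k\ge 1$ be an integer. Put $$A_k=\{a\in\mathbb C^k:\ a_j\ne l/k\ \text{ for all } 1\le j\le k,\ l\in\mathbb Z\}=(\mathbb C\setminus\mathbb Z[1/k])^k,\qquad \mathbb Z[1/k]:=\{l/k:l\in\mathbb Z\},$$ $$Z_k=\{z\in\mathbb C^k:\ z_j\ne -pk-j\ \text{ for all } 1\le j\le k,\ p=0,1,2,\dots\}=\prod_{j=1}^k(\mathbb C\setminus\mathbb Z^-_j).$$ For a connected manifold $X$ let $\widetilde X^{ab}$ be its maximal abelian cover, i.e. the cover belonging to the commutator subgroup of $\pi_1(X,x_0)$; its points are the classes $[\gamma]$ of paths $\gamma$ from $x_0$, where $[\gamma]=[\delta]$ iff $\gamma,\delta$ have the same endpoint and the class of $\gamma\delta^{-1}$ lies in the commutator subgroup. For $\operatorname{Im}a_j>0$, $\operatorname{Re}z_j>0$ $(1\le j\le k)$ and $\operatorname{Re}s>1$ consider the absolutely convergent series $$\zeta_k(a,z,s)=\sum_{n=1}^\infty\frac{e^{2\pi i n a_{[n-1]_k+1}}}{(n+z_{[n-1]_k+1})^s}$$ (principal powers), where $[m]_k$ is the remainder of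 $m$ modulo $k$. Fix base points $a^0\in A_k$, $z^0\in Z_k$ with $\operatorname{Im}a^0_j>0$, $\operatorname{Re}z^0_j>0$ for all $j$. **Theorem.** $\zeta_k$ continues analytically to a single-valued meromorphic, in fact holomorphic, function $\tilde\zeta_k$ on $$\tilde{\mathcal Z}_k=\widetilde{A_k}^{ab}\times\widetilde{Z_k}^{ab}\times\mathbb C ;$$ that is, $\tilde\zeta_k([\alpha],[\beta],s)=\zeta_k(a,z,s)$ whenever $\operatorname{Re}s>1$, $\alpha$ is a path from $a^0$ to $a$ in $\{\operatorname{Im}a_j>0\ \forall j\}$ and $\beta$ is a path from $z^0$ to $z$ in $\{\operatorname{Re}z_j>0\ \forall j\}$. Moreover: 1. (Monodromy around $a_j=l/k$.) Let $1\le j\le k$ and $l\in\mathbb Z$. Let $\alpha$ be any path in $A_k$ from $a^0$ to a point $a$, and let $\sigma$ be a loop at $a$ that follows a path $\tau$ in $A_k$, then runs once counterclockwise around a circle in the $a_j$-plane with centre $l/k$ and radius less than $1/k$ (the other coordinates being fixed), and returns along $\tau$. Then for every point $Q$ of $\widetilde{Z_k}^{ab}$ over $z$ and every $s\in\mathbb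 C$ $$\tilde\zeta_k([\alpha\sigma],Q,s)-\tilde\zeta_k([\alpha],Q,s)=-\frac{2\pi i\,e^{2\pi i j a_j}}{\Gamma(s)}\cdot\frac{\left[2\pi\left(a_j-\frac lk\right)\right]^{s-1}e^{i\frac{\pi}{2}(s-1)}\,e^{-2\pi i\left(a_j-\frac lk\right)(j+z_j)}}{k},$$ where $1/\Gamma$ is regarded as an entire function and $\log(a_j-l/k)$ in the power is continued along $\alpha$ from its principal value at $a^0$. 2. (Monodromy around $z_j=-pk-j$.) Let $1\le j\le k$ and let $p\ge0$ be an integer. Let $\beta$ be any path in $Z_k$ from $z^0$ to a point $z$, and let $\sigma$ be a loop at $z$ that follows a path $\tau$ in $Z_k$, then runs once counterclockwise around a circle in the $z_j$-plane with centre $-pk-j$ and radius less than $k$ (the other coordinates being fixed), and returns along $\tau$. Then for every point $P$ of $\widetilde{A_k}^{ab}$ over $a$ and every $s\in\mathbb C$ $$\tilde\zeta_k(P,[\beta\sigma],s)-\tilde\zeta_k(P,[\beta],s)=\frac{e^{2\pi i(pk+j)a_j}}{(pk+j+z_j)^s}\left(e^{-2\pi i s}-1\right),$$ where $\log(pk+j+z_j)$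 in the power is continued along $\beta$ from its principal value at $z^0$. 3. $\tilde{\mathcal Z}_k$ is the Riemann domain of $\zeta_k$ over $\mathbb C^k\times\mathbb C^k\times\mathbb C$: the germs of $\tilde\zeta_k$ at two different points of $\tilde{\mathcal Z}_k$ over the same point are different, and no germ of $\tilde\zeta_k$ can be continued meromorphically beyond $A_k\times Z_k\times\mathbb C$, i.e. if a germ of $\tilde\zeta_k$ is the germ of a meromorphic function $g/h$ ($g,h$ holomorphic, $h\not\equiv0$) on a connected open set $V\subseteq\mathbb C^k\times\mathbb C^k\times\mathbb C$, then $V\subseteq A_k\times Z_k\times\mathbb C$. -/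

import Mathlib

open Complex Topology

/-! ### The maximal abelian cover of a pointed space -/

section AbelianCover

variable {X : Type*} [TopologicalSpace X]

/-- Two paths `γ`, `δ` from `x₀` to `x` are identified when the class of the loop `γ · δ⁻¹` lies in
the commutator subgroup of `π₁(X, x₀)`. -/
def abelianSetoid (x₀ x : X) : Setoid (Path x₀ x) where
  r γ δ := FundamentalGroup.fromPath (Path.Homotopic.Quotient.mk (γ.trans δ.symm)) ∈
    commutator (FundamentalGroup X x₀)
  iseqv := by
    refine ⟨fun γ => ?_, fun {γ δ} h => ?_, fun {γ δ ε} h₁ h₂ => ?_⟩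
    · have : FundamentalGroup.fromPath (Path.Homotopic.Quotient.mk (γ.trans γ.symm)) =
          (1 : FundamentalGroup X x₀) := by
        rw [FundamentalGroup.one_def]; simp
      rw [this]; exact one_mem _
    · have : FundamentalGroup.fromPath (Path.Homotopic.Quotient.mk (δ.trans γ.symm)) =
          (FundamentalGroup.fromPath (Path.Homotopic.Quotient.mk (γ.trans δ.symm)))⁻¹ := by
        rw [FundamentalGroup.inv_def]
        change _ = Path.Homotopic.Quotient.symm (Path.Homotopic.Quotient.mk (γ.trans δ.symm))
        rw [← Path.Homotopic.Quotient.mk_symm, Path.trans_symm, Path.symm_symm]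
      rw [this]; exact inv_mem h
    · have : FundamentalGroup.fromPath (Path.Homotopic.Quotient.mk (γ.trans ε.symm)) =
          (FundamentalGroup.fromPath (Path.Homotopic.Quotient.mk (δ.trans ε.symm))) *
          (FundamentalGroup.fromPath (Path.Homotopic.Quotient.mk (γ.trans δ.symm))) := by
        rw [FundamentalGroup.mul_def]
        simp only [Path.Homotopic.Quotient.mk_trans, Path.Homotopic.Quotient.mk_symm]
        rw [Path.Homotopic.Quotient.trans_assoc, ← Path.Homotopic.Quotient.trans_assoc _ _
          (Path.Homotopic.Quotient.mk ε).symm, Path.Homotopic.Quotient.symm_trans,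
          Path.Homotopic.Quotient.refl_trans]
      rw [this]; exact mul_mem h₂ h₁

/-- The maximal abelian cover of `X` (the cover belonging to the commutator subgroup of
`π₁(X, x₀)`), as the set of classes of paths starting at `x₀`. -/
structure AbelianCover (x₀ : X) where
  /-- the point of `X` under the point of the cover -/
  pt : X
  /-- the class of the path -/
  cls : Quotient (abelianSetoid x₀ pt)

namespace AbelianCover

variable {x₀ : X}

/-- The point of the cover given by a path from the base point. -/
def ofPath {x : X} (γ : Path x₀ x) : AbelianCover x₀ :=
  ⟨x, Quotient.mk (abelianSetoid x₀ x) γ⟩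

/-- Prolonging a point of the cover along a path of `X` (the endpoint of the lifted path). -/
noncomputable def append (P : AbelianCover x₀) {y : X} (δ : Path P.pt y) : AbelianCover x₀ :=
  ⟨y, Quotient.map (fun γ : Path x₀ P.pt => γ.trans δ) (by
    intro γ γ' h
    have : FundamentalGroup.fromPath
          (Path.Homotopic.Quotient.mk ((γ.trans δ).trans (γ'.trans δ).symm)) =
        FundamentalGroup.fromPath (Path.Homotopic.Quotient.mk (γ.trans γ'.symm)) := by
      rw [Path.trans_symm]
      simp only [Path.Homotopic.Quotient.mk_trans, Path.Homotopic.Quotient.mk_symm]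
      rw [Path.Homotopic.Quotient.trans_assoc, ← Path.Homotopic.Quotient.trans_assoc
        (Path.Homotopic.Quotient.mk δ), Path.Homotopic.Quotient.trans_symm,
        Path.Homotopic.Quotient.refl_trans]
    change _ ∈ _
    rw [this]; exact h) P.cls⟩

/-- The usual topology of a cover: a neighbourhood of `P` consists of the prolongations of `P`
along paths that stay in an open set `V`. -/
instance : TopologicalSpace (AbelianCover x₀) :=
  TopologicalSpace.generateFrom
    {S | ∃ (P : AbelianCover x₀) (V : Set X), IsOpen V ∧ P.pt ∈ V ∧
      S = {Q | ∃ (y : X) (δ : Path P.pt y), (∀ t, δ t ∈ V) ∧ Q = P.append δ}}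

end AbelianCover

end AbelianCover

/-! ### Holomorphic functions on a space spread over a complex vector space -/

section Spread

variable {M E : Type*} [TopologicalSpace M] [NormedAddCommGroup E] [NormedSpace ℂ E]

/-- `e` is a local chart at `P` of the space `M` spread over `E` by `π`: a homeomorphism from an
open neighbourhood of `P` onto an open subset of `E` which is the restriction of `π`. -/
def IsSpreadChart (π : M → E) (P : M) (e : OpenPartialHomeomorph M E) : Prop :=
  P ∈ e.source ∧ Set.EqOn e π e.source

/-- `M` is spread over `E` by `π` (i.e. `π` is a local homeomorphism) and `F` is holomorphic for
the complex structure which `M` inherits from `E`. -/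
def IsHolomorphicOver (π : M → E) (F : M → ℂ) : Prop :=
  ∀ P, ∃ e : OpenPartialHomeomorph M E, IsSpreadChart π P e ∧ AnalyticAt ℂ (F ∘ e.symm) (π P)

/-- `F` has different germs at different points of `M` over the same point of `E`. -/
def SeparatesFibres (π : M → E) (F : M → ℂ) : Prop :=
  ∀ (P Q : M) (e e' : OpenPartialHomeomorph M E), IsSpreadChart π P e → IsSpreadChart π Q e' →
    π P = π Q → F ∘ e.symm =ᶠ[𝓝 (π P)] F ∘ e'.symm → P = Q

/-- No germ of `F` can be continued meromorphically outside `U`: if a germ of `F` at some point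
`P` is the germ of a meromorphic function `g / h` on a connected open set `V ∋ π P`, then
`V ⊆ U`. -/
def NoMeromorphicContinuationBeyond (π : M → E) (F : M → ℂ) (U : Set E) : Prop :=
  ∀ (P : M) (e : OpenPartialHomeomorph M E) (V : Set E) (g h : E → ℂ),
    IsSpreadChart π P e → IsOpen V → IsPreconnected V → π P ∈ V →
    AnalyticOnNhd ℂ g V → AnalyticOnNhd ℂ h V → (∃ v ∈ V, h v ≠ 0) →
    (∀ᶠ v in 𝓝 (π P), h v * F (e.symm v) = g v) → V ⊆ U

end Spread

/-! ### The function `ζ_k` and its domains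

The index `j = 1, …, k` is represented by `j : Fin k`, standing for `j + 1`. -/

/-- The set of `a` in `ℂᵏ` such that no coordinate is of the form `l / k` with `l` an integer. -/
def aDomain (k : ℕ) : Set (Fin k → ℂ) :=
  {a | ∀ (j : Fin k) (l : ℤ), a j ≠ l / k}

/-- The set of `z` in `ℂᵏ` such that the `j`-th coordinate is not of the form `-pk - j` with
`p = 0, 1, 2, …`. -/
def zDomain (k : ℕ) : Set (Fin k → ℂ) :=
  {z | ∀ (j : Fin k) (p : ℕ), z j ≠ -(p * k : ℂ) - (j + 1 : ℂ)}

/-- The term with number `n + 1` of the series `ζ_k(a, z, s)`. -/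
noncomputable def lerchLipschitzTerm (k : ℕ) [NeZero k] (a z : Fin k → ℂ) (s : ℂ) (n : ℕ) : ℂ :=
  exp (2 * Real.pi * I * (n + 1) * a (Fin.ofNat k n)) / ((n + 1) + z (Fin.ofNat k n)) ^ s

/-- The projection of the product of the two covers and `ℂ` to `ℂᵏ × ℂᵏ × ℂ`. -/
def coverProj {k : ℕ} (a₀ : aDomain k) (z₀ : zDomain k) :
    AbelianCover a₀ × AbelianCover z₀ × ℂ → (Fin k → ℂ) × (Fin k → ℂ) × ℂ :=
  fun P => (P.1.pt.1, P.2.1.pt.1, P.2.2)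

/-- The loop `σ` in `U` based at `x` runs once, counterclockwise, along the circle with centre `c`
in the plane of the `j`-th coordinate, the other coordinates being fixed; the radius of the circle
is less than `R`. -/
def IsCircleAround {k : ℕ} {U : Set (Fin k → ℂ)} (j : Fin k) (c : ℂ) (R : ℝ) {x : U}
    (σ : Path x x) : Prop :=
  ‖x.1 j - c‖ < R ∧
    ∀ t : unitInterval, (σ t).1 = Function.update x.1 j (c + (x.1 j - c) * exp (2 * Real.pi * I * t))

/-- The loop `σ` based at `x` is a simple positive loop around the hyperplane given by `c` in the
`j`-th coordinate: it goes along some path `τ`, then once counterclockwise around a circle of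
radius less than `R`, and returns along `τ`. -/
def IsMeridian {k : ℕ} {U : Set (Fin k → ℂ)} (j : Fin k) (c : ℂ) (R : ℝ) {x : U}
    (σ : Path x x) : Prop :=
  ∃ (y : U) (τ : Path x y) (ω : Path y y), IsCircleAround j c R ω ∧
    σ = (τ.trans ω).trans τ.symm

/-- `θ` is the continuous branch of `log (γ_j - c)` along the path `γ` which starts with the
principal value. -/
def IsLogAlong {k : ℕ} {U : Set (Fin k → ℂ)} (j : Fin k) (c : ℂ) {x y : U} (γ : Path x y)
    (θ : C(unitInterval, ℂ)) : Prop :=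
  θ 0 = log (x.1 j - c) ∧ ∀ t, exp (θ t) = (γ t).1 j - c

/-! Sorting the series by the residue of `n` modulo `k`, with `n = pk + j`, gives `ζ_k = k^{-s} ∑_j
e^{2πi j a_j} Φ(k a_j, (z_j + j)/k, s)`, where `Φ(x, w, s) = ∑_p e^{2πipx} (p + w)^{-s}` is the
Lerch function. So the theorem is about `Φ` for `x` off the integers and `w` off the integers `≤ 0`.

For `Re w, Re s > 0` the Mellin integral `Γ(s)⁻¹ ∫ t^{s-1} e^{-wt} / (1 - e^{2πix-t}) dt` is
analytic in `x` on the plane cut downward from the integers (`analyticAt_lerchInt`). The operator `w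
+ (2πi)⁻¹ ∂_x`, applied to `Φ` at `s + 1`, gives `Φ` at `s` (`lerchOp_lerchInt`), and its iterates
reach all `s`. When `x` crosses the cut below `l`, the pole `y = 2πi(x - l)` of the integrand
crosses the ray of integration, and `Φ` jumps by the residue term `2πi Γ(s)⁻¹ y^{s-1} e^{-wy}`
(`exists_lerchInt_crossing`).

Continuation along paths is replaced by an explicit formula. A turn around `l` multiplies the
residue term by `e^{2πis}`, so `n` turns subtract the residue term times the `q`-integer `1 + q + ⋯
+ q^{n-1}`, `q = e^{2πis}`. Hence the continued `Φ` depends only on the continued logarithms of `x -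
l` (`lerchMulti`). In `w` one splits off finitely many terms `e^{2πipx}(w + p)^{-s}`, which need
only the logarithms of `w + p` (`lerchFull`). Increments of logarithms are homomorphisms from the
fundamental group to an abelian group, so these logarithms live on the maximal abelian covers. Thus
`zetaCont` is single-valued there; it is holomorphic by a local check, and its monodromy is algebra
in the logarithms.

The logarithms also determine a point of the cover (`AbelianCover.ext_of_logAlong`): the fundamental
group of the punctured plane is generated by loops around the punctures, so a loop with zero
increments is a product of commutators. Equal germs have equal monodromy along every loop, and for
non-real `s` the monodromy determines the logarithm; this separates the fibres. Finally, a quotient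
`g / h` near a point with `a_j = l/k` or `z_j = -pk - j` would be unchanged along a small circle
around that hyperplane, whereas the monodromy is nonzero for non-real `s`; so no meromorphic
continuation reaches these points. -/

/-! ### Increments of logarithms along paths -/

section LogIncrement

variable {X : Type*} [TopologicalSpace X]

/-- The continuous logarithm of `f` along the path `γ` which starts with the principal value. -/
noncomputable def logLift (f : C(X, {z : ℂ // z ≠ 0})) {x y : X} (γ : Path x y) :
    C(unitInterval, ℂ) :=
  Complex.isCoveringMap_exp.liftPath (γ.map f.continuous).toContinuousMap (log (f x).1)
    (by ext; simp [exp_log (f x).2])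

/-- The increment of `log f` along the path `γ`. -/
noncomputable def logInc (f : C(X, {z : ℂ // z ≠ 0})) {x y : X} (γ : Path x y) : ℂ :=
  logLift f γ 1 - log (f x).1

variable (f : C(X, {z : ℂ // z ≠ 0})) {x y z : X}

lemma logLift_zero (γ : Path x y) : logLift f γ 0 = log (f x).1 :=
  Complex.isCoveringMap_exp.liftPath_zero _ _ _

lemma exp_logLift (γ : Path x y) (t : unitInterval) : exp (logLift f γ t) = (f (γ t)).1 :=
  congrArg Subtype.val (congrFun (Complex.isCoveringMap_exp.liftPath_lifts
    (γ.map f.continuous).toContinuousMap (log (f x).1) (by ext; simp [exp_log (f x).2])) t)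

/-- Shifted by a constant, `θ` starts at the principal value, and then uniqueness of lifts through
`exp` identifies it with `logLift`. -/
lemma logInc_eq {γ : Path x y} {θ : unitInterval → ℂ} (hθ : Continuous θ)
    (h : ∀ t, exp (θ t) = (f (γ t)).1) : logInc f γ = θ 1 - θ 0 := by
  have key : (fun t => θ t + (log (f x).1 - θ 0)) = logLift f γ := by
    refine (Complex.isCoveringMap_exp.eq_liftPath_iff _).2 ⟨by fun_prop, ?_, by simp⟩
    funext t
    ext
    simp only [Function.comp_apply, exp_add, exp_sub, h, exp_log (f x).2]
    rw [Path.source, div_self (f x).2, mul_one]; rfl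
  rw [logInc, ← key]; ring

/-- The free starting value `w` allows the logarithm along a second path to begin where the one
along the first path ended. -/
lemma exists_log_along (γ : Path x y) {w : ℂ} (hw : exp w = (f x).1) :
    ∃ θ : C(unitInterval, ℂ), θ 0 = w ∧ (∀ t, exp (θ t) = (f (γ t)).1) ∧
      θ 1 = w + logInc f γ := by
  let θ : C(unitInterval, ℂ) := ⟨fun t => logLift f γ t + (w - log (f x).1), by fun_prop⟩
  refine ⟨θ, by simp [θ, logLift_zero], fun t => ?_, by simp [θ, logInc]; ring⟩
  simp only [θ, ContinuousMap.coe_mk, exp_add, exp_sub, exp_logLift, hw, exp_log (f x).2]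
  rw [div_self (f x).2, mul_one]

lemma logInc_congr {γ γ' : Path x y} (h : γ.Homotopic γ') : logInc f γ = logInc f γ' := by
  unfold logInc logLift
  congr 1
  exact Complex.isCoveringMap_exp.liftPath_apply_one_eq_of_homotopicRel
    (h.map f) _ _ _

lemma logInc_trans (γ : Path x y) (δ : Path y z) :
    logInc f (γ.trans δ) = logInc f γ + logInc f δ := by
  obtain ⟨θ, h0, hθ, h1⟩ := exists_log_along f γ (exp_log (f x).2)
  have hy : exp (θ 1) = (f y).1 := by rw [hθ]; simp
  obtain ⟨φ, k0, hφ, k1⟩ := exists_log_along f δ hy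
  let p : Path (θ 0) (θ 1) := ⟨θ, rfl, rfl⟩
  let q : Path (θ 1) (φ 1) := ⟨φ, k0, rfl⟩
  have : logInc f (γ.trans δ) = (p.trans q) 1 - (p.trans q) 0 := by
    refine logInc_eq f (p.trans q).continuous fun t => ?_
    rw [Path.trans_apply, Path.trans_apply]
    split_ifs
    · exact hθ _
    · exact hφ _
  rw [this, Path.target, Path.source, k1, h1, h0]; ring

lemma logInc_refl : logInc f (Path.refl x) = 0 := by
  rw [logInc_eq f (θ := fun _ => log (f x).1) continuous_const (fun t => exp_log (f x).2)]; simp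

lemma logInc_symm (γ : Path x y) : logInc f γ.symm = -logInc f γ := by
  have h := logInc_trans f γ γ.symm
  rw [← logInc_congr f ⟨Path.Homotopy.reflTransSymm γ⟩, logInc_refl] at h
  linear_combination -h

lemma exp_logInc (γ : Path x y) : exp (logInc f γ) = (f y).1 / (f x).1 := by
  rw [logInc, exp_sub, exp_logLift, exp_log (f x).2, Path.target]

/-- The increment of `log f` as a homomorphism on the fundamental group. -/
noncomputable def logIncHom (x : X) : FundamentalGroup X x →* Multiplicative ℂ where
  toFun g := Multiplicative.ofAdd (Quotient.lift (s := Path.Homotopic.setoid x x)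
    (fun γ => logInc f γ) (fun _ _ h => logInc_congr f h) (FundamentalGroup.toPath g))
  map_one' := by
    change Multiplicative.ofAdd (logInc f (Path.refl x)) = _
    rw [logInc_refl]; rfl
  map_mul' p q := by
    obtain ⟨γ, rfl⟩ := Path.Homotopic.Quotient.mk_surjective p
    obtain ⟨δ, rfl⟩ := Path.Homotopic.Quotient.mk_surjective q
    -- The product in `FundamentalGroup` traverses its right factor first; the order is harmless
    -- because the target is commutative.
    change Multiplicative.ofAdd (logInc f (δ.trans γ)) =
      Multiplicative.ofAdd (logInc f γ) * Multiplicative.ofAdd (logInc f δ)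
    rw [logInc_trans, ← ofAdd_add, add_comm]

lemma logIncHom_mk (γ : Path x x) :
    logIncHom f x (FundamentalGroup.fromPath (Path.Homotopic.Quotient.mk γ)) =
      Multiplicative.ofAdd (logInc f γ) := rfl

/-- A homomorphism to a commutative group kills commutators. This is what makes logarithms
single-valued on the maximal abelian cover. -/
lemma logInc_eq_of_abelian {γ δ : Path x y} (h : (abelianSetoid x y) γ δ) :
    logInc f γ = logInc f δ := by
  have h' := Abelianization.commutator_subset_ker (logIncHom f x) h
  rw [MonoidHom.mem_ker, logIncHom_mk, logInc_trans, logInc_symm] at h'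
  have : logInc f γ + -logInc f δ = 0 := h'
  linear_combination this

end LogIncrement

/-! ### Basic properties of the maximal abelian cover -/

namespace AbelianCover

variable {X : Type*} [TopologicalSpace X] {x₀ : X}

lemma ofPath_eq_iff {x : X} {γ δ : Path x₀ x} :
    ofPath γ = ofPath δ ↔ (abelianSetoid x₀ x) γ δ := by
  constructor
  · intro h
    simp only [ofPath, AbelianCover.mk.injEq, heq_eq_eq, true_and] at h
    exact Quotient.exact h
  · intro h
    unfold ofPath
    rw [Quotient.sound h]

lemma ofPath_congr {x : X} {γ δ : Path x₀ x} (h : γ.Homotopic δ) : ofPath γ = ofPath δ := by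
  unfold ofPath
  congr 1
  refine Quotient.sound ?_
  change FundamentalGroup.fromPath _ ∈ _
  rw [Path.Homotopic.Quotient.mk_trans, Path.Homotopic.Quotient.eq.2 h,
    Path.Homotopic.Quotient.mk_symm, Path.Homotopic.Quotient.trans_symm]
  exact one_mem _

lemma append_congr (P : AbelianCover x₀) {y : X} {δ ε : Path P.pt y} (h : δ.Homotopic ε) :
    P.append δ = P.append ε := by
  obtain ⟨x, c⟩ := P
  obtain ⟨γ, rfl⟩ := Quotient.exists_rep c
  exact ofPath_congr ((Path.Homotopic.refl γ).hcomp h)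

lemma append_refl (P : AbelianCover x₀) : P.append (Path.refl P.pt) = P := by
  obtain ⟨x, c⟩ := P
  obtain ⟨γ, rfl⟩ := Quotient.exists_rep c
  exact ofPath_congr ⟨Path.Homotopy.transRefl γ⟩

lemma append_append (P : AbelianCover x₀) {y z : X} (δ : Path P.pt y) (ε : Path y z) :
    (P.append δ).append ε = P.append (δ.trans ε) := by
  obtain ⟨x, c⟩ := P
  obtain ⟨γ, rfl⟩ := Quotient.exists_rep c
  exact ofPath_congr ⟨Path.Homotopy.transAssoc γ δ ε⟩

variable (f : C(X, {z : ℂ // z ≠ 0}))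

/-- The logarithm of `f`, continued to the maximal abelian cover from its principal value. -/
noncomputable def logAlong (P : AbelianCover x₀) : ℂ :=
  log (f x₀).1 + Quotient.lift (fun γ : Path x₀ P.pt => logInc f γ)
    (fun _ _ h => logInc_eq_of_abelian f h) P.cls

lemma logAlong_ofPath {x : X} (γ : Path x₀ x) :
    logAlong f (ofPath γ) = log (f x₀).1 + logInc f γ := rfl

lemma logAlong_append (P : AbelianCover x₀) {y : X} (δ : Path P.pt y) :
    logAlong f (P.append δ) = logAlong f P + logInc f δ := by
  obtain ⟨x, c⟩ := P
  obtain ⟨γ, rfl⟩ := Quotient.exists_rep c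
  change logAlong f (ofPath (γ.trans δ)) = logAlong f (ofPath γ) + _
  rw [logAlong_ofPath, logAlong_ofPath, logInc_trans, add_assoc]

lemma exp_logAlong (P : AbelianCover x₀) : exp (logAlong f P) = (f P.pt).1 := by
  obtain ⟨x, c⟩ := P
  obtain ⟨γ, rfl⟩ := Quotient.exists_rep c
  change exp (logAlong f (ofPath γ)) = _
  rw [logAlong_ofPath, exp_add, exp_logInc, exp_log (f x₀).2, mul_div_cancel₀ _ (f x₀).2]

end AbelianCover

/-! ### Charts of the maximal abelian cover -/

namespace AbelianCover

section Basis

variable {X : Type*} [TopologicalSpace X] {x₀ : X}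

lemma _root_.Path.trans_mem {x y z : X} {δ : Path x y} {ε : Path y z} {V : Set X}
    (hδ : ∀ t, δ t ∈ V) (hε : ∀ t, ε t ∈ V) (t : unitInterval) : (δ.trans ε) t ∈ V := by
  rw [Path.trans_apply]
  split_ifs
  · exact hδ _
  · exact hε _

/-- The prolongations of `P` along paths that stay in `V`. -/
def sheet (P : AbelianCover x₀) (V : Set X) : Set (AbelianCover x₀) :=
  {Q | ∃ (y : X) (δ : Path P.pt y), (∀ t, δ t ∈ V) ∧ Q = P.append δ}

lemma mem_sheet_self (P : AbelianCover x₀) {V : Set X} (h : P.pt ∈ V) : P ∈ P.sheet V :=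
  ⟨_, Path.refl _, fun _ => h, (append_refl P).symm⟩

lemma sheet_subset {P Q : AbelianCover x₀} {V W : Set X} (hQ : Q ∈ P.sheet V) (hW : W ⊆ V) :
    Q.sheet W ⊆ P.sheet V := by
  rintro R ⟨z, ε, hε, rfl⟩
  obtain ⟨y, δ, hδ, rfl⟩ := hQ
  exact ⟨z, δ.trans ε, Path.trans_mem hδ fun t => hW (hε t), append_append P δ ε⟩

lemma pt_mem_of_mem_sheet {P Q : AbelianCover x₀} {V : Set X} (hQ : Q ∈ P.sheet V) : Q.pt ∈ V := by
  obtain ⟨y, δ, hδ, rfl⟩ := hQ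
  have := hδ 1
  rwa [Path.target] at this

/-- A sheet can be recentred at any of its points, so two sheets with a common point contain the
sheet of that point over the intersection of the two open sets. -/
lemma isTopologicalBasis_sheets : TopologicalSpace.IsTopologicalBasis
    {S | ∃ (P : AbelianCover x₀) (V : Set X), IsOpen V ∧ P.pt ∈ V ∧ S = P.sheet V} where
  exists_subset_inter := by
    rintro _ ⟨P, V, hV, -, rfl⟩ _ ⟨P', V', hV', -, rfl⟩ Q ⟨hQ, hQ'⟩
    have hq : Q.pt ∈ V ∩ V' := ⟨pt_mem_of_mem_sheet hQ, pt_mem_of_mem_sheet hQ'⟩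
    exact ⟨Q.sheet (V ∩ V'), ⟨Q, _, hV.inter hV', hq, rfl⟩, mem_sheet_self Q hq,
      fun R hR => ⟨sheet_subset hQ Set.inter_subset_left hR,
        sheet_subset hQ' Set.inter_subset_right hR⟩⟩
  sUnion_eq := by
    refine Set.eq_univ_of_forall fun P => ⟨P.sheet Set.univ, ⟨P, _, isOpen_univ, trivial, rfl⟩,
      mem_sheet_self P trivial⟩
  eq_generateFrom := rfl

lemma isOpen_sheet (P : AbelianCover x₀) {V : Set X} (hV : IsOpen V) (hP : P.pt ∈ V) :
    IsOpen (P.sheet V) :=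
  isTopologicalBasis_sheets.isOpen ⟨P, V, hV, hP, rfl⟩

lemma mem_nhds_iff_sheet {P : AbelianCover x₀} {S : Set (AbelianCover x₀)} :
    S ∈ 𝓝 P ↔ ∃ V, IsOpen V ∧ P.pt ∈ V ∧ P.sheet V ⊆ S := by
  constructor
  · intro h
    obtain ⟨_, ⟨Q, V, hV, -, rfl⟩, hP, hS⟩ := isTopologicalBasis_sheets.mem_nhds_iff.1 h
    exact ⟨V, hV, pt_mem_of_mem_sheet hP, (sheet_subset hP subset_rfl).trans hS⟩
  · rintro ⟨V, hV, hP, hS⟩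
    exact Filter.mem_of_superset ((isOpen_sheet P hV hP).mem_nhds (mem_sheet_self P hP)) hS

lemma continuous_pt : Continuous (fun P : AbelianCover x₀ => P.pt) := by
  rw [continuous_iff_continuousAt]
  intro P S hS
  obtain ⟨V, hVS, hV, hP⟩ := mem_nhds_iff.1 hS
  exact mem_nhds_iff_sheet.2 ⟨V, hV, hP, fun Q hQ => hVS (pt_mem_of_mem_sheet hQ)⟩

/-- The prolongation of `P` along the part of `γ` up to the parameter `t`. -/
noncomputable def liftPath (P : AbelianCover x₀) {y : X} (γ : Path P.pt y) (t : unitInterval) :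
    AbelianCover x₀ :=
  P.append ((γ.subpath 0 t).cast γ.source.symm rfl)

lemma append_cast_target (P : AbelianCover x₀) {y z : X} (γ : Path P.pt y) (h : z = y) :
    P.append (γ.cast rfl h) = P.append γ := by
  subst h; rfl

lemma liftPath_zero (P : AbelianCover x₀) {y : X} (γ : Path P.pt y) : P.liftPath γ 0 = P := by
  have : (γ.subpath 0 0).cast γ.source.symm rfl =
      (Path.refl P.pt).cast rfl γ.source := by
    ext t; simp
  rw [liftPath, this, append_cast_target, append_refl]

lemma liftPath_one (P : AbelianCover x₀) {y : X} (γ : Path P.pt y) :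
    P.liftPath γ 1 = P.append γ := by
  have : (γ.subpath 0 1).cast γ.source.symm rfl = γ.cast rfl γ.target := by
    ext t; simp
  rw [liftPath, this, append_cast_target]

lemma liftPath_append (P : AbelianCover x₀) {y : X} (γ : Path P.pt y) (s t : unitInterval) :
    (P.liftPath γ s).append (γ.subpath s t) = P.liftPath γ t := by
  unfold liftPath
  rw [append_append]
  refine append_congr P ?_
  exact Path.Homotopic.pathCast ⟨Path.Homotopy.subpathTransSubpath γ 0 s t⟩ γ.source.symm rfl

/-- The subpath has the same image as the interval between `s` and `t`, which is as close to `s` as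
`t` is. -/
lemma _root_.Path.eventually_subpath_mem {x y : X} (γ : Path x y) (s : unitInterval) {V : Set X}
    (hV : IsOpen V) (hs : γ s ∈ V) : ∀ᶠ t in 𝓝 s, ∀ u, γ.subpath s t u ∈ V := by
  obtain ⟨ε, hε, hball⟩ := Metric.isOpen_iff.1 (hV.preimage γ.continuous) s hs
  refine Filter.mem_of_superset (Metric.ball_mem_nhds s hε) fun t ht u => ?_
  obtain ⟨v, hv, hvu⟩ : γ.subpath s t u ∈ γ '' Set.uIcc s t := by
    rw [← Path.range_subpath]; exact ⟨u, rfl⟩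
  rw [← hvu]
  refine hball ?_
  have h1 : |(v : ℝ) - s| ≤ |(t : ℝ) - s| := by
    rcases le_total s t with hst | hst
    · rw [Set.uIcc_of_le hst] at hv
      have a : (s : ℝ) ≤ v := hv.1
      have b : (v : ℝ) ≤ t := hv.2
      rw [abs_of_nonneg (by linarith), abs_of_nonneg (by linarith)]; linarith
    · rw [Set.uIcc_of_ge hst] at hv
      have a : (t : ℝ) ≤ v := hv.1
      have b : (v : ℝ) ≤ s := hv.2
      rw [abs_of_nonpos (by linarith), abs_of_nonpos (by linarith)]; linarith
  exact lt_of_le_of_lt h1 ht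

lemma continuous_liftPath (P : AbelianCover x₀) {y : X} (γ : Path P.pt y) :
    Continuous (P.liftPath γ) := by
  rw [continuous_iff_continuousAt]
  intro s S hS
  obtain ⟨V, hV, hP, hVS⟩ := mem_nhds_iff_sheet.1 hS
  refine Filter.mem_map.2 (Filter.mem_of_superset (γ.eventually_subpath_mem s hV hP) fun t ht => ?_)
  exact hVS ⟨γ t, γ.subpath s t, ht, (liftPath_append P γ s t).symm⟩

end Basis

section Chart

variable {E : Type*} [NormedAddCommGroup E] [NormedSpace ℝ E] {U S : Set E}

/-- The straight path in a convex subset `S` of `U`. -/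
noncomputable def segPath (hS : Convex ℝ S) (hSU : S ⊆ U) {x y : U} (hx : x.1 ∈ S) (hy : y.1 ∈ S) :
    Path x y where
  toFun t := ⟨AffineMap.lineMap x.1 y.1 (t : ℝ), hSU (hS.lineMap_mem hx hy t.2)⟩
  continuous_toFun := by
    refine Continuous.subtype_mk ?_ _
    exact AffineMap.lineMap_continuous.comp continuous_subtype_val
  source' := by ext; simp
  target' := by ext; simp

lemma segPath_mem (hS : Convex ℝ S) (hSU : S ⊆ U) {x y : U} (hx : x.1 ∈ S) (hy : y.1 ∈ S)
    (t : unitInterval) : (segPath hS hSU hx hy t).1 ∈ S :=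
  hS.lineMap_mem hx hy t.2

lemma homotopic_of_convex (hS : Convex ℝ S) (hSU : S ⊆ U) {x y : U} {γ δ : Path x y}
    (hγ : ∀ t, (γ t).1 ∈ S) (hδ : ∀ t, (δ t).1 ∈ S) : γ.Homotopic δ := by
  refine ⟨{ toFun := fun p => ⟨AffineMap.lineMap (γ p.2).1 (δ p.2).1 (p.1 : ℝ),
              hSU (hS.lineMap_mem (hγ _) (hδ _) p.1.2)⟩
            continuous_toFun := ?_
            map_zero_left := fun t => by ext; simp
            map_one_left := fun t => by ext; simp
            prop' := ?_ }⟩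
  · refine Continuous.subtype_mk ?_ _
    simp only [AffineMap.lineMap_apply_module]
    fun_prop
  · rintro s t (rfl | rfl) <;> ext <;> simp

variable {x₀ : U}

open Classical in
/-- The chart of the cover of `U` around `P` whose image is a ball contained in `U`. -/
noncomputable def chart (P : AbelianCover x₀) {r : ℝ} (hr : 0 < r)
    (hU : Metric.ball P.pt.1 r ⊆ U) : OpenPartialHomeomorph (AbelianCover x₀) E where
  toFun Q := Q.pt.1
  -- Off the ball the value `P` is a dummy, never seen by the chart.
  invFun v := if h : v ∈ Metric.ball P.pt.1 r then
    P.append (segPath (y := ⟨v, hU h⟩) (convex_ball P.pt.1 r) hU (Metric.mem_ball_self hr) h) else P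
  source := P.sheet (Subtype.val ⁻¹' Metric.ball P.pt.1 r)
  target := Metric.ball P.pt.1 r
  map_source' Q hQ := pt_mem_of_mem_sheet hQ
  map_target' v hv := by
    rw [dif_pos hv]
    exact ⟨_, _, fun t => segPath_mem _ hU _ _ t, rfl⟩
  left_inv' Q hQ := by
    have hv : Q.pt.1 ∈ Metric.ball P.pt.1 r := pt_mem_of_mem_sheet hQ
    rw [dif_pos hv]
    obtain ⟨y, δ, hδ, rfl⟩ := hQ
    -- Every path in the ball is homotopic to the segment with the same ends, so the prolongation
    -- depends on the end only.
    exact append_congr P (homotopic_of_convex (convex_ball _ _) hU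
      (fun t => segPath_mem _ hU _ _ t) hδ)
  right_inv' v hv := by
    simp only [dif_pos hv]; rfl
  open_source := isOpen_sheet P (Metric.isOpen_ball.preimage continuous_subtype_val)
    (Metric.mem_ball_self hr)
  open_target := Metric.isOpen_ball
  continuousOn_toFun := (continuous_subtype_val.comp continuous_pt).continuousOn
  continuousOn_invFun := by
    intro v hv
    refine ContinuousAt.continuousWithinAt fun S hS => ?_
    simp only [dif_pos hv] at hS
    obtain ⟨V, hV, hPV, hVS⟩ := mem_nhds_iff_sheet.1 hS
    obtain ⟨W, hW, rfl⟩ := isOpen_induced_iff.1 hV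
    have hvW : v ∈ W := hPV
    obtain ⟨ε, hε, hball⟩ := Metric.isOpen_iff.1 (hW.inter Metric.isOpen_ball) v ⟨hvW, hv⟩
    refine Filter.mem_map.2 (Filter.mem_of_superset (Metric.ball_mem_nhds v hε) fun w hw => ?_)
    have hwB : w ∈ Metric.ball P.pt.1 r := (hball hw).2
    have hsub : Metric.ball v ε ⊆ U := fun u hu => hU (hball hu).2
    refine Set.mem_preimage.2 (hVS ?_)
    rw [dif_pos hwB]
    refine ⟨⟨w, hU hwB⟩, segPath (convex_ball v ε) hsub (Metric.mem_ball_self hε) hw,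
      fun t => (hball (segPath_mem _ hsub _ _ t)).1, ?_⟩
    refine Eq.trans ?_ (append_append P _ _).symm
    -- The segment to `w` and the broken line through `v` both stay in the ball around `P`.
    refine append_congr P (homotopic_of_convex (convex_ball P.pt.1 r) hU
      (fun t => segPath_mem _ hU _ _ t) (Path.trans_mem (V := Subtype.val ⁻¹' Metric.ball P.pt.1 r)
        (fun t => segPath_mem _ hU _ _ t)
        fun t => (hball (segPath_mem (convex_ball v ε) hsub _ _ t)).2))

lemma mem_chart_source (P : AbelianCover x₀) {r : ℝ} (hr : 0 < r)
    (hU : Metric.ball P.pt.1 r ⊆ U) : P ∈ (P.chart hr hU).source :=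
  mem_sheet_self P (Metric.mem_ball_self hr)

lemma chart_symm_apply (P : AbelianCover x₀) {r : ℝ} (hr : 0 < r)
    (hU : Metric.ball P.pt.1 r ⊆ U) {v : E} (hv : v ∈ Metric.ball P.pt.1 r) :
    (P.chart hr hU).symm v = P.append (segPath (y := ⟨v, hU hv⟩) (convex_ball P.pt.1 r) hU
      (Metric.mem_ball_self hr) hv) :=
  dif_pos hv

end Chart

end AbelianCover

/-! ### Generators of the fundamental group of a plane with punctures at integers -/

section PathClasses

variable {X : Type*} [TopologicalSpace X] {x₀ : X}

/-- The class of the loop `γ · δ⁻¹` lies in the subgroup `N` of the fundamental group. -/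
def PathRel (N : Subgroup (FundamentalGroup X x₀)) {x : X} (γ δ : Path x₀ x) : Prop :=
  FundamentalGroup.fromPath (Path.Homotopic.Quotient.mk (γ.trans δ.symm)) ∈ N

namespace PathRel

variable {N : Subgroup (FundamentalGroup X x₀)} {x y : X} {γ δ ε : Path x₀ x}

lemma of_homotopic (h : γ.Homotopic δ) : PathRel N γ δ := by
  unfold PathRel
  rw [Path.Homotopic.Quotient.mk_trans, Path.Homotopic.Quotient.eq.2 h,
    Path.Homotopic.Quotient.mk_symm, Path.Homotopic.Quotient.trans_symm]
  exact one_mem _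

lemma symm (h : PathRel N γ δ) : PathRel N δ γ := by
  have : FundamentalGroup.fromPath (Path.Homotopic.Quotient.mk (δ.trans γ.symm)) =
      (FundamentalGroup.fromPath (Path.Homotopic.Quotient.mk (γ.trans δ.symm)))⁻¹ := by
    rw [FundamentalGroup.inv_def]
    change _ = Path.Homotopic.Quotient.symm (Path.Homotopic.Quotient.mk (γ.trans δ.symm))
    rw [← Path.Homotopic.Quotient.mk_symm, Path.trans_symm, Path.symm_symm]
  unfold PathRel
  rw [this]; exact inv_mem h

lemma trans (h₁ : PathRel N γ δ) (h₂ : PathRel N δ ε) : PathRel N γ ε := by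
  have : FundamentalGroup.fromPath (Path.Homotopic.Quotient.mk (γ.trans ε.symm)) =
      (FundamentalGroup.fromPath (Path.Homotopic.Quotient.mk (δ.trans ε.symm))) *
      (FundamentalGroup.fromPath (Path.Homotopic.Quotient.mk (γ.trans δ.symm))) := by
    rw [FundamentalGroup.mul_def]
    simp only [Path.Homotopic.Quotient.mk_trans, Path.Homotopic.Quotient.mk_symm]
    rw [Path.Homotopic.Quotient.trans_assoc, ← Path.Homotopic.Quotient.trans_assoc _ _
      (Path.Homotopic.Quotient.mk ε).symm, Path.Homotopic.Quotient.symm_trans,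
      Path.Homotopic.Quotient.refl_trans]
  unfold PathRel
  rw [this]; exact mul_mem h₂ h₁

lemma append_iff (η : Path x y) : PathRel N (γ.trans η) (δ.trans η) ↔ PathRel N γ δ := by
  have : FundamentalGroup.fromPath
        (Path.Homotopic.Quotient.mk ((γ.trans η).trans (δ.trans η).symm)) =
      FundamentalGroup.fromPath (Path.Homotopic.Quotient.mk (γ.trans δ.symm)) := by
    rw [Path.trans_symm]
    simp only [Path.Homotopic.Quotient.mk_trans, Path.Homotopic.Quotient.mk_symm]
    rw [Path.Homotopic.Quotient.trans_assoc, ← Path.Homotopic.Quotient.trans_assoc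
      (Path.Homotopic.Quotient.mk η), Path.Homotopic.Quotient.trans_symm,
      Path.Homotopic.Quotient.refl_trans]
  unfold PathRel
  rw [this]

end PathRel

end PathClasses

/-! ### Paths inside a simply connected subset. -/

section SimplyConnectedSubset

variable {E : Type*} [TopologicalSpace E] {U S : Set E}

lemma homotopic_of_simplyConnected [SimplyConnectedSpace S] (hSU : S ⊆ U) {x y : U}
    {γ δ : Path x y} (hγ : ∀ t, (γ t).1 ∈ S) (hδ : ∀ t, (δ t).1 ∈ S) : γ.Homotopic δ := by
  have hx : x.1 ∈ S := by simpa using hγ 0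
  have hy : y.1 ∈ S := by simpa using hγ 1
  let lift (ε : Path x y) (hε : ∀ t, (ε t).1 ∈ S) : Path (⟨x.1, hx⟩ : S) ⟨y.1, hy⟩ :=
    { toFun := fun t => ⟨(ε t).1, hε t⟩
      continuous_toFun := by fun_prop
      source' := by ext; simp
      target' := by ext; simp }
  let incl : C(S, U) := ⟨Set.inclusion hSU, continuous_inclusion hSU⟩
  have := (SimplyConnectedSpace.paths_homotopic (lift γ hγ) (lift δ hδ)).map incl
  exact this

lemma exists_path_of_simplyConnected [SimplyConnectedSpace S] (hSU : S ⊆ U) {x y : U}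
    (hx : x.1 ∈ S) (hy : y.1 ∈ S) : ∃ γ : Path x y, ∀ t, (γ t).1 ∈ S := by
  let p : Path (⟨x.1, hx⟩ : S) ⟨y.1, hy⟩ := PathConnectedSpace.somePath _ _
  exact ⟨p.map (f := Set.inclusion hSU) (continuous_inclusion hSU), fun t => (p t).2⟩

end SimplyConnectedSubset

/-! ### The punctured plane as a union of two contractible cut planes. -/

/-- The complex plane without the integers in `T`. -/
def puncturedPlane (T : Set ℤ) : Set ℂ := {y | ∀ l ∈ T, y ≠ (l : ℂ)}

/-- The complex plane cut along the vertical rays that start at the integers in `T` and go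
downward if `ε = 1` and upward if `ε = -1`. -/
def cutPlane (ε : ℝ) (T : Set ℤ) : Set ℂ := {y | ∀ l ∈ T, ¬(y.re = l ∧ ε * y.im ≤ 0)}

section Punctured

variable {T : Set ℤ} {ε : ℝ}

lemma cutPlane_subset : cutPlane ε T ⊆ puncturedPlane T := by
  rintro y hy l hl rfl
  exact hy l hl ⟨by simp, by simp⟩

/-- Any set of integers is closed in `ℝ`, so even infinitely many vertical rays have a closed union.
-/
lemma isOpen_cutPlane (ε : ℝ) (T : Set ℤ) : IsOpen (cutPlane ε T) := by
  have h1 : IsClosed (((↑) : ℤ → ℝ) '' T) :=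
    Int.isClosedEmbedding_coe_real.isClosedMap _ (isClosed_discrete T)
  have : (cutPlane ε T)ᶜ = (re ⁻¹' (((↑) : ℤ → ℝ) '' T)) ∩ {y | ε * y.im ≤ 0} := by
    ext y
    simp only [cutPlane, Set.mem_compl_iff, Set.mem_ofPred_eq, not_forall, not_not,
      Set.mem_inter_iff, Set.mem_preimage, Set.mem_image]
    constructor
    · rintro ⟨l, hl, h1, h2⟩; exact ⟨⟨l, hl, h1.symm⟩, h2⟩
    · rintro ⟨⟨l, hl, h1⟩, h2⟩; exact ⟨l, hl, h1.symm, h2⟩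
  rw [← isClosed_compl_iff, this]
  exact (h1.preimage continuous_re).inter
    (isClosed_le (continuous_const.mul continuous_im) continuous_const)

lemma puncturedPlane_eq_union : puncturedPlane T = cutPlane 1 T ∪ cutPlane (-1) T := by
  refine subset_antisymm (fun y hy => ?_) (Set.union_subset cutPlane_subset cutPlane_subset)
  by_contra h
  simp only [cutPlane, Set.mem_union, Set.mem_ofPred_eq, not_or, not_forall, not_not] at h
  obtain ⟨⟨l, hl, h1, h2⟩, ⟨l', hl', h3, h4⟩⟩ := h
  refine hy l hl (Complex.ext (by simpa using h1) ?_)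
  simp only [intCast_im]
  linarith

/-- Moving vertically away from the cuts never meets them; this brings every point into the
half-plane `ε Im y > 0`, which is convex and disjoint from the cuts, and a straight homotopy to `εi`
finishes. -/
lemma contractible_cutPlane (hε : ε = 1 ∨ ε = -1) : ContractibleSpace (cutPlane ε T) := by
  have hε2 : ε * ε = 1 := by rcases hε with rfl | rfl <;> norm_num
  rw [contractible_iff_id_nullhomotopic]
  have hup : ∀ y : ℂ, 0 < ε * y.im → y ∈ cutPlane ε T := fun y hy l _ h => not_le.2 hy h.2
  have himH (y : ℂ) (s : ℝ) : ε * (y + s * (|y.im| + 1 : ℝ) * ε * I).im =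
      ε * y.im + s * (|y.im| + 1) := by
    have : (y + s * (|y.im| + 1 : ℝ) * ε * I).im = y.im + s * (|y.im| + 1) * ε := by
      simp [Complex.add_im, Complex.mul_im]
    rw [this]; linear_combination s * (|y.im| + 1) * hε2
  have hreH (y : ℂ) (s : ℝ) : (y + s * (|y.im| + 1 : ℝ) * ε * I).re = y.re := by
    simp
  have habs (y : ℂ) : -|y.im| ≤ ε * y.im := by
    rcases hε with rfl | rfl
    · linarith [neg_abs_le y.im]
    · linarith [le_abs_self y.im]
  -- The displacement `|Im y| + 1` makes `ε Im` at least `1`, wherever the point started.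
  let g : C(cutPlane ε T, cutPlane ε T) :=
    ⟨fun y => ⟨y.1 + (1 : ℝ) * (|y.1.im| + 1 : ℝ) * ε * I, hup _ (by
      rw [himH]; linarith [habs y.1])⟩, by
      refine Continuous.subtype_mk ?_ _
      fun_prop⟩
  let pt : cutPlane ε T := ⟨ε * I, hup _ (by simp [hε2])⟩
  refine ⟨pt, ContinuousMap.Homotopic.trans (g := g) ?_ ?_⟩
  · refine ⟨{ toFun := fun p => ⟨p.2.1 + (p.1 : ℝ) * (|p.2.1.im| + 1 : ℝ) * ε * I, ?_⟩
              continuous_toFun := ?_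
              map_zero_left := fun y => by ext; simp
              map_one_left := fun y => by ext; simp [g] }⟩
    · intro l hl h
      rw [himH, hreH] at h
      refine p.2.2 l hl ⟨h.1, ?_⟩
      have := mul_nonneg p.1.2.1 (by positivity : 0 ≤ |p.2.1.im| + 1)
      linarith [h.2]
    · refine Continuous.subtype_mk ?_ _
      fun_prop
  · refine ⟨{ toFun := fun p => ⟨(1 - (p.1 : ℝ) : ℝ) * (g p.2).1 + (p.1 : ℝ) * pt.1, ?_⟩
              continuous_toFun := ?_
              map_zero_left := fun y => by ext; simp
              map_one_left := fun y => by ext; simp }⟩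
    · have h1 : 0 < ε * (g p.2).1.im := by
        change 0 < ε * (p.2.1 + (1 : ℝ) * (|p.2.1.im| + 1 : ℝ) * ε * I).im
        rw [himH]; linarith [habs p.2.1]
      refine hup _ ?_
      have h2 : ε * pt.1.im = 1 := by simp [pt, hε2]
      have h3 : ((1 - (p.1 : ℝ) : ℝ) * (g p.2).1 + (p.1 : ℝ) * pt.1).im =
          (1 - (p.1 : ℝ)) * (g p.2).1.im + (p.1 : ℝ) * pt.1.im := by
        rw [add_im, im_ofReal_mul, im_ofReal_mul]
      rw [h3]
      have h4 : ε * ((1 - (p.1 : ℝ)) * (g p.2).1.im + (p.1 : ℝ) * pt.1.im) =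
          (1 - (p.1 : ℝ)) * (ε * (g p.2).1.im) + p.1 := by
        linear_combination (p.1 : ℝ) * h2
      rw [h4]
      rcases eq_or_lt_of_le p.1.2.1 with h0 | h0
      · rw [← h0]; linarith
      · have := mul_nonneg (sub_nonneg.2 p.1.2.2) h1.le
        linarith
    · refine Continuous.subtype_mk ?_ _
      fun_prop

instance : SimplyConnectedSpace (cutPlane 1 T) :=
  have := contractible_cutPlane (T := T) (ε := 1) (Or.inl rfl)
  inferInstance

instance : SimplyConnectedSpace (cutPlane (-1) T) :=
  have := contractible_cutPlane (T := T) (ε := -1) (Or.inr rfl)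
  inferInstance

/-- The part of the vertical strip `m ≤ Re y < m + 1` which does not meet the cuts. -/
def strip (T : Set ℤ) (m : ℤ) : Set ℂ := {y | m ≤ y.re ∧ y.re < m + 1 ∧ (m ∈ T → (m : ℝ) < y.re)}

lemma convex_strip (m : ℤ) : Convex ℝ (strip T m) := by
  have h : strip T m = (re ⁻¹' Set.Ico (m : ℝ) (m + 1)) ∩ ⋂ _ : m ∈ T, re ⁻¹' Set.Ioi (m : ℝ) := by
    ext y; simp [strip, and_assoc]
  rw [h]
  exact ((convex_Ico _ _).linear_preimage reLm).inter
    (convex_iInter fun _ => (convex_Ioi _).linear_preimage reLm)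

lemma strip_subset (m : ℤ) : strip T m ⊆ cutPlane ε T := by
  rintro y ⟨h1, h2, h3⟩ l hl ⟨h4, -⟩
  rw [h4] at h1 h2 h3
  have : l = m := by
    have a : m ≤ l := by exact_mod_cast h1
    have b : l < m + 1 := by exact_mod_cast h2
    omega
  subst this
  exact lt_irrefl _ (h3 hl)

lemma mem_strip {y : ℂ} (h1 : y ∈ cutPlane 1 T) (h2 : y ∈ cutPlane (-1) T) :
    y ∈ strip T ⌊y.re⌋ := by
  refine ⟨Int.floor_le _, Int.lt_floor_add_one _, fun hT => lt_of_le_of_ne (Int.floor_le _) ?_⟩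
  intro h
  rcases le_total y.im 0 with h3 | h3
  · exact h1 _ hT ⟨h.symm, by linarith⟩
  · exact h2 _ hT ⟨h.symm, by linarith⟩

/-- The midpoint of the interval between `m` and `m + 1`. -/
noncomputable def midPoint (T : Set ℤ) (m : ℤ) : puncturedPlane T :=
  ⟨(m + 1 / 2 : ℝ), cutPlane_subset (ε := 1) (strip_subset m ⟨by simp, by simp; norm_num, by simp⟩)⟩

lemma midPoint_mem_strip (m : ℤ) : (midPoint T m).1 ∈ strip T m :=
  ⟨by simp [midPoint], by simp [midPoint]; norm_num, by simp [midPoint]⟩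

variable {x₀ : puncturedPlane T} (hx₀ : x₀.1 ∈ cutPlane 1 T)

/-- A path from the base point to a midpoint avoiding the lower cuts. -/
noncomputable def lowPath (m : ℤ) : Path x₀ (midPoint T m) :=
  (exists_path_of_simplyConnected cutPlane_subset hx₀
    (strip_subset m (midPoint_mem_strip m))).choose

lemma lowPath_mem (m : ℤ) (t : unitInterval) : (lowPath hx₀ m t).1 ∈ cutPlane 1 T :=
  (exists_path_of_simplyConnected cutPlane_subset hx₀
    (strip_subset m (midPoint_mem_strip m))).choose_spec t

/-- A path between midpoints avoiding the upper cuts. -/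
noncomputable def upPath (T : Set ℤ) (m n : ℤ) : Path (midPoint T m) (midPoint T n) :=
  (exists_path_of_simplyConnected (S := cutPlane (-1) T) cutPlane_subset
    (strip_subset m (midPoint_mem_strip m)) (strip_subset n (midPoint_mem_strip n))).choose

lemma upPath_mem (m n : ℤ) (t : unitInterval) : (upPath T m n t).1 ∈ cutPlane (-1) T :=
  (exists_path_of_simplyConnected (S := cutPlane (-1) T) cutPlane_subset
    (strip_subset m (midPoint_mem_strip m)) (strip_subset n (midPoint_mem_strip n))).choose_spec t

/-- A loop which runs once around the integer `m`. -/
noncomputable def puncturedGen (m : ℤ) : Path x₀ x₀ :=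
  ((lowPath hx₀ (m - 1)).trans (upPath T (m - 1) m)).trans (lowPath hx₀ m).symm

/-- The subgroup generated by the loops around the punctures. -/
noncomputable def genSubgroup : Subgroup (FundamentalGroup (puncturedPlane T) x₀) :=
  Subgroup.closure (Set.range fun m : T =>
    FundamentalGroup.fromPath (Path.Homotopic.Quotient.mk (puncturedGen hx₀ m.1)))

/-- If `m + 1` is a puncture, the loop in question is one of the generators. Otherwise the segment
between the two midpoints avoids both families of cuts, and the two paths are homotopic. -/
lemma pathRel_succ (m : ℤ) :
    PathRel (genSubgroup hx₀) ((lowPath hx₀ m).trans (upPath T m (m + 1))) (lowPath hx₀ (m + 1)) := by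
  by_cases hm : m + 1 ∈ T
  · have h : PathRel (genSubgroup hx₀) ((lowPath hx₀ (m + 1 - 1)).trans
        (upPath T (m + 1 - 1) (m + 1))) (lowPath hx₀ (m + 1)) :=
      Subgroup.subset_closure ⟨⟨m + 1, hm⟩, rfl⟩
    rwa [add_sub_cancel_right] at h
  · have hS : Convex ℝ {y : ℂ | (m : ℝ) < y.re ∧ y.re < m + 2} :=
      ((convex_Ioi _).linear_preimage reLm).inter ((convex_Iio _).linear_preimage reLm)
    have hsub (ε : ℝ) : {y : ℂ | (m : ℝ) < y.re ∧ y.re < m + 2} ⊆ cutPlane ε T := by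
      rintro y ⟨h1, h2⟩ l hl ⟨h3, -⟩
      rw [h3] at h1 h2
      have a : m < l := by exact_mod_cast h1
      have b : l < m + 2 := by exact_mod_cast h2
      obtain rfl : l = m + 1 := by omega
      exact hm hl
    let σ : Path (midPoint T m) (midPoint T (m + 1)) := AbelianCover.segPath hS
      ((hsub 1).trans cutPlane_subset) (by simp [midPoint]; norm_num)
      (by simp only [midPoint, Set.mem_ofPred_eq, ofReal_re]; push_cast; constructor <;> linarith)
    have hσ : ∀ t, (σ t).1 ∈ {y : ℂ | (m : ℝ) < y.re ∧ y.re < m + 2} :=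
      AbelianCover.segPath_mem _ _ _ _
    have h1 : (upPath T m (m + 1)).Homotopic σ :=
      homotopic_of_simplyConnected (S := cutPlane (-1) T) cutPlane_subset (upPath_mem m _)
        fun t => hsub _ (hσ t)
    refine PathRel.of_homotopic (((Path.Homotopic.refl _).hcomp h1).trans
      (homotopic_of_simplyConnected (S := cutPlane 1 T) cutPlane_subset ?_ (lowPath_mem hx₀ _)))
    exact Path.trans_mem (V := Subtype.val ⁻¹' cutPlane 1 T) (lowPath_mem hx₀ m)
      fun t => hsub _ (hσ t)

lemma pathRel_upPath (m : ℤ) (n : ℕ) : PathRel (genSubgroup hx₀)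
    ((lowPath hx₀ m).trans (upPath T m (m + n))) (lowPath hx₀ (m + n)) := by
  induction n with
  | zero =>
    have h : (upPath T m (m + (0 : ℕ))).Homotopic
        ((Path.refl (midPoint T m)).cast rfl (by simp)) :=
      homotopic_of_simplyConnected (S := cutPlane (-1) T) cutPlane_subset (upPath_mem m _)
        fun t => by simpa using strip_subset m (midPoint_mem_strip m)
    refine PathRel.of_homotopic (((Path.Homotopic.refl _).hcomp h).trans
      (homotopic_of_simplyConnected (S := cutPlane 1 T) cutPlane_subset ?_ (lowPath_mem hx₀ _)))
    exact Path.trans_mem (V := Subtype.val ⁻¹' cutPlane 1 T) (lowPath_mem hx₀ m)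
      fun t => by simpa using strip_subset m (midPoint_mem_strip m)
  | succ n ih =>
    have h1 := (PathRel.append_iff (upPath T (m + n) (m + n + 1))).2 ih
    have h2 := h1.trans (pathRel_succ hx₀ (m + n))
    have h3 : ((lowPath hx₀ m).trans (upPath T m (m + n + 1))).Homotopic
        (((lowPath hx₀ m).trans (upPath T m (m + n))).trans (upPath T (m + n) (m + n + 1))) := by
      refine Path.Homotopic.trans ?_ ⟨(Path.Homotopy.transAssoc _ _ _).symm⟩
      refine (Path.Homotopic.refl _).hcomp ?_
      exact homotopic_of_simplyConnected (S := cutPlane (-1) T) cutPlane_subset (upPath_mem m _)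
        (Path.trans_mem (V := Subtype.val ⁻¹' cutPlane (-1) T) (upPath_mem _ _) (upPath_mem _ _))
    have h4 := (PathRel.of_homotopic (N := genSubgroup hx₀) h3).trans h2
    rw [add_assoc] at h4
    exact_mod_cast h4

/-- Paths above the punctures with the same ends are homotopic, so `β` may be replaced by `upPath`.
Moves to the left are reduced to moves to the right by running `β` after the reverse path. -/
lemma pathRel_upPath' (m n : ℤ) {β : Path (midPoint T m) (midPoint T n)}
    (hβ : ∀ t, (β t).1 ∈ cutPlane (-1) T) :
    PathRel (genSubgroup hx₀) ((lowPath hx₀ m).trans β) (lowPath hx₀ n) := by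
  have hh (η : Path (midPoint T m) (midPoint T n)) (hη : ∀ t, (η t).1 ∈ cutPlane (-1) T) :
      PathRel (genSubgroup hx₀) ((lowPath hx₀ m).trans β) ((lowPath hx₀ m).trans η) :=
    PathRel.of_homotopic ((Path.Homotopic.refl _).hcomp
      (homotopic_of_simplyConnected (S := cutPlane (-1) T) cutPlane_subset hβ hη))
  rcases le_total m n with h | h
  · obtain ⟨d, rfl⟩ := Int.le.dest h
    exact (hh _ (upPath_mem _ _)).trans (pathRel_upPath hx₀ m d)
  · obtain ⟨d, rfl⟩ := Int.le.dest h
    have h1 := (PathRel.append_iff β).2 (pathRel_upPath hx₀ n d)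
    refine h1.symm.trans (PathRel.of_homotopic ?_)
    refine Path.Homotopic.trans ⟨Path.Homotopy.transAssoc _ _ _⟩ (Path.Homotopic.trans
      ((Path.Homotopic.refl _).hcomp (q₁ := Path.refl _) ?_) ⟨Path.Homotopy.transRefl _⟩)
    exact homotopic_of_simplyConnected (S := cutPlane (-1) T) cutPlane_subset
      (Path.trans_mem (V := Subtype.val ⁻¹' cutPlane (-1) T) (upPath_mem _ _) hβ)
      fun t => by simpa using strip_subset n (midPoint_mem_strip n)

/-- The standard paths from the base point to `y`: those which avoid the lower cuts, and those
which avoid the lower cuts up to a midpoint and then avoid the upper cuts. -/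
def IsStandard {y : puncturedPlane T} (e : Path x₀ y) : Prop :=
  (∀ t, (e t).1 ∈ cutPlane 1 T) ∨ ∃ (m : ℤ) (β : Path (midPoint T m) y),
    (∀ t, (β t).1 ∈ cutPlane (-1) T) ∧ e = (lowPath hx₀ m).trans β

/-- The endpoint lies in both cut planes, hence in a strip containing a midpoint. Through that
midpoint the comparison becomes one between paths ending at midpoints. -/
lemma IsStandard.pathRel_low_up {y : puncturedPlane T} {e : Path x₀ y}
    (he : ∀ t, (e t).1 ∈ cutPlane 1 T) {m : ℤ} {β : Path (midPoint T m) y}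
    (hβ : ∀ t, (β t).1 ∈ cutPlane (-1) T) :
    PathRel (genSubgroup hx₀) e ((lowPath hx₀ m).trans β) := by
  have hy1 : y.1 ∈ cutPlane 1 T := by simpa using he 1
  have hy2 : y.1 ∈ cutPlane (-1) T := by simpa using hβ 1
  have hy := mem_strip hy1 hy2
  set n := ⌊y.1.re⌋
  let σ : Path (midPoint T n) y := AbelianCover.segPath (convex_strip n)
    ((strip_subset (ε := 1) n).trans cutPlane_subset) (midPoint_mem_strip n) hy
  have hσ : ∀ t, (σ t).1 ∈ strip T n := AbelianCover.segPath_mem _ _ _ _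
  have h1 : e.Homotopic ((lowPath hx₀ n).trans σ) :=
    homotopic_of_simplyConnected (S := cutPlane 1 T) cutPlane_subset he
      (Path.trans_mem (V := Subtype.val ⁻¹' cutPlane 1 T) (lowPath_mem hx₀ n)
        fun t => strip_subset _ (hσ t))
  refine (PathRel.of_homotopic h1).trans ?_
  have hσ' : ∀ t, (σ.symm t).1 ∈ cutPlane (-1) T := fun t => strip_subset _ (hσ _)
  have h2 := (PathRel.append_iff σ).2 (pathRel_upPath' hx₀ m n
    (β := β.trans σ.symm) (Path.trans_mem (V := Subtype.val ⁻¹' cutPlane (-1) T) hβ hσ'))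
  refine h2.symm.trans (PathRel.of_homotopic ?_)
  refine Path.Homotopic.trans ⟨Path.Homotopy.transAssoc _ _ _⟩
    ((Path.Homotopic.refl _).hcomp ?_)
  exact homotopic_of_simplyConnected (S := cutPlane (-1) T) cutPlane_subset
    (Path.trans_mem (V := Subtype.val ⁻¹' cutPlane (-1) T)
      (Path.trans_mem (V := Subtype.val ⁻¹' cutPlane (-1) T) hβ hσ')
      fun t => strip_subset _ (hσ t)) hβ

lemma IsStandard.pathRel {y : puncturedPlane T} {e e' : Path x₀ y} (he : IsStandard hx₀ e)
    (he' : IsStandard hx₀ e') : PathRel (genSubgroup hx₀) e e' := by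
  rcases he with he | ⟨m, β, hβ, rfl⟩ <;> rcases he' with he' | ⟨n, β', hβ', rfl⟩
  · exact PathRel.of_homotopic (homotopic_of_simplyConnected (S := cutPlane 1 T)
      cutPlane_subset he he')
  · exact IsStandard.pathRel_low_up hx₀ he hβ'
  · exact (IsStandard.pathRel_low_up hx₀ he' hβ).symm
  · have hs : ∀ t, (β'.symm t).1 ∈ cutPlane (-1) T := fun t => hβ' _
    have h := (PathRel.append_iff β').2 (pathRel_upPath' hx₀ m n
      (β := β.trans β'.symm) (Path.trans_mem (V := Subtype.val ⁻¹' cutPlane (-1) T) hβ hs))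
    refine PathRel.trans (PathRel.of_homotopic ?_) h
    refine Path.Homotopic.trans ?_ ⟨(Path.Homotopy.transAssoc _ _ _).symm⟩
    refine (Path.Homotopic.refl _).hcomp ?_
    exact homotopic_of_simplyConnected (S := cutPlane (-1) T) cutPlane_subset hβ
      (Path.trans_mem (V := Subtype.val ⁻¹' cutPlane (-1) T)
        (Path.trans_mem (V := Subtype.val ⁻¹' cutPlane (-1) T) hβ hs) hβ')

lemma IsStandard.append_low {y z : puncturedPlane T} (hy : y.1 ∈ cutPlane 1 T) {η : Path y z}
    (hη : ∀ t, (η t).1 ∈ cutPlane 1 T) :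
    ∃ e : Path x₀ y, IsStandard hx₀ e ∧ IsStandard hx₀ (e.trans η) := by
  obtain ⟨e, he⟩ := exists_path_of_simplyConnected cutPlane_subset hx₀ hy
  exact ⟨e, Or.inl he, Or.inl (Path.trans_mem (V := Subtype.val ⁻¹' cutPlane 1 T) he hη)⟩

lemma IsStandard.append_up {y z : puncturedPlane T} (hy : y.1 ∈ cutPlane (-1) T) {η : Path y z}
    (hη : ∀ t, (η t).1 ∈ cutPlane (-1) T) :
    ∃ (e : Path x₀ y) (e' : Path x₀ z), IsStandard hx₀ e ∧ IsStandard hx₀ e' ∧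
      e'.Homotopic (e.trans η) := by
  obtain ⟨β, hβ⟩ := exists_path_of_simplyConnected (S := cutPlane (-1) T) cutPlane_subset
    (strip_subset 0 (midPoint_mem_strip 0)) hy
  exact ⟨(lowPath hx₀ 0).trans β, (lowPath hx₀ 0).trans (β.trans η), Or.inr ⟨0, β, hβ, rfl⟩,
    Or.inr ⟨0, _, Path.trans_mem (V := Subtype.val ⁻¹' cutPlane (-1) T) hβ hη, rfl⟩,
    ⟨(Path.Homotopy.transAssoc _ _ _).symm⟩⟩

end Punctured

/-! ### Loops around the punctures generate, and logarithms detect commutators. -/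

section Generation

variable {T : Set ℤ} {x₀ : puncturedPlane T} (hx₀ : x₀.1 ∈ cutPlane 1 T)

lemma isOpen_preimage_cutPlane (ε : ℝ) :
    IsOpen (Subtype.val ⁻¹' cutPlane ε T : Set (puncturedPlane T)) :=
  (isOpen_cutPlane ε T).preimage continuous_subtype_val

lemma exists_standard_subpath {y : puncturedPlane T} (γ : Path x₀ y) (s : unitInterval) :
    ∀ᶠ t in 𝓝 s, ∃ (e : Path x₀ (γ s)) (e' : Path x₀ (γ t)), IsStandard hx₀ e ∧
      IsStandard hx₀ e' ∧ e'.Homotopic (e.trans (γ.subpath s t)) := by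
  have h : (γ s).1 ∈ cutPlane 1 T ∪ cutPlane (-1) T :=
    puncturedPlane_eq_union (T := T) ▸ (γ s).2
  rcases h with h | h
  · filter_upwards [γ.eventually_subpath_mem s (isOpen_preimage_cutPlane 1) h] with t ht
    obtain ⟨e, h1, h2⟩ := IsStandard.append_low hx₀ h ht
    exact ⟨e, _, h1, h2, Path.Homotopic.refl _⟩
  · filter_upwards [γ.eventually_subpath_mem s (isOpen_preimage_cutPlane (-1)) h] with t ht
    exact IsStandard.append_up hx₀ h ht

lemma PathRel.cast_iff {X : Type*} [TopologicalSpace X] {x₀ x y : X}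
    {N : Subgroup (FundamentalGroup X x₀)} {γ δ : Path x₀ x} (h : y = x) :
    PathRel N (γ.cast rfl h) (δ.cast rfl h) ↔ PathRel N γ δ := by
  subst h; rfl

lemma IsStandard.cast {x y : puncturedPlane T} {e : Path x₀ x} (he : IsStandard hx₀ e)
    (h : y = x) : IsStandard hx₀ (e.cast rfl h) := by
  subst h; exact he

/-- This is the van Kampen argument. Each short piece of `γ` lies in one of the two cut planes, and
standard paths with the same end are related; so whether the initial part of `γ` up to `t` is
related to a standard path is locally constant in `t`. It is true at `0`, hence at `1`. -/
lemma exists_standard {y : puncturedPlane T} (γ : Path x₀ y) :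
    ∃ e : Path x₀ y, IsStandard hx₀ e ∧ PathRel (genSubgroup hx₀) γ e := by
  let γ' (t : unitInterval) : Path x₀ (γ t) := (γ.subpath 0 t).cast γ.source.symm rfl
  let Good (t : unitInterval) : Prop := ∃ e : Path x₀ (γ t), IsStandard hx₀ e ∧
    PathRel (genSubgroup hx₀) (γ' t) e
  have hloc : IsLocallyConstant Good := by
    rw [IsLocallyConstant.iff_eventually_eq]
    intro s
    filter_upwards [exists_standard_subpath hx₀ γ s] with t ⟨e, e', he, he', hee'⟩
    have hγ : ((γ' s).trans (γ.subpath s t)).Homotopic (γ' t) :=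
      Path.Homotopic.pathCast ⟨Path.Homotopy.subpathTransSubpath γ 0 s t⟩ γ.source.symm rfl
    have key : PathRel (genSubgroup hx₀) (γ' t) e' ↔ PathRel (genSubgroup hx₀) (γ' s) e := by
      rw [← PathRel.append_iff (γ := γ' s) (γ.subpath s t)]
      exact ⟨fun h => (PathRel.of_homotopic hγ).trans (h.trans (PathRel.of_homotopic hee')),
        fun h => (PathRel.of_homotopic hγ).symm.trans (h.trans (PathRel.of_homotopic hee').symm)⟩
    refine propext ⟨?_, ?_⟩
    · rintro ⟨f, hf, hr⟩
      exact ⟨e, he, key.1 (hr.trans (IsStandard.pathRel hx₀ hf he'))⟩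
    · rintro ⟨f, hf, hr⟩
      exact ⟨e', he', key.2 (hr.trans (IsStandard.pathRel hx₀ hf he))⟩
  have h0 : Good 0 := by
    refine ⟨(Path.refl x₀).cast rfl γ.source, Or.inl fun t => by simpa using hx₀,
      PathRel.of_homotopic ?_⟩
    have : γ' 0 = (Path.refl x₀).cast rfl γ.source := by ext t; simp [γ']
    rw [this]
  have h1 : Good 1 := by
    rw [hloc.apply_eq_of_preconnectedSpace 1 0]; exact h0
  obtain ⟨e, he, hr⟩ := h1
  refine ⟨e.cast rfl γ.target.symm, he.cast hx₀ _, ?_⟩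
  have : (γ' 1).cast rfl γ.target.symm = γ := by ext t; simp [γ']
  have h := (PathRel.cast_iff γ.target.symm).2 hr
  rwa [this] at h

/-- A loop is related to a standard one, and the constant path is itself standard. -/
lemma genSubgroup_eq_top : genSubgroup hx₀ = ⊤ := by
  rw [Subgroup.eq_top_iff']
  intro g
  obtain ⟨γ, rfl⟩ := Path.Homotopic.Quotient.mk_surjective g
  obtain ⟨e, he, hr⟩ := exists_standard hx₀ γ
  have h : PathRel (genSubgroup hx₀) γ (Path.refl x₀) :=
    hr.trans (IsStandard.pathRel hx₀ he (Or.inl fun t => by simpa using hx₀))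
  unfold PathRel at h
  rwa [Path.Homotopic.Quotient.mk_trans, Path.Homotopic.Quotient.mk_symm,
    Path.Homotopic.Quotient.mk_refl, ← Path.Homotopic.Quotient.mk_refl,
    ← Path.Homotopic.Quotient.mk_symm, Path.refl_symm, ← Path.Homotopic.Quotient.mk_trans,
    Path.Homotopic.Quotient.eq.2 ⟨Path.Homotopy.transRefl γ⟩] at h

/-- The function `y - l` on the punctured plane. -/
def puncturedFun {l : ℤ} (hl : l ∈ T) : C(puncturedPlane T, {z : ℂ // z ≠ 0}) :=
  ⟨fun y => ⟨y.1 - l, sub_ne_zero.2 (y.2 l hl)⟩, by fun_prop⟩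

/-- The branch of the logarithm on the plane cut along the imaginary half-axis that is negative
for `ε = 1` and positive for `ε = -1`. -/
noncomputable def vertLog (ε : ℝ) (u : ℂ) : ℂ := log (-(ε * I) * u) + ε * I * (Real.pi / 2)

lemma exp_vertLog {ε : ℝ} (hε : ε = 1 ∨ ε = -1) {u : ℂ} (hu : u ≠ 0) : exp (vertLog ε u) = u := by
  have hε0 : (ε : ℂ) ≠ 0 := by rcases hε with rfl | rfl <;> simp
  rw [vertLog, exp_add, exp_log (mul_ne_zero (neg_ne_zero.2 (mul_ne_zero hε0 I_ne_zero)) hu)]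
  have h : exp (ε * I * (Real.pi / 2)) = ε * I := by
    rcases hε with rfl | rfl
    · rw [ofReal_one, one_mul, mul_comm, exp_pi_div_two_mul_I]
    · rw [show ((-1 : ℝ) : ℂ) * I * (Real.pi / 2) = -(Real.pi / 2 * I) by push_cast; ring,
        exp_neg, exp_pi_div_two_mul_I]
      simp
  rw [h]
  have : (ε : ℂ) * ε = 1 := by rcases hε with rfl | rfl <;> simp
  linear_combination (-u * ε * ε) * I_mul_I + u * this

lemma vertLog_mem_slitPlane {ε : ℝ} {u : ℂ} (hε : ε ≠ 0) (h : ¬(u.re = 0 ∧ ε * u.im ≤ 0)) :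
    -(ε * I) * u ∈ slitPlane := by
  rw [mem_slitPlane_iff]
  have h1 : (-(ε * I) * u).re = ε * u.im := by simp
  have h2 : (-(ε * I) * u).im = -(ε * u.re) := by simp
  rw [h1, h2]
  by_contra hc
  push Not at hc
  exact h ⟨by simpa [hε] using hc.2, hc.1⟩

lemma logInc_puncturedFun {ε : ℝ} (hε : ε = 1 ∨ ε = -1) {l : ℤ} (hl : l ∈ T)
    {x y : puncturedPlane T} {γ : Path x y} (hγ : ∀ t, (γ t).1 ∈ cutPlane ε T) :
    logInc (puncturedFun hl) γ = vertLog ε (y.1 - l) - vertLog ε (x.1 - l) := by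
  have hε0 : ε ≠ 0 := by rcases hε with rfl | rfl <;> simp
  have h := logInc_eq (puncturedFun hl) (γ := γ) (θ := fun t => vertLog ε ((γ t).1 - l)) ?_
    (fun t => exp_vertLog hε (sub_ne_zero.2 ((γ t).2 l hl)))
  · rw [h, γ.source, γ.target]
  · refine Continuous.add (Continuous.clog (by fun_prop) fun t => ?_) continuous_const
    refine vertLog_mem_slitPlane hε0 fun h => hγ t l hl ⟨?_, ?_⟩
    · have := h.1
      simp at this; linarith
    · simpa using h.2

lemma vertLog_sub_of_pos {r : ℝ} (hr : 0 < r) : vertLog 1 r - vertLog (-1) r = 0 := by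
  have h1 : -(((1 : ℝ) : ℂ) * I) * r = r * (-I) := by push_cast; ring
  have h2 : -(((-1 : ℝ) : ℂ) * I) * r = r * I := by push_cast; ring
  rw [vertLog, vertLog, h1, h2, log_ofReal_mul hr (neg_ne_zero.2 I_ne_zero),
    log_ofReal_mul hr I_ne_zero, log_I, log_neg_I]
  push_cast; ring

/-- To the right of a puncture the two branches agree; to the left they differ by a full turn. This
difference is the winding number of the generators. -/
lemma vertLog_sub_of_neg {r : ℝ} (hr : r < 0) :
    vertLog 1 r - vertLog (-1) r = 2 * Real.pi * I := by
  have h1 : -(((1 : ℝ) : ℂ) * I) * r = (-r : ℝ) * I := by push_cast; ring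
  have h2 : -(((-1 : ℝ) : ℂ) * I) * r = (-r : ℝ) * (-I) := by push_cast; ring
  rw [vertLog, vertLog, h1, h2, log_ofReal_mul (neg_pos.2 hr) (neg_ne_zero.2 I_ne_zero),
    log_ofReal_mul (neg_pos.2 hr) I_ne_zero, log_I, log_neg_I]
  push_cast; ring

/-- The lower and the upper branch of `log (y - l)` are compared at the midpoints on both sides of
`m`. Their difference changes between these midpoints only if `m = l`. -/
lemma logInc_puncturedGen {l : ℤ} (hl : l ∈ T) (m : ℤ) :
    logInc (puncturedFun hl) (puncturedGen hx₀ m) = if m = l then 2 * Real.pi * I else 0 := by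
  rw [puncturedGen, logInc_trans, logInc_trans, logInc_symm,
    logInc_puncturedFun (Or.inl rfl) hl (lowPath_mem hx₀ _),
    logInc_puncturedFun (Or.inl rfl) hl (lowPath_mem hx₀ _),
    logInc_puncturedFun (Or.inr rfl) hl (upPath_mem _ _)]
  have hmid (n : ℤ) : (midPoint T n).1 - l = ((n - l + 1 / 2 : ℝ) : ℂ) := by
    simp only [midPoint]; push_cast; ring
  have hδ (n : ℤ) : vertLog 1 ((midPoint T n).1 - l) - vertLog (-1) ((midPoint T n).1 - l) =
      if n < l then 2 * Real.pi * I else 0 := by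
    rw [hmid]
    split_ifs with h
    · have h' : (n : ℝ) + 1 ≤ l := by exact_mod_cast h
      exact vertLog_sub_of_neg (by linarith)
    · have h' : (l : ℝ) ≤ n := by exact_mod_cast not_lt.1 h
      exact vertLog_sub_of_pos (by linarith)
  have h1 := hδ (m - 1)
  have h2 := hδ m
  have h3 : (if m = l then 2 * Real.pi * I else 0 : ℂ) =
      (if m - 1 < l then 2 * Real.pi * I else 0) - (if m < l then 2 * Real.pi * I else 0) := by
    split_ifs <;> first | omega | simp
  rw [h3]
  linear_combination h1 - h2

/-- In the abelianization the class is a product of powers of the generators. The exponent at `l` is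
the increment of `log (y - l)` divided by `2πi`, so zero increments leave the empty product. -/
lemma mem_commutator_of_logInc_eq_zero {T : Set ℤ} {x₀ : puncturedPlane T}
    (hx₀ : x₀.1 ∈ cutPlane 1 T) (γ : FundamentalGroup (puncturedPlane T) x₀)
    (h : ∀ (l : ℤ) (hl : l ∈ T), logIncHom (puncturedFun hl) x₀ γ = 1) :
    γ ∈ commutator (FundamentalGroup (puncturedPlane T) x₀) := by
  let g (m : T) : FundamentalGroup (puncturedPlane T) x₀ :=
    FundamentalGroup.fromPath (Path.Homotopic.Quotient.mk (puncturedGen hx₀ m.1))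
  have hmem : γ ∈ genSubgroup hx₀ := genSubgroup_eq_top hx₀ ▸ Subgroup.mem_top γ
  have key : ∃ n : T →₀ ℤ, Abelianization.of γ = n.prod (fun m e => Abelianization.of (g m) ^ e) ∧
      ∀ l : T, logIncHom (puncturedFun l.2) x₀ γ =
        Multiplicative.ofAdd (n l * (2 * Real.pi * I) : ℂ) := by
    refine Subgroup.closure_induction (p := fun γ _ => ∃ n : T →₀ ℤ, Abelianization.of γ =
      n.prod (fun m e => Abelianization.of (g m) ^ e) ∧
      ∀ l : T, logIncHom (puncturedFun l.2) x₀ γ =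
        Multiplicative.ofAdd (n l * (2 * Real.pi * I) : ℂ)) ?_ ?_ ?_ ?_ hmem
    · rintro _ ⟨m, rfl⟩
      refine ⟨Finsupp.single m 1, ?_, fun l => ?_⟩
      · rw [Finsupp.prod_single_index (zpow_zero _), zpow_one]
      · change Multiplicative.ofAdd (logInc (puncturedFun l.2) (puncturedGen hx₀ m.1)) = _
        rw [logInc_puncturedGen]
        by_cases hml : m = l
        · subst hml; simp
        · rw [if_neg fun hh => hml (Subtype.ext hh), Finsupp.single_apply, if_neg hml]; simp
    · exact ⟨0, by rw [map_one, Finsupp.prod_zero_index], fun l => by rw [map_one]; simp⟩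
    · rintro a b - - ⟨n, h1, h2⟩ ⟨n', h3, h4⟩
      refine ⟨n + n', ?_, fun l => ?_⟩
      · rw [map_mul, h1, h3, Finsupp.prod_add_index' (fun _ => zpow_zero _)
          (fun _ _ _ => zpow_add _ _ _)]
      · rw [map_mul, h2, h4, ← ofAdd_add, Finsupp.add_apply]
        congr 1; push_cast; ring
    · rintro a - ⟨n, h1, h2⟩
      refine ⟨-n, ?_, fun l => ?_⟩
      · rw [map_inv, h1, Finsupp.prod_neg_index (fun _ => zpow_zero _)]
        simp [Finsupp.prod]
      · rw [map_inv, h2, ← ofAdd_neg, Finsupp.neg_apply]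
        congr 1; push_cast; ring
  obtain ⟨n, h1, h2⟩ := key
  have hn : n = 0 := by
    ext l
    have := (h2 l).symm.trans (h l.1 l.2)
    have h3 : (n l * (2 * Real.pi * I) : ℂ) = 0 := this
    have h4 : (2 * Real.pi * I : ℂ) ≠ 0 := two_pi_I_ne_zero
    simpa [h4] using h3
  rw [hn, Finsupp.prod_zero_index] at h1
  exact (QuotientGroup.eq_one_iff γ).1 h1

end Generation

/-! ### The fundamental group of a product and its commutator subgroup. -/

section Product

variable {ι : Type*} {X : Type*} [TopologicalSpace X] {Y : ι → Type*} [∀ j, TopologicalSpace (Y j)]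
  (Ψ : X ≃ₜ ∀ j, Y j) (x₀ : X)

/-- The `j`-th component of a homeomorphism onto a product. -/
def homeoProj (j : ι) : C(X, Y j) := ⟨fun x => Ψ x j, by fun_prop⟩

/-- The map from the fundamental group of a product to the product of the fundamental groups. -/
noncomputable def fundamentalGroupPi :
    FundamentalGroup X x₀ →* ∀ j, FundamentalGroup (Y j) (homeoProj Ψ j x₀) :=
  MonoidHom.pi fun j => FundamentalGroup.map (homeoProj Ψ j) x₀

lemma fundamentalGroupPi_mk (γ : Path x₀ x₀) (j : ι) :
    fundamentalGroupPi Ψ x₀ (FundamentalGroup.fromPath (Path.Homotopic.Quotient.mk γ)) j =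
      FundamentalGroup.fromPath
        (Path.Homotopic.Quotient.mk (γ.map (homeoProj Ψ j).continuous)) := rfl

lemma fundamentalGroupPi_injective : Function.Injective (fundamentalGroupPi Ψ x₀) := by
  intro g g' h
  obtain ⟨γ, rfl⟩ := Path.Homotopic.Quotient.mk_surjective g
  obtain ⟨γ', rfl⟩ := Path.Homotopic.Quotient.mk_surjective g'
  have h' (j : ι) : (γ.map (homeoProj Ψ j).continuous).Homotopic
      (γ'.map (homeoProj Ψ j).continuous) :=
    Path.Homotopic.Quotient.eq.1 (congrFun h j)
  have h1 : (Path.pi fun j => γ.map (homeoProj Ψ j).continuous).Homotopic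
      (Path.pi fun j => γ'.map (homeoProj Ψ j).continuous) :=
    ⟨Path.Homotopic.piHomotopy _ _ fun j => (h' j).some⟩
  have h2 := (h1.map ⟨Ψ.symm, Ψ.symm.continuous⟩).pathCast (Ψ.symm_apply_apply x₀).symm
    (Ψ.symm_apply_apply x₀).symm
  refine Path.Homotopic.Quotient.eq.2 ?_
  convert h2 using 1
  · ext t; exact (Ψ.symm_apply_apply _).symm
  · ext t; exact (Ψ.symm_apply_apply _).symm

lemma fundamentalGroupPi_surjective : Function.Surjective (fundamentalGroupPi Ψ x₀) := by
  intro q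
  choose γ hγ using fun j => Path.Homotopic.Quotient.mk_surjective (q j)
  let δ : Path x₀ x₀ := ((Path.pi γ).map Ψ.symm.continuous).cast (Ψ.symm_apply_apply x₀).symm
    (Ψ.symm_apply_apply x₀).symm
  refine ⟨FundamentalGroup.fromPath (Path.Homotopic.Quotient.mk δ), ?_⟩
  funext j
  rw [fundamentalGroupPi_mk, ← hγ j]
  change Path.Homotopic.Quotient.mk _ = _
  congr 1
  ext t
  exact congrFun (Ψ.apply_symm_apply _) j

lemma mem_commutator_of_pi [Finite ι] {g : FundamentalGroup X x₀}
    (h : ∀ j, fundamentalGroupPi Ψ x₀ g j ∈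
      commutator (FundamentalGroup (Y j) (homeoProj Ψ j x₀))) :
    g ∈ commutator (FundamentalGroup X x₀) := by
  have h1 : fundamentalGroupPi Ψ x₀ g ∈
      commutator (∀ j, FundamentalGroup (Y j) (homeoProj Ψ j x₀)) := by
    -- Finiteness of `ι` enters here, to identify the commutator subgroup of the product with the
    -- product of the commutator subgroups.
    rw [commutator_def, ← Subgroup.pi_top Set.univ, Subgroup.commutator_pi_pi_of_finite]
    exact fun j _ => h j
  have h2 : (commutator (FundamentalGroup X x₀)).map (fundamentalGroupPi Ψ x₀) =
      commutator (∀ j, FundamentalGroup (Y j) (homeoProj Ψ j x₀)) := by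
    rw [commutator_def, Subgroup.map_commutator, ← MonoidHom.range_eq_map,
      MonoidHom.range_eq_top.2 (fundamentalGroupPi_surjective Ψ x₀), commutator_def]
  rw [← h2] at h1
  obtain ⟨g', hg', hgg⟩ := h1
  rwa [← fundamentalGroupPi_injective Ψ x₀ hgg]

end Product

/-- Equal logarithms make all increments along `γ · δ⁻¹` vanish, so each component of this loop is a
product of commutators, and therefore so is the loop. -/
theorem AbelianCover.ext_of_logAlong {ι : Type*} [Finite ι] {X : Type*} [TopologicalSpace X]
    {T : ι → Set ℤ} (Ψ : X ≃ₜ ∀ j, puncturedPlane (T j)) {x₀ : X}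
    (h₀ : ∀ j, (Ψ x₀ j).1 ∈ cutPlane 1 (T j)) {P Q : AbelianCover x₀} (hpt : P.pt = Q.pt)
    (hlog : ∀ (j : ι) (l : ℤ) (hl : l ∈ T j),
      AbelianCover.logAlong ((puncturedFun hl).comp (homeoProj Ψ j)) P =
        AbelianCover.logAlong ((puncturedFun hl).comp (homeoProj Ψ j)) Q) : P = Q := by
  obtain ⟨x, c⟩ := P
  obtain ⟨y, d⟩ := Q
  obtain rfl : x = y := hpt
  obtain ⟨γ, rfl⟩ := Quotient.exists_rep c
  obtain ⟨δ, rfl⟩ := Quotient.exists_rep d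
  refine AbelianCover.ofPath_eq_iff.2 (mem_commutator_of_pi Ψ x₀ fun j => ?_)
  rw [fundamentalGroupPi_mk]
  refine mem_commutator_of_logInc_eq_zero (h₀ j) _ fun l hl => ?_
  change Multiplicative.ofAdd (logInc ((puncturedFun hl).comp (homeoProj Ψ j))
    (γ.trans δ.symm)) = 1
  have h : log _ + logInc ((puncturedFun hl).comp (homeoProj Ψ j)) γ =
    log _ + logInc ((puncturedFun hl).comp (homeoProj Ψ j)) δ := hlog j l hl
  rw [logInc_trans, logInc_symm, add_left_cancel h, add_neg_cancel]
  rfl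

/-! ### Holomorphy in three variables -/

section Osgood

open MeasureTheory Metric

/-- Integration against `W` is bounded on `C(K, ℂ)` by the `L¹` norm of `W`. Analyticity of a `C(K,
ℂ)`-valued kernel thus passes to the integral without differentiating under it. -/
lemma exists_continuousLinearMap_integral {α K : Type*} [MeasurableSpace α] {μ : Measure α}
    [TopologicalSpace K] [CompactSpace K] {W : α → ℂ} (hW : Integrable W μ) {c : α → K}
    (hc : ∀ φ : C(K, ℂ), AEStronglyMeasurable (fun θ => φ (c θ)) μ) :
    ∃ L : C(K, ℂ) →L[ℂ] ℂ, ∀ φ, L φ = ∫ θ, W θ * φ (c θ) ∂μ := by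
  have hint (φ : C(K, ℂ)) : Integrable (fun θ => W θ * φ (c θ)) μ :=
    hW.mul_bdd (c := ‖φ‖) (hc φ) (Filter.Eventually.of_forall fun θ => φ.norm_coe_le_norm _)
  let L₀ : C(K, ℂ) →ₗ[ℂ] ℂ :=
    { toFun := fun φ => ∫ θ, W θ * φ (c θ) ∂μ
      map_add' := fun φ ψ => by
        rw [← integral_add (hint φ) (hint ψ)]; simp [mul_add]
      map_smul' := fun a φ => by
        rw [RingHom.id_apply, smul_eq_mul, ← integral_const_mul]
        congr 1; funext θ; simp; ring }
  refine ⟨L₀.mkContinuous (∫ θ, ‖W θ‖ ∂μ) fun φ => ?_, fun φ => rfl⟩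
  calc ‖L₀ φ‖ ≤ ∫ θ, ‖W θ * φ (c θ)‖ ∂μ := norm_integral_le_integral_norm _
    _ ≤ ∫ θ, ‖W θ‖ * ‖φ‖ ∂μ := by
        refine integral_mono (hint φ).norm (hW.norm.mul_const _) fun θ => ?_
        simp only [norm_mul]
        exact mul_le_mul_of_nonneg_left (φ.norm_coe_le_norm _) (norm_nonneg _)
    _ = (∫ θ, ‖W θ‖ ∂μ) * ‖φ‖ := integral_mul_const _ _

/-- A continuous function of three complex variables which is holomorphic in each of them is
analytic. -/
lemma analyticAt_of_separately {f : ℂ × ℂ × ℂ → ℂ} {p : ℂ × ℂ × ℂ} {R : ℝ} (hR : 0 < R)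
    (hc : ContinuousOn f (ball p R))
    (h1 : ∀ q ∈ ball p R, DifferentiableAt ℂ (fun x => f (x, q.2.1, q.2.2)) q.1)
    (h2 : ∀ q ∈ ball p R, DifferentiableAt ℂ (fun x => f (q.1, x, q.2.2)) q.2.1)
    (h3 : ∀ q ∈ ball p R, DifferentiableAt ℂ (fun x => f (q.1, q.2.1, x)) q.2.2) :
    AnalyticAt ℂ f p := by
  obtain ⟨a, b, d⟩ := p
  set r := R / 2 with hr
  have hr0 : 0 < r := by positivity
  have hrR : r < R := by linarith
  have hmem {x y z : ℂ} (hx : x ∈ closedBall a r) (hy : y ∈ closedBall b r)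
      (hz : z ∈ closedBall d r) : (x, y, z) ∈ ball (a, b, d) R := by
    rw [mem_closedBall] at hx hy hz
    simp only [mem_ball, Prod.dist_eq, max_lt_iff]
    exact ⟨by linarith, by linarith, by linarith⟩
  let K := sphere a r × sphere b r × sphere d r
  let c : ℝ × ℝ × ℝ → K := fun θ => (⟨circleMap a r θ.1, circleMap_mem_sphere a hr0.le _⟩,
    ⟨circleMap b r θ.2.1, circleMap_mem_sphere b hr0.le _⟩,
    ⟨circleMap d r θ.2.2, circleMap_mem_sphere d hr0.le _⟩)
  have hcc : Continuous c := by
    have := continuous_circleMap a r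
    have := continuous_circleMap b r
    have := continuous_circleMap d r
    fun_prop
  let W : ℝ × ℝ × ℝ → ℂ := fun θ => deriv (circleMap a r) θ.1 * deriv (circleMap b r) θ.2.1 *
    deriv (circleMap d r) θ.2.2 * f (circleMap a r θ.1, circleMap b r θ.2.1, circleMap d r θ.2.2)
  have hs {x y z : ℂ} (hx : x ∈ sphere a r) (hy : y ∈ sphere b r) (hz : z ∈ sphere d r) :
      (x, y, z) ∈ ball (a, b, d) R :=
    hmem (sphere_subset_closedBall hx) (sphere_subset_closedBall hy) (sphere_subset_closedBall hz)
  have hWc : Continuous W := by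
    have e1 := continuous_circleMap a r
    have e2 := continuous_circleMap b r
    have e3 := continuous_circleMap d r
    have e4 : Continuous fun θ : ℝ × ℝ × ℝ =>
        f (circleMap a r θ.1, circleMap b r θ.2.1, circleMap d r θ.2.2) :=
      hc.comp_continuous (by fun_prop) fun θ => hs (circleMap_mem_sphere a hr0.le _)
        (circleMap_mem_sphere b hr0.le _) (circleMap_mem_sphere d hr0.le _)
    simp only [W, deriv_circleMap]
    have e1' := continuous_circleMap 0 r
    exact ((((e1'.comp continuous_fst).mul continuous_const).mul
      ((e1'.comp continuous_snd.fst).mul continuous_const)).mul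
      ((e1'.comp continuous_snd.snd).mul continuous_const)).mul e4
  let m : Measure ℝ := volume.restrict (Set.Ioc 0 (2 * Real.pi))
  let μ : Measure (ℝ × ℝ × ℝ) := m.prod (m.prod m)
  have hint {g : ℝ × ℝ × ℝ → ℂ} (hg : Continuous g) : Integrable g μ := by
    have : μ = (volume : Measure (ℝ × ℝ × ℝ)).restrict (Set.Ioc 0 (2 * Real.pi) ×ˢ
        Set.Ioc 0 (2 * Real.pi) ×ˢ Set.Ioc 0 (2 * Real.pi)) := by
      simp only [μ, m, Measure.prod_restrict]; rfl
    rw [this]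
    refine (hg.continuousOn.integrableOn_compact (K := Set.Icc 0 (2 * Real.pi) ×ˢ
        Set.Icc 0 (2 * Real.pi) ×ˢ Set.Icc 0 (2 * Real.pi)) ?_).mono_set ?_
    · exact isCompact_Icc.prod (isCompact_Icc.prod isCompact_Icc)
    · exact Set.prod_mono Set.Ioc_subset_Icc_self
        (Set.prod_mono Set.Ioc_subset_Icc_self Set.Ioc_subset_Icc_self)
  have hint2 {g : ℝ × ℝ → ℂ} (hg : Continuous g) : Integrable g (m.prod m) := by
    have : m.prod m = (volume : Measure (ℝ × ℝ)).restrict (Set.Ioc 0 (2 * Real.pi) ×ˢ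
        Set.Ioc 0 (2 * Real.pi)) := by
      simp only [m, Measure.prod_restrict]; rfl
    rw [this]
    refine (hg.continuousOn.integrableOn_compact (K := Set.Icc 0 (2 * Real.pi) ×ˢ
        Set.Icc 0 (2 * Real.pi)) ?_).mono_set ?_
    · exact isCompact_Icc.prod isCompact_Icc
    · exact Set.prod_mono Set.Ioc_subset_Icc_self Set.Ioc_subset_Icc_self
  obtain ⟨L, hL⟩ := exists_continuousLinearMap_integral (hint hWc) (c := c)
    fun φ => (φ.continuous.comp hcc).aestronglyMeasurable
  let e1 : ℂ → C(K, ℂ) := fun x => ⟨fun ζ : sphere a r × sphere b r × sphere d r => ζ.1.1, by fun_prop⟩ - x • 1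
  let e2 : ℂ → C(K, ℂ) := fun x => ⟨fun ζ : sphere a r × sphere b r × sphere d r => ζ.2.1.1, by fun_prop⟩ - x • 1
  let e3 : ℂ → C(K, ℂ) := fun x => ⟨fun ζ : sphere a r × sphere b r × sphere d r => ζ.2.2.1, by fun_prop⟩ - x • 1
  have hne {c₀ : ℂ} (ζ : sphere c₀ r) {x : ℂ} (hx : x ∈ ball c₀ r) : ζ.1 - x ≠ 0 := by
    intro h0
    have h4 : dist ζ.1 c₀ = r := ζ.2
    rw [sub_eq_zero.1 h0] at h4
    exact (ne_of_lt hx) h4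
  have u1 {x : ℂ} (hx : x ∈ ball a r) : IsUnit (e1 x) := by
    rw [ContinuousMap.isUnit_iff_forall_ne_zero]
    intro ζ; simpa [e1] using hne ζ.1 hx
  have u2 {x : ℂ} (hx : x ∈ ball b r) : IsUnit (e2 x) := by
    rw [ContinuousMap.isUnit_iff_forall_ne_zero]
    intro ζ; simpa [e2] using hne ζ.2.1 hx
  have u3 {x : ℂ} (hx : x ∈ ball d r) : IsUnit (e3 x) := by
    rw [ContinuousMap.isUnit_iff_forall_ne_zero]
    intro ζ; simpa [e3] using hne ζ.2.2 hx
  have hinv {e : C(K, ℂ)} (he : IsUnit e) (ζ : K) : (Ring.inverse e) ζ = (e ζ)⁻¹ := by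
    have h := congrArg (fun g : C(K, ℂ) => g ζ) (Ring.mul_inverse_cancel e he)
    exact eq_inv_of_mul_eq_one_right h
  -- The Cauchy kernel of the polydisc, as a function of `q` with values in the Banach algebra `C(K,
  -- ℂ)`. It is analytic because inversion is analytic at units.
  let Θ : ℂ × ℂ × ℂ → C(K, ℂ) := fun q =>
    Ring.inverse (e1 q.1) * (Ring.inverse (e2 q.2.1) * Ring.inverse (e3 q.2.2))
  have hΘ : AnalyticAt ℂ Θ (a, b, d) := by
    have aux {e : ℂ × ℂ × ℂ → C(K, ℂ)} {q} (he : AnalyticAt ℂ e q) (hu : IsUnit (e q)) :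
        AnalyticAt ℂ (fun q => Ring.inverse (e q)) q :=
      AnalyticAt.comp (g := Ring.inverse) (analyticAt_inverse (𝕜 := ℂ) hu.unit) he
    refine (aux ?_ (u1 (mem_ball_self hr0))).mul ((aux ?_ (u2 (mem_ball_self hr0))).mul
      (aux ?_ (u3 (mem_ball_self hr0))))
    · exact analyticAt_const.sub (analyticAt_fst.smul analyticAt_const)
    · exact analyticAt_const.sub ((analyticAt_fst.comp analyticAt_snd).smul analyticAt_const)
    · exact analyticAt_const.sub ((analyticAt_snd.comp analyticAt_snd).smul analyticAt_const)
  -- The one-variable Cauchy formula, used once in each variable, represents `f` by its values on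
  -- the torus `K`.
  have hmain : ∀ q ∈ ball (a, b, d) r,
      f q = ((2 * Real.pi * I : ℂ) ^ 3)⁻¹ * L (Θ q) := by
    rintro ⟨x, y, z⟩ hq
    simp only [mem_ball, Prod.dist_eq, max_lt_iff] at hq
    obtain ⟨hx, hy, hz⟩ := hq
    have hx' : x ∈ ball a r := hx
    have hy' : y ∈ ball b r := hy
    have hz' : z ∈ ball d r := hz
    have k1 : (∮ ζ in C(a, r), (ζ - x)⁻¹ • f (ζ, y, z)) = (2 * Real.pi * I : ℂ) • f (x, y, z) :=
      DifferentiableOn.circleIntegral_sub_inv_smul (fun ζ hζ => (h1 (ζ, y, z) (hmem hζ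
        (ball_subset_closedBall hy') (ball_subset_closedBall hz'))).differentiableWithinAt) hx'
    have k2 (ζ : ℂ) (hζ : ζ ∈ sphere a r) : (∮ η in C(b, r), (η - y)⁻¹ • f (ζ, η, z)) =
        (2 * Real.pi * I : ℂ) • f (ζ, y, z) :=
      DifferentiableOn.circleIntegral_sub_inv_smul (fun η hη => (h2 (ζ, η, z)
        (hmem (sphere_subset_closedBall hζ) hη
        (ball_subset_closedBall hz'))).differentiableWithinAt) hy'
    have k3 (ζ : ℂ) (hζ : ζ ∈ sphere a r) (η : ℂ) (hη : η ∈ sphere b r) :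
        (∮ ξ in C(d, r), (ξ - z)⁻¹ • f (ζ, η, ξ)) = (2 * Real.pi * I : ℂ) • f (ζ, η, z) :=
      DifferentiableOn.circleIntegral_sub_inv_smul (fun ξ hξ => (h3 (ζ, η, ξ)
        (hmem (sphere_subset_closedBall hζ) (sphere_subset_closedBall hη)
        hξ)).differentiableWithinAt) hz'
    have hval (θ : ℝ × ℝ × ℝ) : (Θ (x, y, z)) (c θ) = (circleMap a r θ.1 - x)⁻¹ *
        ((circleMap b r θ.2.1 - y)⁻¹ * (circleMap d r θ.2.2 - z)⁻¹) := by
      simp only [Θ, ContinuousMap.mul_apply, hinv (u1 hx'), hinv (u2 hy'), hinv (u3 hz')]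
      simp [e1, e2, e3, c]
    have hcont : Continuous fun θ => W θ * (Θ (x, y, z)) (c θ) :=
      hWc.mul ((Θ (x, y, z)).continuous.comp hcc)
    have h2pi : (0 : ℝ) ≤ 2 * Real.pi := by positivity
    rw [hL, integral_prod _ (hint hcont)]
    have integrate_middle (θ₁ : ℝ) : ∫ θ₂ : ℝ × ℝ, W (θ₁, θ₂) * (Θ (x, y, z)) (c (θ₁, θ₂)) ∂(m.prod m) =
        deriv (circleMap a r) θ₁ • ((circleMap a r θ₁ - x)⁻¹ •
          ((2 * Real.pi * I : ℂ) ^ 2 * f (circleMap a r θ₁, y, z))) := by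
      have hζ := circleMap_mem_sphere a hr0.le θ₁
      rw [integral_prod _ (hint2 (g := fun θ₂ => W (θ₁, θ₂) * (Θ (x, y, z)) (c (θ₁, θ₂)))
        (hcont.comp (Continuous.prodMk_right θ₁)))]
      have integrate_last (θ₂ : ℝ) : ∫ θ₃ : ℝ, W (θ₁, θ₂, θ₃) * (Θ (x, y, z)) (c (θ₁, θ₂, θ₃)) ∂m =
          (deriv (circleMap a r) θ₁ * (circleMap a r θ₁ - x)⁻¹ * (2 * Real.pi * I)) *
          (deriv (circleMap b r) θ₂ • ((circleMap b r θ₂ - y)⁻¹ •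
            f (circleMap a r θ₁, circleMap b r θ₂, z))) := by
        have hη := circleMap_mem_sphere b hr0.le θ₂
        have h := k3 _ hζ _ hη
        rw [circleIntegral, intervalIntegral.integral_of_le h2pi] at h
        calc _ = ∫ θ₃ : ℝ, (deriv (circleMap a r) θ₁ * deriv (circleMap b r) θ₂ *
              (circleMap a r θ₁ - x)⁻¹ * (circleMap b r θ₂ - y)⁻¹) *
              (deriv (circleMap d r) θ₃ • (fun ξ => (ξ - z)⁻¹ •
              f (circleMap a r θ₁, circleMap b r θ₂, ξ)) (circleMap d r θ₃)) ∂m := by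
              congr 1; funext θ₃
              rw [hval]; simp only [W, smul_eq_mul]; ring
          _ = _ := by
              rw [integral_const_mul, h]; simp only [smul_eq_mul]; ring
      simp only [integrate_last]
      rw [integral_const_mul]
      have h := k2 _ hζ
      rw [circleIntegral, intervalIntegral.integral_of_le h2pi] at h
      rw [h]; simp only [smul_eq_mul]; ring
    simp only [integrate_middle]
    have h := k1
    rw [circleIntegral, intervalIntegral.integral_of_le h2pi] at h
    have h' : (∫ θ₁ : ℝ, deriv (circleMap a r) θ₁ • ((circleMap a r θ₁ - x)⁻¹ •
          ((2 * Real.pi * I : ℂ) ^ 2 * f (circleMap a r θ₁, y, z))) ∂m) =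
        (2 * Real.pi * I : ℂ) ^ 2 * ((2 * Real.pi * I : ℂ) • f (x, y, z)) := by
      rw [← h, ← integral_const_mul]
      congr 1; funext θ; simp only [smul_eq_mul]; ring
    rw [h', smul_eq_mul]
    have := two_pi_I_ne_zero
    field_simp
  have hana : AnalyticAt ℂ (fun q => ((2 * Real.pi * I : ℂ) ^ 3)⁻¹ * L (Θ q)) (a, b, d) :=
    analyticAt_const.mul ((L.analyticAt _).comp hΘ)
  exact hana.congr (Filter.eventuallyEq_of_mem (ball_mem_nhds _ hr0) fun q hq => (hmain q hq).symm)

end Osgood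

/-! ### Analyticity of integrals depending on parameters. -/

section ParametricIntegral

open MeasureTheory Metric

variable {α : Type*} [MeasurableSpace α] {μ : Measure α}

/-- A bound on the integrand suffices: Cauchy's estimate on discs of radius `R / 4` around points of
the half disc bounds the derivative by `b / (R / 4)`. -/
lemma differentiableAt_integral_of_dominated {F : ℂ → α → ℂ} {z : ℂ} {R : ℝ} (hR : 0 < R)
    {b : α → ℝ} (hb : Integrable b μ) (hm : ∀ x ∈ ball z R, AEStronglyMeasurable (F x) μ)
    (hbd : ∀ᵐ t ∂μ, ∀ x ∈ ball z R, ‖F x t‖ ≤ b t)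
    (hd : ∀ᵐ t ∂μ, DifferentiableOn ℂ (fun x => F x t) (ball z R)) :
    DifferentiableAt ℂ (fun x => ∫ t, F x t ∂μ) z := by
  have hz : z ∈ ball z R := mem_ball_self hR
  have hint : Integrable (F z) μ := hb.mono' (hm z hz) (hbd.mono fun t h => h z hz)
  -- The derivative is the limit of difference quotients along a sequence, so its measurability need
  -- not be assumed.
  have hmeas : AEStronglyMeasurable (fun t => deriv (fun x => F x t) z) μ := by
    let h : ℕ → ℂ := fun n => ((R / (n + 2) : ℝ) : ℂ)
    have hh0 (n : ℕ) : 0 < R / (n + 2) := by positivity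
    have hhR (n : ℕ) : R / (n + 2) < R := by
      rw [div_lt_iff₀ (by positivity)]; nlinarith [(n.cast_nonneg : (0 : ℝ) ≤ n)]
    have hmem (n : ℕ) : z + h n ∈ ball z R := by
      simp only [h, mem_ball, dist_self_add_left, norm_real, Real.norm_eq_abs, abs_of_pos (hh0 n)]
      exact hhR n
    have hlim : Filter.Tendsto h Filter.atTop (𝓝[≠] 0) := by
      rw [tendsto_nhdsWithin_iff]
      refine ⟨?_, Filter.Eventually.of_forall fun n => by
        simpa only [h, Set.mem_compl_iff, Set.mem_singleton_iff, ofReal_eq_zero]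
          using (hh0 n).ne'⟩
      have : Filter.Tendsto (fun n : ℕ => R / ((n : ℝ) + 2)) Filter.atTop (𝓝 0) :=
        (tendsto_const_nhds (x := R)).div_atTop
          (Filter.tendsto_atTop_add_const_right _ _ tendsto_natCast_atTop_atTop)
      exact (Complex.continuous_ofReal.tendsto' 0 0 ofReal_zero).comp this
    refine aestronglyMeasurable_of_tendsto_ae Filter.atTop
      (f := fun n t => (h n)⁻¹ • (F (z + h n) t - F z t)) (fun n => ?_) ?_
    · exact ((hm _ (hmem n)).sub (hm z hz)).const_smul (h n)⁻¹
    · filter_upwards [hd] with t ht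
      have h1 := (ht.differentiableAt (ball_mem_nhds z hR)).hasDerivAt
      rw [hasDerivAt_iff_tendsto_slope_zero] at h1
      exact h1.comp hlim
  refine (hasDerivAt_integral_of_dominated_loc_of_deriv_le (s := ball z (R / 2))
    (F' := fun x t => deriv (fun x => F x t) x) (bound := fun t => b t / (R / 4))
    (ball_mem_nhds z (by positivity)) ?_ hint hmeas ?_ (hb.div_const _) ?_).2.differentiableAt
  · filter_upwards [ball_mem_nhds z hR] with x hx using hm x hx
  · filter_upwards [hbd, hd] with t hbt hdt x hx
    have hsub : closedBall x (R / 4) ⊆ ball z R := fun y hy => by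
      rw [mem_closedBall] at hy; rw [mem_ball] at hx ⊢
      linarith [dist_triangle y x z]
    exact norm_deriv_le_of_forall_mem_sphere_norm_le (by positivity)
      ((hdt.mono hsub).mono closure_ball_subset_closedBall).diffContOnCl
      fun y hy => hbt y (hsub (sphere_subset_closedBall hy))
  · filter_upwards [hd] with t hdt x hx
    exact (hdt.differentiableAt (isOpen_ball.mem_nhds
      (ball_subset_ball (by linarith) hx))).hasDerivAt

/-- An integral depending on three complex parameters is analytic if the integrand is, and is
dominated by an integrable function. -/
lemma analyticAt_integral_of_dominated {k : ℂ × ℂ × ℂ → α → ℂ} {p : ℂ × ℂ × ℂ} {R : ℝ}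
    (hR : 0 < R) {b : α → ℝ} (hb : Integrable b μ)
    (hm : ∀ q ∈ ball p R, AEStronglyMeasurable (k q) μ)
    (hbd : ∀ᵐ t ∂μ, ∀ q ∈ ball p R, ‖k q t‖ ≤ b t)
    (hd : ∀ᵐ t ∂μ, DifferentiableOn ℂ (fun q => k q t) (ball p R)) :
    AnalyticAt ℂ (fun q => ∫ t, k q t ∂μ) p := by
  have key (q : ℂ × ℂ × ℂ) (hq : q ∈ ball p R) {g : ℂ → ℂ × ℂ × ℂ} {z : ℂ} (hgz : g z = q)
      (hg : Differentiable ℂ g) : DifferentiableAt ℂ (fun x => ∫ t, k (g x) t ∂μ) z := by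
    obtain ⟨ε, hε, hsub⟩ := Metric.mem_nhds_iff.1 (hg.continuous.continuousAt.preimage_mem_nhds
      (isOpen_ball.mem_nhds (hgz.symm ▸ hq)))
    refine differentiableAt_integral_of_dominated hε hb (fun x hx => hm _ (hsub hx)) ?_ ?_
    · filter_upwards [hbd] with t ht x hx using ht _ (hsub hx)
    · filter_upwards [hd] with t ht using ht.comp hg.differentiableOn hsub
  refine analyticAt_of_separately hR ?_ (fun q hq => ?_) (fun q hq => ?_) fun q hq => ?_
  · exact continuousOn_of_dominated hm (fun q hq => hbd.mono fun t h => h q hq) hb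
      (hd.mono fun t h => h.continuousOn)
  · exact key q hq (g := fun x => (x, q.2.1, q.2.2)) rfl (by fun_prop)
  · exact key q hq (g := fun x => (q.1, x, q.2.2)) rfl (by fun_prop)
  · exact key q hq (g := fun x => (q.1, q.2.1, x)) rfl (by fun_prop)

/-- An integral over a compact set depending on three complex parameters is analytic if the
integrand is jointly continuous and analytic in the parameters. -/
lemma analyticAt_integral_of_compact [TopologicalSpace α] [OpensMeasurableSpace α]
    {k : ℂ × ℂ × ℂ → α → ℂ} {p : ℂ × ℂ × ℂ} {R : ℝ}
    (hR : 0 < R) {S : Set α} (hS : IsCompact S) (hSm : MeasurableSet S) (hμ : μ S ≠ ⊤)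
    (hc : ContinuousOn (fun x : (ℂ × ℂ × ℂ) × α => k x.1 x.2) (closedBall p R ×ˢ S))
    (hd : ∀ t ∈ S, DifferentiableOn ℂ (fun q => k q t) (ball p R)) :
    AnalyticAt ℂ (fun q => ∫ t in S, k q t ∂μ) p := by
  obtain ⟨C, hC⟩ := ((isCompact_closedBall p R).prod hS).exists_bound_of_continuousOn hc
  have : IsFiniteMeasure (μ.restrict S) := ⟨by simpa using hμ.lt_top⟩
  refine analyticAt_integral_of_dominated hR (b := fun _ => C) (integrable_const C)
    (fun q hq => ?_) ?_ ?_
  · refine ContinuousOn.aestronglyMeasurable_of_isCompact (?_ : ContinuousOn _ S) hS hSm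
    exact hc.comp (by fun_prop : ContinuousOn (fun t => (q, t)) S)
      fun t ht => ⟨ball_subset_closedBall hq, ht⟩
  · exact (ae_restrict_iff' hSm).2 (Filter.Eventually.of_forall fun t ht q hq =>
      hC (q, t) ⟨ball_subset_closedBall hq, ht⟩)
  · exact (ae_restrict_iff' hSm).2 (Filter.Eventually.of_forall fun t ht => hd t ht)

end ParametricIntegral

/-! ### The Lerch function in the half-plane of convergence of its integral -/

section Lerch

open MeasureTheory Metric

/-- The integrand of the integral for the Lerch function. -/
noncomputable def lerchKer (x w s : ℂ) (t : ℝ) : ℂ :=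
  (t : ℂ) ^ (s - 1) * exp (-w * t) / (1 - exp (2 * Real.pi * I * x - t))

/-- The Lerch function `∑ p, e ^ (2πipx) / (p + w) ^ s` as an integral, for `0 < Re w`,
`0 < Re s`. -/
noncomputable def lerchInt (p : ℂ × ℂ × ℂ) : ℂ :=
  (Gamma p.2.2)⁻¹ * ∫ t in Set.Ioi (0 : ℝ), lerchKer p.1 p.2.1 p.2.2 t

/-- A zero would mean `x = n - it/(2π)` with an integer `n`, a point of a downward cut. -/
lemma one_sub_exp_ne_zero {x : ℂ} (hx : x ∈ cutPlane 1 Set.univ) {t : ℝ} (ht : 0 ≤ t) :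
    1 - exp (2 * Real.pi * I * x - t) ≠ 0 := by
  intro h
  obtain ⟨n, hn⟩ := exp_eq_one_iff.1 (sub_eq_zero.1 h).symm
  have hre := congrArg re hn
  have him := congrArg im hn
  simp at hre him
  have hpi := Real.pi_pos
  refine hx n trivial ⟨?_, ?_⟩
  · have : 2 * Real.pi * (x.re - n) = 0 := by linarith
    have h2 : x.re - n = 0 := by
      rcases mul_eq_zero.1 this with h | h
      · linarith
      · exact h
    linarith
  · rw [one_mul]
    by_contra hc
    push Not at hc
    have := mul_pos hpi hc
    linarith

/-- The modulus has a positive minimum on `K` for `x = x₀`; as `K` is bounded, a small change of `x`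
costs at most half of it, uniformly in `u`. -/
lemma exists_bound_one_sub {K : Set ℝ} (hK : IsCompact K) {x₀ : ℂ}
    (h : ∀ u ∈ K, 1 - u * exp (2 * Real.pi * I * x₀) ≠ 0) :
    ∃ c > 0, ∀ᶠ x in 𝓝 x₀, ∀ u ∈ K, c ≤ ‖1 - u * exp (2 * Real.pi * I * x)‖ := by
  rcases K.eq_empty_or_nonempty with rfl | hne
  · exact ⟨1, one_pos, by simp⟩
  obtain ⟨u₀, hu₀, hmin⟩ := hK.exists_isMinOn hne
    (f := fun u : ℝ => ‖1 - u * exp (2 * Real.pi * I * x₀)‖) (by fun_prop)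
  obtain ⟨M, hM⟩ := hK.isBounded.exists_norm_le
  set m := ‖1 - u₀ * exp (2 * Real.pi * I * x₀)‖ with hm
  have hm0 : 0 < m := norm_pos_iff.2 (h u₀ hu₀)
  have hM0 : 0 ≤ M := (norm_nonneg _).trans (hM u₀ hu₀)
  have hev : ∀ᶠ x in 𝓝 x₀, ‖exp (2 * Real.pi * I * x) - exp (2 * Real.pi * I * x₀)‖ <
      m / (2 * (M + 1)) := by
    have : ContinuousAt (fun x => exp (2 * Real.pi * I * x) - exp (2 * Real.pi * I * x₀)) x₀ := by
      fun_prop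
    have h1 := this.norm.eventually_lt_const (u := m / (2 * (M + 1))) (by simp; positivity)
    exact h1
  refine ⟨m / 2, by positivity, hev.mono fun x hx u hu => ?_⟩
  have h1 : m ≤ ‖1 - u * exp (2 * Real.pi * I * x₀)‖ := hmin hu
  have h2 : ‖u * (exp (2 * Real.pi * I * x) - exp (2 * Real.pi * I * x₀))‖ ≤ m / 2 := by
    rw [norm_mul, norm_real]
    calc ‖u‖ * _ ≤ (M + 1) * (m / (2 * (M + 1))) :=
          mul_le_mul ((hM u hu).trans (by linarith)) hx.le (norm_nonneg _) (by linarith)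
      _ = m / 2 := by field_simp
  have h3 : (1 : ℂ) - u * exp (2 * Real.pi * I * x₀) = (1 - u * exp (2 * Real.pi * I * x)) +
      u * (exp (2 * Real.pi * I * x) - exp (2 * Real.pi * I * x₀)) := by ring
  have h4 := norm_add_le (1 - u * exp (2 * Real.pi * I * x))
    (u * (exp (2 * Real.pi * I * x) - exp (2 * Real.pi * I * x₀)))
  rw [← h3] at h4
  linarith

lemma exp_sub_ofReal_eq (x : ℂ) (t : ℝ) :
    exp (2 * Real.pi * I * x - t) = (Real.exp (-t) : ℝ) * exp (2 * Real.pi * I * x) := by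
  rw [sub_eq_add_neg, exp_add, mul_comm]; push_cast; rfl

/-- The substitution `u = e^{-t}` turns the half-line into `(0, 1]`; adding `u = 0`, where the value
is `1`, makes it compact. -/
lemma exists_bound_kernel {x₀ : ℂ} (hx₀ : x₀ ∈ cutPlane 1 Set.univ) :
    ∃ c > 0, ∀ᶠ x in 𝓝 x₀, ∀ t : ℝ, 0 ≤ t → c ≤ ‖1 - exp (2 * Real.pi * I * x - t)‖ := by
  have key : ∀ u ∈ Set.Icc (0 : ℝ) 1, 1 - u * exp (2 * Real.pi * I * x₀) ≠ 0 := by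
    rintro u ⟨h0, h1⟩
    rcases eq_or_lt_of_le h0 with rfl | h0
    · simp
    · have h2 := one_sub_exp_ne_zero hx₀ (t := -Real.log u)
        (by linarith [Real.log_nonpos h0.le h1])
      rwa [exp_sub_ofReal_eq, neg_neg, Real.exp_log h0] at h2
  obtain ⟨c, hc, h⟩ := exists_bound_one_sub isCompact_Icc key
  refine ⟨c, hc, h.mono fun x hx t ht => ?_⟩
  rw [exp_sub_ofReal_eq]
  exact hx _ ⟨(Real.exp_pos _).le, Real.exp_le_one_iff.2 (by linarith)⟩

lemma measurable_lerchKer (x w s : ℂ) : Measurable (lerchKer x w s) := by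
  unfold lerchKer
  have : Measurable fun t : ℝ => (t : ℂ) ^ (s - 1) := Complex.measurable_ofReal.pow_const _
  fun_prop

lemma norm_lerchKer_le {x w s : ℂ} {t c : ℝ} (ht : 0 < t) (hc : 0 < c)
    (h : c ≤ ‖1 - exp (2 * Real.pi * I * x - t)‖) :
    ‖lerchKer x w s t‖ ≤ t ^ (s.re - 1) * Real.exp (-w.re * t) / c := by
  rw [lerchKer, norm_div, norm_mul, norm_cpow_eq_rpow_re_of_pos ht, norm_exp]
  have : (-w * (t : ℂ)).re = -w.re * t := by simp
  rw [this, sub_re, one_re]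
  have : 0 < t ^ (s.re - 1) := Real.rpow_pos_of_pos ht _
  gcongr

lemma integrableOn_rpow_mul_exp {σ ω : ℝ} (hσ : 0 < σ) (hω : 0 < ω) :
    IntegrableOn (fun t : ℝ => t ^ (σ - 1) * Real.exp (-ω * t)) (Set.Ioi 0) := by
  have := integrableOn_rpow_mul_exp_neg_mul_rpow (p := 1) (s := σ - 1) (b := ω) (by linarith)
    one_pos hω
  simpa using this

lemma integrableOn_lerchKer_of_bound {x w s : ℂ} {S : Set ℝ} (hS : MeasurableSet S)
    (hS0 : S ⊆ Set.Ioi 0) {c : ℝ} (hc : 0 < c)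
    (h : ∀ t ∈ S, c ≤ ‖1 - exp (2 * Real.pi * I * x - t)‖) (hw : 0 < w.re) (hs : 0 < s.re) :
    IntegrableOn (lerchKer x w s) S := by
  refine (((integrableOn_rpow_mul_exp hs hw).mono_set hS0).div_const c).mono'
    (measurable_lerchKer x w s).aestronglyMeasurable ?_
  exact (ae_restrict_iff' hS).2 (Filter.Eventually.of_forall fun t ht =>
    norm_lerchKer_le (hS0 ht) hc (h t ht))

lemma integrableOn_lerchKer {x w s : ℂ} (hx : x ∈ cutPlane 1 Set.univ) (hw : 0 < w.re)
    (hs : 0 < s.re) : IntegrableOn (lerchKer x w s) (Set.Ioi 0) := by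
  obtain ⟨c, hc, h⟩ := exists_bound_kernel hx
  exact integrableOn_lerchKer_of_bound measurableSet_Ioi subset_rfl hc
    (fun t ht => h.self_of_nhds t (le_of_lt ht)) hw hs

lemma analyticAt_integral_lerchKer {x₀ w₀ s₀ : ℂ} {S : Set ℝ} (hS : MeasurableSet S)
    (hS0 : S ⊆ Set.Ioi 0) {c : ℝ} (hc : 0 < c)
    (h : ∀ᶠ x in 𝓝 x₀, ∀ t ∈ S, c ≤ ‖1 - exp (2 * Real.pi * I * x - t)‖)
    (hw : 0 < w₀.re) (hs : 0 < s₀.re) :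
    AnalyticAt ℂ (fun p : ℂ × ℂ × ℂ => ∫ t in S, lerchKer p.1 p.2.1 p.2.2 t) (x₀, w₀, s₀) := by
  obtain ⟨δ, hδ, hball⟩ := Metric.eventually_nhds_iff_ball.1 h
  set R := min δ (min (w₀.re / 2) (s₀.re / 2)) with hR
  have hR0 : 0 < R := lt_min hδ (lt_min (by positivity) (by positivity))
  have hq {q : ℂ × ℂ × ℂ} (hq : q ∈ ball (x₀, w₀, s₀) R) : q.1 ∈ ball x₀ δ ∧
      w₀.re / 2 ≤ q.2.1.re ∧ s₀.re / 2 ≤ q.2.2.re ∧ q.2.2.re ≤ 3 * s₀.re / 2 := by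
    rw [mem_ball, Prod.dist_eq, Prod.dist_eq, max_lt_iff, max_lt_iff] at hq
    obtain ⟨h1, h2, h3⟩ := hq
    have e1 : R ≤ δ := min_le_left _ _
    have e2 : R ≤ w₀.re / 2 := (min_le_right _ _).trans (min_le_left _ _)
    have e3 : R ≤ s₀.re / 2 := (min_le_right _ _).trans (min_le_right _ _)
    have f2 : |(q.2.1 - w₀).re| ≤ dist q.2.1 w₀ := by rw [dist_eq]; exact abs_re_le_norm _
    have f3 : |(q.2.2 - s₀).re| ≤ dist q.2.2 s₀ := by rw [dist_eq]; exact abs_re_le_norm _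
    rw [sub_re] at f2 f3
    have g2 := abs_lt.1 (f2.trans_lt h2)
    have g3 := abs_lt.1 (f3.trans_lt h3)
    exact ⟨mem_ball.2 (by linarith), by linarith [g2.1], by linarith [g3.1], by linarith [g3.2]⟩
  -- The sum of the powers with the smallest and the largest exponent dominates: the first is
  -- decisive for `t ≤ 1`, the second for `t ≥ 1`.
  refine analyticAt_integral_of_dominated hR0 (b := fun t =>
    (t ^ (s₀.re / 2 - 1) * Real.exp (-(w₀.re / 2) * t) +
      t ^ (3 * s₀.re / 2 - 1) * Real.exp (-(w₀.re / 2) * t)) / c) ?_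
    (fun q _ => (measurable_lerchKer _ _ _).aestronglyMeasurable) ?_ ?_
  · exact (((integrableOn_rpow_mul_exp (by linarith) (by linarith)).add
      (integrableOn_rpow_mul_exp (by linarith) (by linarith))).mono_set hS0).div_const c
  · refine (ae_restrict_iff' hS).2 (Filter.Eventually.of_forall fun t ht q hqb => ?_)
    obtain ⟨h1, h2, h3, h4⟩ := hq hqb
    have ht0 : 0 < t := hS0 ht
    refine (norm_lerchKer_le ht0 hc (hball _ h1 t ht)).trans ?_
    have a1 : Real.exp (-q.2.1.re * t) ≤ Real.exp (-(w₀.re / 2) * t) := by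
      apply Real.exp_le_exp.2; nlinarith
    have a2 : t ^ (q.2.2.re - 1) ≤ t ^ (s₀.re / 2 - 1) + t ^ (3 * s₀.re / 2 - 1) := by
      have p1 : 0 < t ^ (s₀.re / 2 - 1) := Real.rpow_pos_of_pos ht0 _
      have p2 : 0 < t ^ (3 * s₀.re / 2 - 1) := Real.rpow_pos_of_pos ht0 _
      rcases le_total t 1 with h | h
      · have := Real.rpow_le_rpow_of_exponent_ge ht0 h
          (by linarith : s₀.re / 2 - 1 ≤ q.2.2.re - 1)
        linarith
      · have := Real.rpow_le_rpow_of_exponent_le h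
          (by linarith : q.2.2.re - 1 ≤ 3 * s₀.re / 2 - 1)
        linarith
    rw [← add_mul]
    have p3 : 0 < t ^ (q.2.2.re - 1) := Real.rpow_pos_of_pos ht0 _
    gcongr
  · refine (ae_restrict_iff' hS).2 (Filter.Eventually.of_forall fun t ht q hqb => ?_)
    obtain ⟨h1, -⟩ := hq hqb
    have ht0 : (t : ℂ) ≠ 0 := ofReal_ne_zero.2 (ne_of_gt (hS0 ht))
    have hne : 1 - exp (2 * Real.pi * I * q.1 - t) ≠ 0 :=
      norm_pos_iff.1 (hc.trans_le (hball _ h1 t ht))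
    unfold lerchKer
    refine DifferentiableAt.differentiableWithinAt ?_
    have : DifferentiableAt ℂ (fun q : ℂ × ℂ × ℂ => (t : ℂ) ^ (q.2.2 - 1)) q :=
      DifferentiableAt.const_cpow (by fun_prop) (Or.inl ht0)
    fun_prop (disch := assumption)

lemma analyticAt_lerchInt {x₀ w₀ s₀ : ℂ} (hx : x₀ ∈ cutPlane 1 Set.univ) (hw : 0 < w₀.re)
    (hs : 0 < s₀.re) : AnalyticAt ℂ lerchInt (x₀, w₀, s₀) := by
  obtain ⟨c, hc, h⟩ := exists_bound_kernel hx
  refine AnalyticAt.mul ?_ (analyticAt_integral_lerchKer measurableSet_Ioi subset_rfl hc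
    (h.mono fun x hx t ht => hx t (le_of_lt ht)) hw hs)
  have : AnalyticAt ℂ (fun s : ℂ => (Gamma s)⁻¹) s₀ :=
    differentiable_one_div_Gamma.analyticAt s₀
  exact AnalyticAt.comp (g := fun s : ℂ => (Gamma s)⁻¹) this (analyticAt_snd.comp analyticAt_snd)

lemma integrableOn_cpow_mul_exp {w s : ℂ} (hw : 0 < w.re) (hs : 0 < s.re) :
    IntegrableOn (fun t : ℝ => (t : ℂ) ^ (s - 1) * exp (-w * t)) (Set.Ioi 0) := by
  refine (integrableOn_rpow_mul_exp hs hw).mono' ?_ ?_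
  · have : Measurable fun t : ℝ => (t : ℂ) ^ (s - 1) := Complex.measurable_ofReal.pow_const _
    exact (by fun_prop : Measurable fun t : ℝ => (t : ℂ) ^ (s - 1) *
      exp (-w * t)).aestronglyMeasurable
  · refine (ae_restrict_iff' measurableSet_Ioi).2 (Filter.Eventually.of_forall fun t ht => ?_)
    rw [norm_mul, norm_cpow_eq_rpow_re_of_pos ht, norm_exp]
    simp

/-- For real `w > 0` this is the Gamma integral after scaling. Both sides are analytic in the right
half-plane and agree at the reals near `1`. -/
lemma integral_cpow_mul_exp {w s : ℂ} (hw : 0 < w.re) (hs : 0 < s.re) :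
    ∫ t in Set.Ioi (0 : ℝ), (t : ℂ) ^ (s - 1) * exp (-w * t) = exp (-(s * log w)) * Gamma s := by
  have hU : IsOpen {w : ℂ | 0 < w.re} := isOpen_lt continuous_const continuous_re
  have hc : IsPreconnected {w : ℂ | 0 < w.re} := (convex_halfSpace_re_gt 0).isPreconnected
  have hf : AnalyticOnNhd ℂ (fun w => ∫ t in Set.Ioi (0 : ℝ), (t : ℂ) ^ (s - 1) * exp (-w * t))
      {w : ℂ | 0 < w.re} := by
    refine DifferentiableOn.analyticOnNhd (fun z hz => ?_) hU
    have hz : 0 < z.re := hz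
    have hre {x : ℂ} (hx : x ∈ ball z (z.re / 2)) : z.re / 2 < x.re := by
      rw [mem_ball, dist_eq] at hx
      have := (abs_lt.1 ((abs_re_le_norm (x - z)).trans_lt hx)).1
      rw [sub_re] at this
      linarith
    refine (differentiableAt_integral_of_dominated (half_pos hz)
      (b := fun t => t ^ (s.re - 1) * Real.exp (-(z.re / 2) * t))
      (integrableOn_rpow_mul_exp hs (half_pos hz)) (fun x hx =>
        (integrableOn_cpow_mul_exp ((half_pos hz).trans (hre hx)) hs).aestronglyMeasurable)
      ?_ (Filter.Eventually.of_forall fun t => by fun_prop)).differentiableWithinAt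
    refine (ae_restrict_iff' measurableSet_Ioi).2 (Filter.Eventually.of_forall fun t ht x hx => ?_)
    have ht0 : 0 < t := ht
    rw [norm_mul, norm_cpow_eq_rpow_re_of_pos ht0, norm_exp, sub_re, one_re]
    have e1 : (-x * (t : ℂ)).re ≤ -(z.re / 2) * t := by
      simp; nlinarith [hre hx]
    have : 0 < t ^ (s.re - 1) := Real.rpow_pos_of_pos ht0 _
    gcongr
  have hg : AnalyticOnNhd ℂ (fun w => exp (-(s * log w)) * Gamma s) {w : ℂ | 0 < w.re} := by
    refine DifferentiableOn.analyticOnNhd (fun z hz => DifferentiableAt.differentiableWithinAt ?_) hU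
    have : DifferentiableAt ℂ log z := differentiableAt_log (Or.inl hz)
    fun_prop
  refine hf.eqOn_of_preconnected_of_frequently_eq hg hc (z₀ := 1) (by simp) ?_ hw
  have ht : Filter.Tendsto (fun r : ℝ => (r : ℂ)) (𝓝[≠] 1) (𝓝[≠] 1) := by
    refine tendsto_nhdsWithin_iff.2 ⟨?_, ?_⟩
    · exact (by simpa using continuous_ofReal.tendsto 1 :
        Filter.Tendsto (fun r : ℝ => (r : ℂ)) (𝓝 1) (𝓝 1)).mono_left nhdsWithin_le_nhds
    · filter_upwards [self_mem_nhdsWithin] with r hr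
      simpa using hr
  refine ht.frequently (Filter.Eventually.frequently ?_)
  filter_upwards [nhdsWithin_le_nhds (eventually_gt_nhds (one_pos : (0 : ℝ) < 1))] with r hr
  have h := integral_cpow_mul_exp_neg_mul_Ioi hs hr
  have : ((1 : ℂ) / r) ^ s = exp (-(s * log r)) := by
    rw [one_div, inv_cpow _ _ (by rw [arg_ofReal_of_nonneg hr.le]; exact Real.pi_pos.ne),
      cpow_def_of_ne_zero (ofReal_ne_zero.2 hr.ne'), ← exp_neg]
    ring_nf
  rw [← this, ← h]
  simp only [neg_mul]

/-- The identity `1/(1 - E) = 1 + E/(1 - E)` with `E = e^{2πix-t}`, under the integral. -/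
lemma lerchInt_succ {x w s : ℂ} (hx : x ∈ cutPlane 1 Set.univ) (hw : 0 < w.re) (hs : 0 < s.re) :
    lerchInt (x, w, s) = exp (-(s * log w)) +
      exp (2 * Real.pi * I * x) * lerchInt (x, w + 1, s) := by
  have hw1 : 0 < (w + 1).re := by simp; linarith
  have h1 : ∫ t in Set.Ioi (0 : ℝ), lerchKer x w s t =
      (∫ t in Set.Ioi (0 : ℝ), (t : ℂ) ^ (s - 1) * exp (-w * t)) +
      exp (2 * Real.pi * I * x) * ∫ t in Set.Ioi (0 : ℝ), lerchKer x (w + 1) s t := by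
    rw [← integral_const_mul, ← integral_add (integrableOn_cpow_mul_exp hw hs)
      ((integrableOn_lerchKer hx hw1 hs).const_mul _)]
    refine setIntegral_congr_fun measurableSet_Ioi fun t ht => ?_
    have hne := one_sub_exp_ne_zero hx (le_of_lt ht)
    have e : exp (-(w + 1) * t) * exp (2 * Real.pi * I * x) =
        exp (-w * t) * exp (2 * Real.pi * I * x - t) := by
      rw [← exp_add, ← exp_add]; ring_nf
    simp only [lerchKer]
    rw [← mul_div_assoc, div_eq_iff hne, add_mul, div_mul_cancel₀ _ hne]
    linear_combination -(t : ℂ) ^ (s - 1) * e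
  have hG : Gamma s ≠ 0 := Gamma_ne_zero_of_re_pos hs
  simp only [lerchInt]
  rw [h1, integral_cpow_mul_exp hw hs]
  field_simp

/-- For `Im x > 0` the denominator expands into a geometric series of ratio less than `1`; its terms
integrate to Gamma values. -/
lemma hasSum_lerchInt {x w s : ℂ} (hx : 0 < x.im) (hw : 0 < w.re) (hs : 0 < s.re) :
    HasSum (fun n : ℕ => exp (2 * Real.pi * I * n * x) * exp (-(s * log (w + n))))
      (lerchInt (x, w, s)) := by
  set q := exp (2 * Real.pi * I * x) with hq
  have hq1 : ‖q‖ < 1 := by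
    rw [hq, norm_exp, Real.exp_lt_one_iff]
    have : (2 * Real.pi * I * x).re = -(2 * Real.pi * x.im) := by simp
    rw [this, neg_lt_zero]
    have := Real.pi_pos
    positivity
  have hwn (n : ℕ) : 0 < (w + n).re := by simp; positivity
  let F : ℕ → ℝ → ℂ := fun n t => q ^ n * ((t : ℂ) ^ (s - 1) * exp (-(w + n) * t))
  have hint (n : ℕ) : IntegrableOn (F n) (Set.Ioi 0) :=
    (integrableOn_cpow_mul_exp (hwn n) hs).const_mul _
  have hsum : Summable fun n => ∫ t in Set.Ioi (0 : ℝ), ‖F n t‖ := by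
    refine Summable.of_nonneg_of_le (fun n => integral_nonneg fun t => norm_nonneg _)
      (fun n => ?_) ((summable_geometric_of_lt_one (norm_nonneg q) hq1).mul_right
      (∫ t in Set.Ioi (0 : ℝ), t ^ (s.re - 1) * Real.exp (-w.re * t)))
    rw [← integral_const_mul]
    refine setIntegral_mono_on (hint n).norm ((integrableOn_rpow_mul_exp hs hw).const_mul _)
      measurableSet_Ioi fun t ht => ?_
    have ht0 : 0 < t := ht
    simp only [F, norm_mul, norm_pow, norm_cpow_eq_rpow_re_of_pos ht0, norm_exp, sub_re, one_re]
    have e1 : (-(w + n) * (t : ℂ)).re ≤ -w.re * t := by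
      simp; nlinarith [(n.cast_nonneg : (0 : ℝ) ≤ n)]
    have : 0 < t ^ (s.re - 1) := Real.rpow_pos_of_pos ht0 _
    gcongr
  have h := hasSum_integral_of_summable_integral_norm hint hsum
  have e1 : ∫ t in Set.Ioi (0 : ℝ), ∑' n, F n t = ∫ t in Set.Ioi (0 : ℝ), lerchKer x w s t := by
    refine setIntegral_congr_fun measurableSet_Ioi fun t ht => ?_
    have ht0 : 0 < t := ht
    have hlt : ‖exp (2 * Real.pi * I * x - t)‖ < 1 := by
      rw [exp_sub_ofReal_eq, norm_mul, norm_real, Real.norm_eq_abs, abs_of_pos (Real.exp_pos _)]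
      have : Real.exp (-t) ≤ 1 := Real.exp_le_one_iff.2 (by linarith)
      calc _ ≤ 1 * ‖q‖ := by gcongr
        _ < 1 := by rwa [one_mul]
    have : ∀ n, F n t = (t : ℂ) ^ (s - 1) * exp (-w * t) * exp (2 * Real.pi * I * x - t) ^ n := by
      intro n
      have : exp (-(w + n) * t) = exp (-w * t) * exp (-(t : ℂ)) ^ n := by
        rw [← exp_nat_mul, ← exp_add]; ring_nf
      simp only [F]
      rw [this, sub_eq_add_neg (2 * Real.pi * I * x), exp_add, mul_pow]; ring
    simp only [this]
    rw [tsum_mul_left, tsum_geometric_of_norm_lt_one hlt, lerchKer, div_eq_mul_inv]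
  rw [e1] at h
  have h' := h.mul_left (Gamma s)⁻¹
  refine h'.congr_fun fun n => ?_
  simp only [F]
  rw [integral_const_mul, integral_cpow_mul_exp (hwn n) hs]
  have hG : Gamma s ≠ 0 := Gamma_ne_zero_of_re_pos hs
  rw [hq, ← exp_nat_mul]
  field_simp

end Lerch

/-! ### Continuation of the Lerch function to all `s`. -/

section LerchExtension

/-- The shift `(x, w, s) ↦ (x, w, s + 1)`. -/
def shiftS (p : ℂ × ℂ × ℂ) : ℂ × ℂ × ℂ := (p.1, p.2.1, p.2.2 + 1)

lemma continuous_shiftS : Continuous shiftS := by unfold shiftS; fun_prop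

/-- The differential operator that lowers the exponent of the Lerch function by one. -/
noncomputable def lerchOp (f : ℂ × ℂ × ℂ → ℂ) (p : ℂ × ℂ × ℂ) : ℂ :=
  p.2.1 * f (shiftS p) + (2 * Real.pi * I)⁻¹ * deriv (fun y => f (y, (shiftS p).2)) p.1

lemma hasDerivAt_fst {f : ℂ × ℂ × ℂ → ℂ} {p : ℂ × ℂ × ℂ} (hf : AnalyticAt ℂ f p) :
    HasDerivAt (fun y => f (y, p.2)) (fderiv ℂ f p (1, 0)) p.1 := by
  have h1 : HasDerivAt (fun y : ℂ => (y, p.2)) ((1 : ℂ), (0 : ℂ × ℂ)) p.1 :=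
    (hasDerivAt_id p.1).prodMk (hasDerivAt_const p.1 p.2)
  exact hf.differentiableAt.hasFDerivAt.comp_hasDerivAt (f := fun y : ℂ => (y, p.2)) p.1 h1

/-- The derivative in the first variable is the Fréchet derivative in the direction `(1, 0)`, which
is jointly analytic. -/
lemma AnalyticAt.lerchOp {f : ℂ × ℂ × ℂ → ℂ} {p : ℂ × ℂ × ℂ} (hf : AnalyticAt ℂ f (shiftS p)) :
    AnalyticAt ℂ (lerchOp f) p := by
  have hshift : AnalyticAt ℂ shiftS p :=
    analyticAt_fst.prod ((analyticAt_fst.comp analyticAt_snd).prod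
      ((analyticAt_snd.comp analyticAt_snd).add analyticAt_const))
  have h1 : AnalyticAt ℂ (fun q => f (shiftS q)) p := hf.comp hshift
  have h2 : AnalyticAt ℂ (fun q => fderiv ℂ f (shiftS q) (1, 0)) p := by
    have h3 : AnalyticAt ℂ (fun q => fderiv ℂ f (shiftS q)) p :=
      (AnalyticAt.fderiv hf).comp (f := shiftS) hshift
    exact (ContinuousLinearMap.apply ℂ ℂ ((1 : ℂ), (0 : ℂ × ℂ))).analyticAt _ |>.comp h3
  have h4 : AnalyticAt ℂ (fun q : ℂ × ℂ × ℂ => q.2.1 * f (shiftS q) +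
      (2 * Real.pi * I)⁻¹ * fderiv ℂ f (shiftS q) (1, 0)) p :=
    ((analyticAt_fst.comp analyticAt_snd).mul h1).add (analyticAt_const.mul h2)
  refine h4.congr ?_
  have hev : ∀ᶠ q in 𝓝 p, AnalyticAt ℂ f (shiftS q) :=
    continuous_shiftS.continuousAt.eventually hf.eventually_analyticAt
  filter_upwards [hev] with q hq
  have := (hasDerivAt_fst hq).deriv
  rw [_root_.lerchOp, ← this]
  rfl

lemma lerchOp_congr {f g : ℂ × ℂ × ℂ → ℂ} {p : ℂ × ℂ × ℂ} (h : f =ᶠ[𝓝 (shiftS p)] g) :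
    lerchOp f p = lerchOp g p := by
  have h1 : (fun y => f (y, (shiftS p).2)) =ᶠ[𝓝 p.1] fun y => g (y, (shiftS p).2) := by
    have : ContinuousAt (fun y : ℂ => (y, (shiftS p).2)) p.1 := by fun_prop
    exact this.eventually h
  rw [lerchOp, lerchOp, h.self_of_nhds, h1.deriv_eq]

lemma lerchOp_add {f g : ℂ × ℂ × ℂ → ℂ} {p : ℂ × ℂ × ℂ} (hf : AnalyticAt ℂ f (shiftS p))
    (hg : AnalyticAt ℂ g (shiftS p)) :
    lerchOp (fun q => f q + g q) p = lerchOp f p + lerchOp g p := by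
  have hf' : DifferentiableAt ℂ (fun y => f (y, (shiftS p).2)) p.1 :=
    (hasDerivAt_fst hf).differentiableAt
  have hg' : DifferentiableAt ℂ (fun y => g (y, (shiftS p).2)) p.1 :=
    (hasDerivAt_fst hg).differentiableAt
  simp only [lerchOp]
  rw [deriv_fun_add hf' hg']
  ring

lemma isPreconnected_cutPlane : IsPreconnected (cutPlane 1 Set.univ) :=
  isPreconnected_iff_preconnectedSpace.2 inferInstance

lemma analyticAt_lerchOp_lerchInt {x w s : ℂ} (hx : x ∈ cutPlane 1 Set.univ) (hw : 0 < w.re)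
    (hs : -1 < s.re) : AnalyticAt ℂ (lerchOp lerchInt) (x, w, s) :=
  AnalyticAt.lerchOp (analyticAt_lerchInt hx hw (by simp; linarith))

lemma AnalyticAt.along_thd {f : ℂ × ℂ × ℂ → ℂ} {x w s : ℂ} (hf : AnalyticAt ℂ f (x, w, s)) :
    AnalyticAt ℂ (fun u => f (x, w, u)) s :=
  AnalyticAt.comp (g := f) (f := fun u : ℂ => (x, w, u)) hf
    (analyticAt_const.prod (analyticAt_const.prod analyticAt_id))

/-- Termwise, `(2πi)⁻¹ ∂_x` multiplies by `n`; together with `w` this gives the factor `w + n`,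
which cancels one power in the denominator. -/
lemma lerchOp_lerchInt_of_im_pos {x w s : ℂ} (hx : 0 < x.im) (hw : 0 < w.re) (hs : 0 < s.re) :
    lerchOp lerchInt (x, w, s) = lerchInt (x, w, s) := by
  have hs1 : 0 < (s + 1).re := by simp; linarith
  -- On `Im y > δ` the terms are bounded by their norms at `δi`, which are summable; so termwise
  -- differentiation is allowed.
  set δ := x.im / 2 with hδ
  have hδ0 : 0 < δ := by positivity
  let F : ℕ → ℂ → ℂ := fun n y => exp (2 * Real.pi * I * n * y) * exp (-((s + 1) * log (w + n)))
  have hsum : Summable fun n => ‖F n (δ * I)‖ :=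
    ((hasSum_lerchInt (x := δ * I) (by simpa using hδ0) hw hs1).summable).norm
  have hle (n : ℕ) (y : ℂ) (hy : y ∈ {y : ℂ | δ < y.im}) : ‖F n y‖ ≤ ‖F n (δ * I)‖ := by
    have hy : δ < y.im := hy
    simp only [F, norm_mul, norm_exp]
    have : (2 * Real.pi * I * n * y).re ≤ (2 * Real.pi * I * n * (δ * I)).re := by
      have : (0 : ℝ) ≤ 2 * Real.pi * n := by positivity
      simp
      nlinarith
    gcongr
  have hopen : IsOpen {y : ℂ | δ < y.im} := isOpen_lt continuous_const continuous_im
  have hxm : x ∈ {y : ℂ | δ < y.im} := by simp [hδ]; linarith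
  have h1 := Complex.hasSum_deriv_of_summable_norm hsum
    (fun n => (by fun_prop : Differentiable ℂ (F n)).differentiableOn) hopen hle hxm
  have h2 : (fun y => ∑' n, F n y) =ᶠ[𝓝 x] fun y => lerchInt (y, w, s + 1) := by
    filter_upwards [hopen.mem_nhds hxm] with y hy
    exact (hasSum_lerchInt (hδ0.trans hy) hw hs1).tsum_eq
  rw [h2.deriv_eq] at h1
  have h3 := ((hasSum_lerchInt hx hw hs1).mul_left w).add (h1.mul_left (2 * Real.pi * I)⁻¹)
  refine h3.unique ((hasSum_lerchInt hx hw hs).congr_fun fun n => ?_)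
  have hd : deriv (F n) x = 2 * Real.pi * I * n * F n x := by
    have h : HasDerivAt (fun y : ℂ => 2 * Real.pi * I * n * y) (2 * Real.pi * I * n) x := by
      simpa using (hasDerivAt_id x).const_mul (2 * Real.pi * I * n)
    rw [(h.cexp.mul_const (exp (-((s + 1) * log (w + n))))).deriv]
    simp only [F]; ring
  have hne : w + n ≠ 0 := by
    intro h
    have := congrArg re h
    simp at this
    linarith [(n.cast_nonneg : (0 : ℝ) ≤ n)]
  have e1 : exp (-(s * log (w + n))) = (w + n) * exp (-((s + 1) * log (w + n))) := by
    conv_rhs => rw [← exp_log hne, exp_log hne]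
    nth_rewrite 2 [← exp_log hne]
    rw [← exp_add]
    ring_nf
  rw [hd, e1]
  simp only [F]
  field_simp [two_pi_I_ne_zero]

/-- Both sides are analytic in `x` on the connected cut plane and agree in the upper half-plane. -/
lemma lerchOp_lerchInt {x w s : ℂ} (hx : x ∈ cutPlane 1 Set.univ) (hw : 0 < w.re) (hs : 0 < s.re) :
    lerchOp lerchInt (x, w, s) = lerchInt (x, w, s) := by
  have h := AnalyticOnNhd.eqOn_of_preconnected_of_eventuallyEq (z₀ := I)
    (f := fun y => lerchOp lerchInt (y, w, s)) (g := fun y => lerchInt (y, w, s))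
    (fun y hy => (analyticAt_lerchOp_lerchInt hy hw (by linarith)).along_fst)
    (fun y hy => (analyticAt_lerchInt hy hw hs).along_fst) isPreconnected_cutPlane
    (fun l _ h => by simp at h; linarith [h.2]) ?_
  · exact h hx
  · filter_upwards [(isOpen_lt continuous_const continuous_im).mem_nhds
      (by simp : (0 : ℝ) < I.im)] with y hy
    exact lerchOp_lerchInt_of_im_pos hy hw hs

/-- The iterates of `lerchOp`, which extend the Lerch function to `-n < Re s`. -/
noncomputable def lerchIter (n : ℕ) : ℂ × ℂ × ℂ → ℂ := lerchOp^[n] lerchInt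

lemma lerchIter_succ (n : ℕ) : lerchIter (n + 1) = lerchOp (lerchIter n) :=
  Function.iterate_succ_apply' _ _ _

lemma analyticAt_lerchIter (n : ℕ) {x w s : ℂ} (hx : x ∈ cutPlane 1 Set.univ) (hw : 0 < w.re)
    (hs : -n < s.re) : AnalyticAt ℂ (lerchIter n) (x, w, s) := by
  induction n generalizing s with
  | zero => exact analyticAt_lerchInt hx hw (by simpa using hs)
  | succ n ih =>
    rw [lerchIter_succ]
    refine AnalyticAt.lerchOp (ih ?_)
    push_cast at hs
    simp
    linarith

lemma lerchIter_succ_eq (n : ℕ) {x w s : ℂ} (hx : x ∈ cutPlane 1 Set.univ) (hw : 0 < w.re)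
    (hs : -n < s.re) : lerchIter (n + 1) (x, w, s) = lerchIter n (x, w, s) := by
  induction n generalizing x w s with
  | zero => exact lerchOp_lerchInt hx hw (by simpa using hs)
  | succ n ih =>
    rw [lerchIter_succ, lerchIter_succ n]
    refine lerchOp_congr ?_
    have h1 : ∀ᶠ q : ℂ × ℂ × ℂ in 𝓝 (shiftS (x, w, s)), q.1 ∈ cutPlane 1 Set.univ :=
      continuous_fst.continuousAt.eventually ((isOpen_cutPlane 1 Set.univ).mem_nhds hx)
    have h2 : ∀ᶠ q : ℂ × ℂ × ℂ in 𝓝 (shiftS (x, w, s)), 0 < q.2.1.re :=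
      (continuous_re.comp (continuous_fst.comp continuous_snd)).continuousAt.eventually_const_lt hw
    have h3 : ∀ᶠ q : ℂ × ℂ × ℂ in 𝓝 (shiftS (x, w, s)), -n < q.2.2.re := by
      refine (continuous_re.comp
        (continuous_snd.comp continuous_snd)).continuousAt.eventually_const_lt ?_
      push_cast at hs
      simp [shiftS]
      linarith
    filter_upwards [h1, h2, h3] with q q1 q2 q3
    rw [← lerchIter_succ]
    exact ih q1 q2 q3

lemma lerchIter_eq_of_le {m n : ℕ} (hmn : m ≤ n) {x w s : ℂ} (hx : x ∈ cutPlane 1 Set.univ)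
    (hw : 0 < w.re) (hs : -m < s.re) : lerchIter n (x, w, s) = lerchIter m (x, w, s) := by
  induction n, hmn using Nat.le_induction with
  | base => rfl
  | succ n hn ih =>
    rw [lerchIter_succ_eq n hx hw, ih]
    have : (m : ℝ) ≤ n := by exact_mod_cast hn
    linarith

/-- The Lerch function for `x` in the plane cut downward from the integers, `0 < Re w` and all
`s`. -/
noncomputable def lerchExt (p : ℂ × ℂ × ℂ) : ℂ := lerchIter (⌊‖p.2.2‖⌋₊ + 1) p

/-- The number of iterates in `lerchExt` exceeds `‖s‖ ≥ -Re s`, and all admissible numbers of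
iterates give the same value. -/
lemma lerchExt_eq (n : ℕ) {x w s : ℂ} (hx : x ∈ cutPlane 1 Set.univ) (hw : 0 < w.re)
    (hs : -n < s.re) : lerchExt (x, w, s) = lerchIter n (x, w, s) := by
  have h : -((⌊‖s‖⌋₊ + 1 : ℕ) : ℝ) < s.re := by
    have h1 := Nat.lt_floor_add_one ‖s‖
    have h2 := (abs_le.1 (abs_re_le_norm s)).1
    push_cast
    linarith
  rw [lerchExt]
  rcases le_total n (⌊‖s‖⌋₊ + 1) with h1 | h1
  · exact lerchIter_eq_of_le h1 hx hw hs
  · exact (lerchIter_eq_of_le h1 hx hw h).symm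

lemma lerchExt_eq_lerchInt {x w s : ℂ} (hx : x ∈ cutPlane 1 Set.univ) (hw : 0 < w.re)
    (hs : 0 < s.re) : lerchExt (x, w, s) = lerchInt (x, w, s) :=
  lerchExt_eq 0 hx hw (by simpa using hs)

lemma lerchExt_eventuallyEq (n : ℕ) {x w s : ℂ} (hw : 0 < w.re) (hs : -n < s.re) :
    ∀ᶠ q in 𝓝 (x, w, s), q.1 ∈ cutPlane 1 Set.univ → lerchExt q = lerchIter n q := by
  have h2 : ∀ᶠ q : ℂ × ℂ × ℂ in 𝓝 (x, w, s), 0 < q.2.1.re :=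
    (continuous_re.comp (continuous_fst.comp continuous_snd)).continuousAt.eventually_const_lt hw
  have h3 : ∀ᶠ q : ℂ × ℂ × ℂ in 𝓝 (x, w, s), -n < q.2.2.re :=
    (continuous_re.comp (continuous_snd.comp continuous_snd)).continuousAt.eventually_const_lt hs
  filter_upwards [h2, h3] with q q2 q3 q1
  exact lerchExt_eq n q1 q2 q3

lemma exists_neg_lt_re (s : ℂ) : ∃ n : ℕ, -n < s.re := by
  obtain ⟨n, hn⟩ := exists_nat_gt (-s.re)
  exact ⟨n, by linarith⟩

lemma analyticAt_lerchExt {x w s : ℂ} (hx : x ∈ cutPlane 1 Set.univ) (hw : 0 < w.re) :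
    AnalyticAt ℂ lerchExt (x, w, s) := by
  obtain ⟨n, hn⟩ := exists_neg_lt_re s
  refine (analyticAt_lerchIter n hx hw hn).congr ?_
  filter_upwards [lerchExt_eventuallyEq n hw hn, continuous_fst.continuousAt.eventually
    ((isOpen_cutPlane 1 Set.univ).mem_nhds hx)] with q hq hq1
  exact (hq hq1).symm

/-- Both sides are entire in `s` and agree for `Re s > 0`, where the integral is available. -/
lemma lerchExt_succ {x w : ℂ} (s : ℂ) (hx : x ∈ cutPlane 1 Set.univ) (hw : 0 < w.re) :
    lerchExt (x, w, s) = exp (-(s * log w)) +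
      exp (2 * Real.pi * I * x) * lerchExt (x, w + 1, s) := by
  have hw1 : 0 < (w + 1).re := by simp; linarith
  have h := AnalyticOnNhd.eqOn_of_preconnected_of_eventuallyEq (z₀ := 1) (U := Set.univ)
    (f := fun u => lerchExt (x, w, u)) (g := fun u => exp (-(u * log w)) +
      exp (2 * Real.pi * I * x) * lerchExt (x, w + 1, u))
    (fun u _ => (analyticAt_lerchExt hx hw).along_thd)
    (fun u _ => AnalyticAt.add (by fun_prop)
      (analyticAt_const.mul (analyticAt_lerchExt hx hw1).along_thd)) isPreconnected_univ trivial ?_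
  · exact h (Set.mem_univ s)
  · filter_upwards [(isOpen_lt continuous_const continuous_re).mem_nhds
      (by simp : (0 : ℝ) < (1 : ℂ).re)] with u hu
    rw [lerchExt_eq_lerchInt hx hw hu, lerchExt_eq_lerchInt hx hw1 hu, lerchInt_succ hx hw hu]

end LerchExtension

/-! ### The jump across a cut, for `Re s > 0`. -/

section Crossing

open MeasureTheory Metric

/-- The function `u / (1 - e ^ (-u))`. -/
noncomputable def todd (u : ℂ) : ℂ := (dslope (fun v : ℂ => -exp (-v)) 0 u)⁻¹

lemma todd_eq {u : ℂ} (hu : u ≠ 0) : todd u = u / (1 - exp (-u)) := by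
  rw [todd, dslope_of_ne _ hu, slope_def_field, sub_zero, inv_div]
  simp only [neg_zero, exp_zero]
  ring_nf

lemma todd_zero : todd 0 = 1 := by
  have h : HasDerivAt (fun v : ℂ => -exp (-v)) 1 0 := by
    have := (((hasDerivAt_id (0 : ℂ)).neg).cexp).neg
    exact this.congr_deriv (by simp)
  rw [todd, dslope_same, h.deriv, inv_one]

/-- The singularity at `0` is removable, and the other zeros of `1 - e^{-u}` are nonzero multiples
of `2πi`. -/
lemma analyticOnNhd_todd : AnalyticOnNhd ℂ todd (ball 0 (2 * Real.pi)) := by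
  have h1 : Differentiable ℂ (dslope (fun v : ℂ => -exp (-v)) 0) := by
    rw [← differentiableOn_univ, Complex.differentiableOn_dslope Filter.univ_mem]
    fun_prop
  intro u hu
  refine AnalyticAt.inv (h1.analyticAt u) fun h => ?_
  rcases eq_or_ne u 0 with rfl | h0
  · have := todd_zero
    rw [todd, h] at this
    simp at this
  · rw [dslope_of_ne _ h0, slope_def_field, sub_zero, div_eq_zero_iff] at h
    simp only [neg_zero, exp_zero, h0, or_false] at h
    have h2 : exp (-u) = 1 := by linear_combination -h
    obtain ⟨n, hn⟩ := exp_eq_one_iff.1 h2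
    have hn0 : n ≠ 0 := by
      rintro rfl
      simp [h0] at hn
    have h3 : ‖u‖ = |(n : ℝ)| * (2 * Real.pi) := by
      rw [← norm_neg, hn]
      simp [abs_of_pos Real.pi_pos]
    have h4 : (1 : ℝ) ≤ |(n : ℝ)| := by exact_mod_cast Int.one_le_abs hn0
    rw [mem_ball_zero_iff, h3] at hu
    nlinarith [Real.pi_pos]

/-- The function `v ^ (s - 1) e ^ (-w v)`. -/
noncomputable def gammaKer (w s v : ℂ) : ℂ := exp ((s - 1) * log v) * exp (-w * v)

lemma hasDerivAt_gammaKer (w s : ℂ) {v : ℂ} (hv : v ∈ slitPlane) :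
    HasDerivAt (gammaKer w s) (((s - 1) / v - w) * gammaKer w s v) v := by
  have h1 := (((hasDerivAt_log hv).const_mul (s - 1)).cexp).mul
    (((hasDerivAt_id v).const_mul (-w)).cexp)
  refine h1.congr_deriv ?_
  simp only [gammaKer, id]
  ring

lemma gammaKer_ofReal (w s : ℂ) {t : ℝ} (ht : 0 < t) :
    gammaKer w s t = (t : ℂ) ^ (s - 1) * exp (-w * t) := by
  rw [gammaKer, cpow_def_of_ne_zero (ofReal_ne_zero.2 ht.ne'), mul_comm (s - 1)]

lemma analyticAt_gammaKer {p : ℂ × ℂ × ℂ} {f : ℂ × ℂ × ℂ → ℂ} (hf : AnalyticAt ℂ f p)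
    (h : f p ∈ slitPlane) : AnalyticAt ℂ (fun q => gammaKer q.2.1 q.2.2 (f q)) p := by
  have h1 : AnalyticAt ℂ (fun q : ℂ × ℂ × ℂ => q.2.1) p := analyticAt_fst.comp analyticAt_snd
  have h2 : AnalyticAt ℂ (fun q : ℂ × ℂ × ℂ => q.2.2) p := analyticAt_snd.comp analyticAt_snd
  exact (((h2.sub analyticAt_const).mul (hf.clog h)).cexp).mul ((h1.neg.mul hf).cexp)

/-- The integrand of the regular part of the Lerch integral near a pole. -/
noncomputable def regKer (w s y v : ℂ) : ℂ :=
  ((s - 1) / v - w) * gammaKer w s v * todd (v - y) + gammaKer w s v * deriv todd (v - y)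

lemma hasDerivAt_regKer (w s y : ℂ) {v : ℂ} (hv : v ∈ slitPlane)
    (hvy : v - y ∈ ball (0 : ℂ) (2 * Real.pi)) :
    HasDerivAt (fun v => gammaKer w s v * todd (v - y)) (regKer w s y v) v := by
  have h1 : HasDerivAt todd (deriv todd (v - y)) (v - y) :=
    (analyticOnNhd_todd _ hvy).differentiableAt.hasDerivAt
  have h2 : HasDerivAt (fun v => todd (v - y)) (deriv todd (v - y)) v := by
    have := h1.comp (h := fun v => v - y) v ((hasDerivAt_id v).sub_const y)
    rwa [mul_one] at this
  exact (hasDerivAt_gammaKer w s hv).mul h2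

lemma integral_inv_sub {a b : ℝ} (hab : a ≤ b) {y : ℂ} (hy : y.im ≠ 0) :
    ∫ t in Set.Icc a b, ((t : ℂ) - y)⁻¹ = log (b - y) - log (a - y) := by
  rw [integral_Icc_eq_integral_Ioc, ← intervalIntegral.integral_of_le hab]
  have hs (t : ℝ) : (t : ℂ) - y ∈ slitPlane := Or.inr (by simpa using hy)
  refine intervalIntegral.integral_eq_sub_of_hasDerivAt (f := fun t : ℝ => log (t - y))
    (fun t _ => ?_) ?_
  · have h := ((hasDerivAt_id (t : ℂ)).sub_const y).clog (hs t)
    simpa using h.comp_ofReal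
  · refine ContinuousOn.intervalIntegrable fun t _ => ContinuousAt.continuousWithinAt ?_
    exact ContinuousAt.inv₀ (by fun_prop) (slitPlane_ne_zero (hs t))

lemma log_neg_of_im_pos {z : ℂ} (hz : 0 < z.im) : log (-z) = log z - Real.pi * I := by
  rw [log, log, norm_neg, arg_neg_eq_arg_sub_pi_of_im_pos hz]
  push_cast; ring

lemma log_neg_of_im_neg {z : ℂ} (hz : z.im < 0) : log (-z) = log z + Real.pi * I := by
  rw [log, log, norm_neg, arg_neg_eq_arg_add_pi_of_im_neg hz]
  push_cast; ring

/-- The centred variable `2πi(x - l)`. -/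
noncomputable def poleVar (l : ℤ) (x : ℂ) : ℂ := 2 * Real.pi * I * (x - l)

lemma poleVar_re (l : ℤ) (x : ℂ) : (poleVar l x).re = -(2 * Real.pi * x.im) := by
  simp [poleVar]

lemma poleVar_im (l : ℤ) (x : ℂ) : (poleVar l x).im = 2 * Real.pi * (x.re - l) := by
  simp [poleVar]

lemma analyticAt_poleVar (l : ℤ) (p : ℂ × ℂ × ℂ) :
    AnalyticAt ℂ (fun q : ℂ × ℂ × ℂ => poleVar l q.1) p :=
  analyticAt_const.mul (analyticAt_fst.sub analyticAt_const)

lemma exp_poleVar_sub (l : ℤ) (x t : ℂ) :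
    exp (2 * Real.pi * I * x - t) = exp (-(t - poleVar l x)) := by
  rw [exp_eq_exp_iff_exists_int]
  exact ⟨l, by rw [poleVar]; ring⟩

/-- On the cut below `l`, the only pole on the line of integration is `T = -2π Im x₀`. Removing an
interval around `T` removes an open interval around `e^{-T}` in `u = e^{-t}`, and the rest is
compact. -/
lemma exists_bound_away {l : ℤ} {x₀ : ℂ} (hre : x₀.re = l) {r : ℝ} (hr : 0 < r) :
    ∃ c > 0, ∀ᶠ x in 𝓝 x₀, ∀ t ∈ Set.Ioi (0 : ℝ) \
      Set.Icc (-(2 * Real.pi * x₀.im) - r) (-(2 * Real.pi * x₀.im) + r),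
      c ≤ ‖1 - exp (2 * Real.pi * I * x - t)‖ := by
  set T := -(2 * Real.pi * x₀.im) with hT
  have hy : poleVar l x₀ = T := Complex.ext (by rw [poleVar_re, ofReal_re])
    (by rw [poleVar_im, hre, sub_self, mul_zero, ofReal_im])
  have hK : IsCompact (Set.Icc (0 : ℝ) 1 \ Set.Ioo (Real.exp (-(T + r))) (Real.exp (-(T - r)))) :=
    isCompact_Icc.diff isOpen_Ioo
  obtain ⟨c, hc, h⟩ := exists_bound_one_sub hK (x₀ := x₀) (by
    rintro u ⟨⟨h0, -⟩, h1⟩ h2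
    have h3 := exp_poleVar_sub l x₀ 0
    rw [sub_zero, hy, zero_sub, neg_neg] at h3
    rw [h3, ← ofReal_exp, ← ofReal_mul, ← ofReal_one, ← ofReal_sub, ofReal_eq_zero] at h2
    have h4 : u = Real.exp (-T) := by
      rw [Real.exp_neg]
      field_simp
      linarith
    exact h1 (h4 ▸ ⟨Real.exp_lt_exp.2 (by linarith), Real.exp_lt_exp.2 (by linarith)⟩))
  refine ⟨c, hc, h.mono fun x hx t ht => ?_⟩
  rw [exp_sub_ofReal_eq]
  refine hx _ ⟨⟨(Real.exp_pos _).le, Real.exp_le_one_iff.2 (by linarith [ht.1.out])⟩, fun h1 => ?_⟩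
  have h2 := Real.exp_lt_exp.1 h1.1
  have h3 := Real.exp_lt_exp.1 h1.2
  exact ht.2 ⟨by linarith, by linarith⟩

/-- The jump of the Lerch function across the cut below the integer `l`. -/
noncomputable def lerchJump (l : ℤ) (p : ℂ × ℂ × ℂ) : ℂ :=
  2 * Real.pi * I * (Gamma p.2.2)⁻¹ * gammaKer p.2.1 p.2.2 (poleVar l p.1)

lemma analyticAt_inv_Gamma (p : ℂ × ℂ × ℂ) :
    AnalyticAt ℂ (fun q : ℂ × ℂ × ℂ => (Gamma q.2.2)⁻¹) p := by
  have : AnalyticAt ℂ (fun s : ℂ => (Gamma s)⁻¹) p.2.2 :=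
    differentiable_one_div_Gamma.analyticAt p.2.2
  exact AnalyticAt.comp (g := fun s : ℂ => (Gamma s)⁻¹) this (analyticAt_snd.comp analyticAt_snd)

lemma analyticAt_lerchJump {l : ℤ} {p : ℂ × ℂ × ℂ} (hp : p.1.im < 0) :
    AnalyticAt ℂ (lerchJump l) p := by
  refine (analyticAt_const.mul (analyticAt_inv_Gamma p)).mul
    (analyticAt_gammaKer (analyticAt_poleVar l p) (Or.inl ?_))
  rw [poleVar_re]
  nlinarith [Real.pi_pos]

lemma mem_cutPlane_of_re_ne {l : ℤ} {x : ℂ} (h1 : |x.re - l| < 1) (h2 : x.re ≠ l) :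
    x ∈ cutPlane 1 Set.univ := by
  rintro m - ⟨h3, -⟩
  rw [h3] at h1 h2
  have h4 : |m - l| < 1 := by exact_mod_cast h1
  have h5 : m = l := by rw [Int.abs_lt_one_iff] at h4; linarith
  exact h2 (by rw [h5])

lemma differentiableAt_regKer {c : ℂ × ℂ × ℂ × ℂ} (h1 : c.2.2.2 ∈ slitPlane)
    (h2 : c.2.2.2 - c.2.2.1 ∈ ball (0 : ℂ) (2 * Real.pi)) :
    DifferentiableAt ℂ (fun c : ℂ × ℂ × ℂ × ℂ => regKer c.1 c.2.1 c.2.2.1 c.2.2.2) c := by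
  have hv : c.2.2.2 ≠ 0 := slitPlane_ne_zero h1
  have e1 : DifferentiableAt ℂ (fun c : ℂ × ℂ × ℂ × ℂ => todd (c.2.2.2 - c.2.2.1)) c :=
    DifferentiableAt.comp (g := todd) c (analyticOnNhd_todd _ h2).differentiableAt (by fun_prop)
  have e2 : DifferentiableAt ℂ (fun c : ℂ × ℂ × ℂ × ℂ => deriv todd (c.2.2.2 - c.2.2.1)) c :=
    DifferentiableAt.comp (g := deriv todd) c
      (analyticOnNhd_todd _ h2).deriv.differentiableAt (by fun_prop)
  have e3 : DifferentiableAt ℂ (fun c : ℂ × ℂ × ℂ × ℂ => gammaKer c.1 c.2.1 c.2.2.2) c := by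
    have : DifferentiableAt ℂ (fun c : ℂ × ℂ × ℂ × ℂ => log c.2.2.2) c :=
      DifferentiableAt.clog (by fun_prop) h1
    unfold gammaKer
    fun_prop
  have e4 : DifferentiableAt ℂ (fun c : ℂ × ℂ × ℂ × ℂ => (c.2.1 - 1) / c.2.2.2 - c.1) c := by
    fun_prop (disch := assumption)
  exact ((e4.mul e3).mul e1).add (e3.mul e2)

lemma continuousOn_regKer {w s y : ℂ} {A B : Set ℝ}
    (h : ∀ t ∈ A, ∀ u ∈ B, y + u * (t - y) ∈ slitPlane ∧
      y + u * (t - y) - y ∈ ball (0 : ℂ) (2 * Real.pi)) :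
    ContinuousOn (fun z : ℝ × ℝ => regKer w s y (y + z.2 * (z.1 - y))) (A ×ˢ B) := by
  rintro ⟨t, u⟩ ⟨ht, hu⟩
  obtain ⟨h1, h2⟩ := h t ht u hu
  refine ContinuousAt.continuousWithinAt ?_
  refine ContinuousAt.comp (g := fun c : ℂ × ℂ × ℂ × ℂ => regKer c.1 c.2.1 c.2.2.1 c.2.2.2)
    (f := fun z : ℝ × ℝ => (w, s, y, y + z.2 * (z.1 - y)))
    (differentiableAt_regKer h1 h2).continuousAt ?_
  fun_prop

/-- The segment from the pole to `t` stays in the disc of radius `r` around `T`. As `r < T`, the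
disc avoids the cut of the power; as `2r ≤ 1 < 2π`, the argument of `todd` stays in its domain. So
the integrand is analytic in the parameters on a compact set. -/
lemma analyticAt_integral_regKer {l : ℤ} {x₀ : ℂ} (w₀ s₀ : ℂ) (hre : x₀.re = l) {r : ℝ}
    (hr : 0 < r) (hrT : r < -(2 * Real.pi * x₀.im)) (hr1 : r ≤ 1 / 2) :
    AnalyticAt ℂ (fun p : ℂ × ℂ × ℂ => ∫ z in Set.Icc (-(2 * Real.pi * x₀.im) - r)
      (-(2 * Real.pi * x₀.im) + r) ×ˢ Set.Icc (0 : ℝ) 1,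
      regKer p.2.1 p.2.2 (poleVar l p.1)
        (poleVar l p.1 + z.2 * (z.1 - poleVar l p.1))) (x₀, w₀, s₀) ∧
    ∀ p ∈ closedBall (x₀, w₀, s₀) (r / 8), ∀ t ∈ Set.Icc (-(2 * Real.pi * x₀.im) - r)
      (-(2 * Real.pi * x₀.im) + r), ∀ u ∈ Set.Icc (0 : ℝ) 1,
      poleVar l p.1 + u * (t - poleVar l p.1) ∈ slitPlane ∧
      poleVar l p.1 + u * (t - poleVar l p.1) - poleVar l p.1 ∈ ball (0 : ℂ) (2 * Real.pi) := by
  set T := -(2 * Real.pi * x₀.im) with hT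
  have hy : poleVar l x₀ = T := Complex.ext (by rw [poleVar_re, ofReal_re])
    (by rw [poleVar_im, hre, sub_self, mul_zero, ofReal_im])
  have key : ∀ p ∈ closedBall (x₀, w₀, s₀) (r / 8), ∀ t ∈ Set.Icc (T - r) (T + r),
      ∀ u ∈ Set.Icc (0 : ℝ) 1, poleVar l p.1 + u * (t - poleVar l p.1) ∈ slitPlane ∧
      poleVar l p.1 + u * (t - poleVar l p.1) - poleVar l p.1 ∈ ball (0 : ℂ) (2 * Real.pi) := by
    intro p hp t ht u hu
    have h1 : ‖p.1 - x₀‖ ≤ r / 8 := by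
      rw [mem_closedBall, Prod.dist_eq] at hp
      rw [← dist_eq]
      exact (le_max_left _ _).trans hp
    -- The pole moves `2π < 8` times as fast as `x`, whence the radius `r / 8`.
    have h2 : ‖poleVar l p.1 - T‖ ≤ r := by
      have : poleVar l p.1 - T = 2 * Real.pi * I * (p.1 - x₀) := by
        rw [← hy, poleVar, poleVar]; ring
      rw [this]
      simp only [norm_mul, norm_ofNat, norm_real, norm_I, Real.norm_eq_abs,
        abs_of_pos Real.pi_pos, mul_one]
      nlinarith [Real.pi_pos, Real.pi_lt_four]
    have h3 : ‖(t : ℂ) - T‖ ≤ r := by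
      rw [← ofReal_sub, norm_real, Real.norm_eq_abs, abs_le]
      exact ⟨by linarith [ht.1], by linarith [ht.2]⟩
    set y := poleVar l p.1
    have h4 : ‖y + u * (t - y) - T‖ ≤ r := by
      have : y + u * (t - y) - T = ((1 - u : ℝ) : ℂ) * (y - T) + u * (t - T) := by
        push_cast; ring
      rw [this]
      refine (norm_add_le _ _).trans ?_
      rw [norm_mul, norm_mul, norm_real, norm_real, Real.norm_eq_abs, Real.norm_eq_abs,
        abs_of_nonneg hu.1, abs_of_nonneg (by linarith [hu.2] : 0 ≤ 1 - u)]
      nlinarith [hu.1, hu.2]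
    refine ⟨Or.inl ?_, ?_⟩
    · have := (abs_le.1 ((abs_re_le_norm _).trans h4)).1
      rw [sub_re, ofReal_re] at this
      linarith
    · have h5 : ‖(t : ℂ) - y‖ ≤ 2 * r := by
        have : (t : ℂ) - y = (t - T) - (y - T) := by ring
        rw [this]
        exact (norm_sub_le _ _).trans (by linarith)
      rw [mem_ball_zero_iff, add_sub_cancel_left, norm_mul, norm_real, Real.norm_eq_abs,
        abs_of_nonneg hu.1]
      have := mul_le_mul hu.2 h5 (norm_nonneg _) zero_le_one
      linarith [Real.pi_gt_three]
  refine ⟨?_, key⟩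
  refine analyticAt_integral_of_compact (μ := volume) (R := r / 8) (by positivity)
    (isCompact_Icc.prod isCompact_Icc) (measurableSet_Icc.prod measurableSet_Icc)
    (isCompact_Icc.prod isCompact_Icc).measure_lt_top.ne ?_ ?_
  · rintro ⟨p, t, u⟩ ⟨hp, ht, hu⟩
    obtain ⟨h1, h2⟩ := key p hp t ht u hu
    refine ContinuousAt.continuousWithinAt ?_
    refine ContinuousAt.comp (g := fun c : ℂ × ℂ × ℂ × ℂ => regKer c.1 c.2.1 c.2.2.1 c.2.2.2)
      (f := fun z : (ℂ × ℂ × ℂ) × (ℝ × ℝ) => (z.1.2.1, z.1.2.2, poleVar l z.1.1,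
        poleVar l z.1.1 + z.2.2 * (z.2.1 - poleVar l z.1.1))) (differentiableAt_regKer h1 h2).continuousAt ?_
    unfold poleVar
    fun_prop
  · rintro ⟨t, u⟩ ⟨ht, hu⟩ p hp
    obtain ⟨h1, h2⟩ := key p (ball_subset_closedBall hp) t ht u hu
    refine DifferentiableAt.differentiableWithinAt ?_
    refine DifferentiableAt.comp (g := fun c : ℂ × ℂ × ℂ × ℂ => regKer c.1 c.2.1 c.2.2.1 c.2.2.2)
      (f := fun z : ℂ × ℂ × ℂ => (z.2.1, z.2.2, poleVar l z.1,
        poleVar l z.1 + u * (t - poleVar l z.1))) p (differentiableAt_regKer h1 h2) ?_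
    unfold poleVar
    fun_prop

/-- With `y` the pole, the kernel is `G(t)/(t - y)`, where `G(v)` is `gammaKer` at `v` times `todd
(v - y)`, and `G(y)` is `gammaKer` at `y`. The quotient `(G(t) - G(y))/(t - y)` is the mean of `G'`
over the segment from `y` to `t`, so the whole singularity is in `G(y)/(t - y)`. -/
lemma lerchKer_eq_regKer {l : ℤ} {x w s : ℂ} {t : ℝ} (ht : 0 < t) (hx : (poleVar l x).im ≠ 0)
    (h : ∀ u ∈ Set.Icc (0 : ℝ) 1, poleVar l x + u * (t - poleVar l x) ∈ slitPlane ∧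
      poleVar l x + u * (t - poleVar l x) - poleVar l x ∈ ball (0 : ℂ) (2 * Real.pi)) :
    lerchKer x w s t = (∫ u in Set.Icc (0 : ℝ) 1,
      regKer w s (poleVar l x) (poleVar l x + u * (t - poleVar l x))) +
      gammaKer w s (poleVar l x) * ((t : ℂ) - poleVar l x)⁻¹ := by
  set y := poleVar l x with hy
  have hty : (t : ℂ) - y ≠ 0 := by
    intro h0
    have := congrArg im h0
    simp at this
    exact hx this
  have hG : ∀ u ∈ Set.Icc (0 : ℝ) 1, HasDerivAt
      (fun u : ℝ => gammaKer w s (y + u * (t - y)) * todd (y + u * (t - y) - y))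
      (regKer w s y (y + u * (t - y)) * (t - y)) u := by
    intro u hu
    have h1 := hasDerivAt_regKer w s y (h u hu).1 (h u hu).2
    have h2 : HasDerivAt (fun u : ℂ => y + u * (t - y)) (t - y) u := by
      simpa using ((hasDerivAt_id (u : ℂ)).mul_const ((t : ℂ) - y)).const_add y
    exact (h1.comp (h := fun u : ℂ => y + u * (t - y)) (u : ℂ) h2).comp_ofReal
  have hcont : ContinuousOn (fun u : ℝ => regKer w s y (y + u * (t - y))) (Set.Icc 0 1) := by
    intro u hu
    refine ContinuousAt.continuousWithinAt ?_
    refine ContinuousAt.comp (g := fun c : ℂ × ℂ × ℂ × ℂ => regKer c.1 c.2.1 c.2.2.1 c.2.2.2)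
      (f := fun u : ℝ => (w, s, y, y + u * (t - y)))
      (differentiableAt_regKer (h u hu).1 (h u hu).2).continuousAt ?_
    fun_prop
  have hint := intervalIntegral.integral_eq_sub_of_hasDerivAt
    (f := fun u : ℝ => gammaKer w s (y + u * (t - y)) * todd (y + u * (t - y) - y))
    (a := 0) (b := 1) (fun u hu => hG u (by rwa [Set.uIcc_of_le zero_le_one] at hu))
    (ContinuousOn.intervalIntegrable (by
      rw [Set.uIcc_of_le zero_le_one]; exact hcont.mul continuousOn_const))
  rw [intervalIntegral.integral_mul_const, intervalIntegral.integral_of_le zero_le_one,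
    ← integral_Icc_eq_integral_Ioc] at hint
  simp only [ofReal_one, one_mul, ofReal_zero, zero_mul, add_zero, sub_self, todd_zero,
    mul_one, add_sub_cancel] at hint
  have e : lerchKer x w s t * (t - y) = gammaKer w s t * todd (t - y) := by
    rw [lerchKer, todd_eq hty, gammaKer_ofReal w s ht, exp_poleVar_sub l]
    ring
  rw [← mul_left_inj' hty, e, add_mul, hint, mul_assoc, inv_mul_cancel₀ hty]
  ring

/-- The integral away from the pole and the regular part near it are analytic across the cut. The
singular part integrates to a difference of two logarithms, and the one at the left end `T - r`
changes by `2πi` when the pole crosses the real axis. -/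
lemma exists_lerchInt_crossing {l : ℤ} {x₀ w₀ s₀ : ℂ} (hre : x₀.re = l) (him : x₀.im < 0)
    (hw : 0 < w₀.re) (hs : 0 < s₀.re) :
    ∃ f : ℂ × ℂ × ℂ → ℂ, AnalyticAt ℂ f (x₀, w₀, s₀) ∧ ∀ᶠ p in 𝓝 (x₀, w₀, s₀),
      ((l : ℝ) < p.1.re → f p = lerchInt p) ∧
      (p.1.re < l → f p = lerchInt p + lerchJump l p) := by
  set T := -(2 * Real.pi * x₀.im) with hT
  have hT0 : 0 < T := by rw [hT]; nlinarith [Real.pi_pos]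
  have hy : poleVar l x₀ = T := Complex.ext (by rw [poleVar_re, ofReal_re])
    (by rw [poleVar_im, hre, sub_self, mul_zero, ofReal_im])
  set r := min (T / 2) (1 / 2) with hrdef
  have hr : 0 < r := lt_min (by positivity) (by norm_num)
  have hrT : r < T := (min_le_left _ _).trans_lt (by linarith)
  obtain ⟨hreg, hkey⟩ := analyticAt_integral_regKer w₀ s₀ hre hr hrT (min_le_right _ _)
  rw [← hT] at hreg hkey
  obtain ⟨c, hc, hb⟩ := exists_bound_away hre hr
  rw [← hT] at hb
  set S₂ := Set.Icc (T - r) (T + r) with hS₂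
  have hS₂0 : S₂ ⊆ Set.Ioi 0 := fun t ht => lt_of_lt_of_le (by linarith) ht.1
  have hfar := analyticAt_integral_lerchKer (x₀ := x₀) (measurableSet_Ioi.diff measurableSet_Icc)
    Set.sdiff_subset hc hb hw hs
  have hlog1 : AnalyticAt ℂ (fun p : ℂ × ℂ × ℂ => log (T + r - poleVar l p.1)) (x₀, w₀, s₀) := by
    refine AnalyticAt.clog (analyticAt_const.sub (analyticAt_poleVar l _)) (Or.inl ?_)
    change 0 < ((T : ℂ) + r - poleVar l x₀).re
    rw [hy]; simpa using hr
  have hlog2 : AnalyticAt ℂ (fun p : ℂ × ℂ × ℂ => log (poleVar l p.1 - (T - r)))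
      (x₀, w₀, s₀) := by
    refine AnalyticAt.clog ((analyticAt_poleVar l _).sub analyticAt_const) (Or.inl ?_)
    change 0 < (poleVar l x₀ - ((T : ℂ) - r)).re
    rw [hy]; simpa using hr
  have hgam : AnalyticAt ℂ (fun p : ℂ × ℂ × ℂ => gammaKer p.2.1 p.2.2 (poleVar l p.1))
      (x₀, w₀, s₀) := by
    refine analyticAt_gammaKer (analyticAt_poleVar l _) (Or.inl ?_)
    change 0 < (poleVar l x₀).re
    rw [hy]; simpa using hT0
  -- `log (T - r - y)` is replaced by `log (y - (T - r)) - πi`, correct to the right of the cut and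
  -- analytic across it.
  refine ⟨_, (analyticAt_inv_Gamma _).mul ((hfar.add hreg).add
    (hgam.mul ((hlog1.sub hlog2).add (analyticAt_const (v := Real.pi * I))))), ?_⟩
  have h1 : ∀ᶠ p : ℂ × ℂ × ℂ in 𝓝 (x₀, w₀, s₀), |p.1.re - l| < 1 := by
    have : ContinuousAt (fun p : ℂ × ℂ × ℂ => |p.1.re - l|) (x₀, w₀, s₀) :=
      (continuous_abs.comp ((continuous_re.comp continuous_fst).sub
        continuous_const)).continuousAt
    exact this.eventually_lt continuousAt_const (by simp [hre])
  have h2 : ∀ᶠ q : ℂ × ℂ × ℂ in 𝓝 (x₀, w₀, s₀), 0 < q.2.1.re :=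
    (continuous_re.comp (continuous_fst.comp continuous_snd)).continuousAt.eventually_const_lt hw
  have h3 : ∀ᶠ q : ℂ × ℂ × ℂ in 𝓝 (x₀, w₀, s₀), 0 < q.2.2.re :=
    (continuous_re.comp (continuous_snd.comp continuous_snd)).continuousAt.eventually_const_lt hs
  have h4 : closedBall (x₀, w₀, s₀) (r / 8) ∈ 𝓝 (x₀, w₀, s₀) :=
    closedBall_mem_nhds _ (by positivity)
  have main : ∀ᶠ p : ℂ × ℂ × ℂ in 𝓝 (x₀, w₀, s₀), p.1.re ≠ l →
      ∫ t in Set.Ioi (0 : ℝ), lerchKer p.1 p.2.1 p.2.2 t =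
        (∫ t in Set.Ioi (0 : ℝ) \ S₂, lerchKer p.1 p.2.1 p.2.2 t) +
        (∫ z in S₂ ×ˢ Set.Icc (0 : ℝ) 1, regKer p.2.1 p.2.2 (poleVar l p.1)
          (poleVar l p.1 + z.2 * (z.1 - poleVar l p.1))) +
        gammaKer p.2.1 p.2.2 (poleVar l p.1) *
          (log (T + r - poleVar l p.1) - log (T - r - poleVar l p.1)) := by
    filter_upwards [h1, h2, h3, h4] with p p1 p2 p3 p4 hne
    have hI := integrableOn_lerchKer (mem_cutPlane_of_re_ne p1 hne) p2 p3
    have him : (poleVar l p.1).im ≠ 0 := by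
      rw [poleVar_im]
      exact mul_ne_zero (by positivity) (sub_ne_zero.2 hne)
    have hsplit : ∫ t in Set.Ioi (0 : ℝ), lerchKer p.1 p.2.1 p.2.2 t =
        (∫ t in Set.Ioi (0 : ℝ) \ S₂, lerchKer p.1 p.2.1 p.2.2 t) +
        ∫ t in S₂, lerchKer p.1 p.2.1 p.2.2 t := by
      rw [setIntegral_sdiff measurableSet_Icc hI hS₂0, sub_add_cancel]
    have hreg' : IntegrableOn (fun z : ℝ × ℝ => regKer p.2.1 p.2.2 (poleVar l p.1)
        (poleVar l p.1 + z.2 * (z.1 - poleVar l p.1))) (S₂ ×ˢ Set.Icc (0 : ℝ) 1) :=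
      (continuousOn_regKer fun t ht u hu => hkey p p4 t ht u hu).integrableOn_compact
        (isCompact_Icc.prod isCompact_Icc)
    rw [hsplit, add_assoc]
    congr 1
    rw [show (volume : Measure (ℝ × ℝ)) = volume.prod volume from rfl] at hreg' ⊢
    rw [setIntegral_prod _ hreg']
    have hinv : IntegrableOn (fun t : ℝ => ((t : ℂ) - poleVar l p.1)⁻¹) S₂ := by
      refine ContinuousOn.integrableOn_compact isCompact_Icc fun t _ =>
        ContinuousAt.continuousWithinAt (ContinuousAt.inv₀ (by fun_prop) fun h0 => him ?_)
      simpa using congrArg im h0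
    have hinner : IntegrableOn (fun t : ℝ => ∫ u in Set.Icc (0 : ℝ) 1, regKer p.2.1 p.2.2
        (poleVar l p.1) (poleVar l p.1 + u * (t - poleVar l p.1))) S₂ := by
      rw [IntegrableOn, ← Measure.prod_restrict] at hreg'
      exact hreg'.integral_prod_left
    have hiv := integral_inv_sub (a := T - r) (b := T + r) (by linarith) him
    push_cast at hiv
    rw [← hiv, ← integral_const_mul, ← integral_add hinner (hinv.const_mul _)]
    exact setIntegral_congr_fun measurableSet_Icc fun t ht =>
      lerchKer_eq_regKer (hS₂0 ht) him (hkey p p4 t ht)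
  filter_upwards [main, h1] with p hp p1
  constructor
  · intro hlt
    rw [lerchInt, hp hlt.ne']
    have : log ((T : ℂ) - r - poleVar l p.1) =
        log (poleVar l p.1 - (T - r)) - Real.pi * I := by
      rw [← log_neg_of_im_pos, neg_sub]
      rw [sub_im, poleVar_im, ← ofReal_sub, ofReal_im, sub_zero]
      have := Real.pi_pos
      have := sub_pos.2 hlt
      positivity
    rw [this]
    simp only [Pi.mul_apply, Pi.add_apply, Pi.sub_apply]
    ring
  · intro hlt
    rw [lerchInt, hp hlt.ne, lerchJump]
    have : log ((T : ℂ) - r - poleVar l p.1) =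
        log (poleVar l p.1 - (T - r)) + Real.pi * I := by
      rw [← log_neg_of_im_neg, neg_sub]
      rw [sub_im, poleVar_im, ← ofReal_sub, ofReal_im, sub_zero]
      exact mul_neg_of_pos_of_neg (by positivity) (sub_neg.2 hlt)
    rw [this]
    simp only [Pi.mul_apply, Pi.add_apply, Pi.sub_apply]
    ring

end Crossing

/-! ### The jump for all `s`, and values on the cuts. -/

section CrossingExt

/-- Differentiating `y^s e^{-wy}` gives `(s/y - w) y^s e^{-wy}`; the terms with `w` cancel, and
`s/Γ(s + 1) = 1/Γ(s)`. -/
lemma lerchOp_lerchJump {l : ℤ} {p : ℂ × ℂ × ℂ} (hp : p.1.im < 0) :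
    lerchOp (lerchJump l) p = lerchJump l p := by
  obtain ⟨x, w, s⟩ := p
  have hx : poleVar l x ∈ slitPlane := Or.inl (by
    rw [poleVar_re]
    have : x.im < 0 := hp
    nlinarith [Real.pi_pos])
  have hy := slitPlane_ne_zero hx
  have h1 : HasDerivAt (poleVar l) (2 * Real.pi * I) x := by
    have := ((hasDerivAt_id x).sub_const (l : ℂ)).const_mul (2 * Real.pi * I)
    rw [mul_one] at this
    exact this
  have h2 := ((hasDerivAt_gammaKer w (s + 1) hx).comp x h1).const_mul
    (2 * Real.pi * I * (Gamma (s + 1))⁻¹)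
  have h3 : deriv (fun y => lerchJump l (y, w, s + 1)) x = _ := h2.deriv
  have h4 : gammaKer w (s + 1) (poleVar l x) = poleVar l x * gammaKer w s (poleVar l x) := by
    simp only [gammaKer]
    rw [show (s + 1 - 1) * log (poleVar l x) = (s - 1) * log (poleVar l x) + log (poleVar l x) by
      ring, exp_add, exp_log hy]
    ring
  simp only [lerchOp, shiftS]
  rw [h3]
  simp only [lerchJump]
  rw [h4, one_div_Gamma_eq_self_mul_one_div_Gamma_add_one s]
  field_simp [two_pi_I_ne_zero]
  ring

/-- `f` continues `g` analytically across the cut below `l`. -/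
def CrossesCut (l : ℤ) (g f : ℂ × ℂ × ℂ → ℂ) (p₀ : ℂ × ℂ × ℂ) : Prop :=
  AnalyticAt ℂ f p₀ ∧ ∀ᶠ p in 𝓝 p₀, ((l : ℝ) < p.1.re → f p = g p) ∧
    (p.1.re < l → f p = g p + lerchJump l p)

/-- The operator is additive and local in the shifted point, and it reproduces the jump; so crossing
relations descend from `s + 1` to `s`. -/
lemma CrossesCut.lerchOp {l : ℤ} {g f : ℂ × ℂ × ℂ → ℂ} {p₀ : ℂ × ℂ × ℂ} (him : p₀.1.im < 0)
    (h : CrossesCut l g f (shiftS p₀)) : CrossesCut l (_root_.lerchOp g) (_root_.lerchOp f) p₀ := by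
  refine ⟨h.1.lerchOp, ?_⟩
  have h1 := continuous_shiftS.continuousAt.eventually h.2.eventually_nhds
  have h2 := continuous_shiftS.continuousAt.eventually h.1.eventually_analyticAt
  have h3 : ∀ᶠ p : ℂ × ℂ × ℂ in 𝓝 p₀, p.1.im < 0 :=
    (continuous_im.comp continuous_fst).continuousAt.eventually_lt continuousAt_const him
  filter_upwards [h1, h2, h3] with p p1 p2 p3
  have p3' : (shiftS p).1.im < 0 := p3
  constructor
  · intro hlt
    refine lerchOp_congr ?_
    filter_upwards [p1, (continuous_re.comp continuous_fst).continuousAt.eventually_const_lt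
      (hlt : (l : ℝ) < (shiftS p).1.re)] with q q1 q2
    exact q1.1 q2
  · intro hlt
    have e1 : f =ᶠ[𝓝 (shiftS p)] fun q => g q + lerchJump l q := by
      filter_upwards [p1, (continuous_re.comp continuous_fst).continuousAt.eventually_lt
        continuousAt_const (hlt : (shiftS p).1.re < (l : ℝ))] with q q1 q2
      exact q1.2 q2
    have hJ : AnalyticAt ℂ (lerchJump l) (shiftS p) := analyticAt_lerchJump p3'
    have hg : AnalyticAt ℂ g (shiftS p) := by
      refine (p2.sub hJ).congr ?_
      filter_upwards [e1] with q hq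
      rw [Pi.sub_apply, hq, add_sub_cancel_right]
    rw [lerchOp_congr e1, lerchOp_add hg hJ, lerchOp_lerchJump p3]

lemma CrossesCut.congr {l : ℤ} {g g' f : ℂ × ℂ × ℂ → ℂ} {p₀ : ℂ × ℂ × ℂ}
    (h : CrossesCut l g f p₀)
    (hg : ∀ᶠ p in 𝓝 p₀, p.1.re ≠ (l : ℝ) → g p = g' p) : CrossesCut l g' f p₀ := by
  refine ⟨h.1, ?_⟩
  filter_upwards [h.2, hg] with p h1 h2
  exact ⟨fun h3 => (h1.1 h3).trans (h2 h3.ne'), fun h3 => by rw [h1.2 h3, h2 h3.ne]⟩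

lemma exists_lerchIter_crossing (n : ℕ) {l : ℤ} {x w s : ℂ} (hre : x.re = l) (him : x.im < 0)
    (hw : 0 < w.re) (hs : -n < s.re) : ∃ f, CrossesCut l (lerchIter n) f (x, w, s) := by
  induction n generalizing s with
  | zero => exact exists_lerchInt_crossing hre him hw (by simpa using hs)
  | succ n ih =>
    obtain ⟨f, hf⟩ := ih (s := s + 1) (by push_cast at hs; simp; linarith)
    rw [lerchIter_succ]
    exact ⟨_, CrossesCut.lerchOp him hf⟩

lemma eventually_mem_cutPlane {l : ℤ} {x : ℂ} (q : ℂ × ℂ) (hre : x.re = l) :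
    ∀ᶠ p : ℂ × ℂ × ℂ in 𝓝 (x, q), p.1.re ≠ l → p.1 ∈ cutPlane 1 Set.univ := by
  have : ContinuousAt (fun p : ℂ × ℂ × ℂ => |p.1.re - l|) (x, q) :=
    (continuous_abs.comp ((continuous_re.comp continuous_fst).sub
      continuous_const)).continuousAt
  filter_upwards [this.eventually_lt continuousAt_const (by simp [hre] :
    |(x, q).1.re - l| < 1)] with p hp hne
  exact mem_cutPlane_of_re_ne hp hne

lemma exists_lerchExt_crossing {l : ℤ} {x w : ℂ} (s : ℂ) (hre : x.re = l) (him : x.im < 0)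
    (hw : 0 < w.re) : ∃ f, CrossesCut l lerchExt f (x, w, s) := by
  obtain ⟨n, hn⟩ := exists_neg_lt_re s
  obtain ⟨f, hf⟩ := exists_lerchIter_crossing n hre him hw hn
  refine ⟨f, hf.congr ?_⟩
  filter_upwards [lerchExt_eventuallyEq n hw hn, eventually_mem_cutPlane (w, s) hre] with p h1 h2 h3
  exact (h1 (h2 h3)).symm

/-- The extension of the Lerch function to the cuts by its limits from the left. -/
noncomputable def lerchLeft (p : ℂ × ℂ × ℂ) : ℂ :=
  Filter.limUnder (𝓝[>] (0 : ℝ)) fun ε : ℝ => lerchExt (p.1 - ε, p.2)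

lemma tendsto_sub_left (p : ℂ × ℂ × ℂ) :
    Filter.Tendsto (fun ε : ℝ => ((p.1 - ε, p.2) : ℂ × ℂ × ℂ)) (𝓝[>] 0) (𝓝 p) := by
  have : Continuous fun ε : ℝ => ((p.1 - ε, p.2) : ℂ × ℂ × ℂ) := by fun_prop
  have h := this.tendsto 0
  simp only [ofReal_zero, sub_zero] at h
  exact h.mono_left nhdsWithin_le_nhds

lemma tendsto_sub_ofReal (x : ℂ) :
    Filter.Tendsto (fun ε : ℝ => x - ε) (𝓝[>] 0) (𝓝 x) := by
  have : Continuous fun ε : ℝ => x - ε := by fun_prop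
  have h := this.tendsto 0
  simp only [ofReal_zero, sub_zero] at h
  exact h.mono_left nhdsWithin_le_nhds

lemma tendsto_lerchExt_of_mem {p : ℂ × ℂ × ℂ} (hx : p.1 ∈ cutPlane 1 Set.univ)
    (hw : 0 < p.2.1.re) : Filter.Tendsto (fun ε : ℝ => lerchExt (p.1 - ε, p.2)) (𝓝[>] 0)
      (𝓝 (lerchExt p)) :=
  (analyticAt_lerchExt hx hw).continuousAt.tendsto.comp (tendsto_sub_left p)

lemma lerchLeft_of_mem {p : ℂ × ℂ × ℂ} (hx : p.1 ∈ cutPlane 1 Set.univ) (hw : 0 < p.2.1.re) :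
    lerchLeft p = lerchExt p :=
  (tendsto_lerchExt_of_mem hx hw).limUnder_eq

lemma analyticAt_lerchLeft {p : ℂ × ℂ × ℂ} (hx : p.1 ∈ cutPlane 1 Set.univ)
    (hw : 0 < p.2.1.re) : AnalyticAt ℂ lerchLeft p := by
  refine (analyticAt_lerchExt hx hw).congr ?_
  filter_upwards [continuous_fst.continuousAt.eventually
    ((isOpen_cutPlane 1 Set.univ).mem_nhds hx), (continuous_re.comp (continuous_fst.comp
      continuous_snd)).continuousAt.eventually_const_lt hw] with q h1 h2
  exact (lerchLeft_of_mem h1 h2).symm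

lemma tendsto_lerchExt_of_crossesCut {l : ℤ} {f : ℂ × ℂ × ℂ → ℂ} {p : ℂ × ℂ × ℂ}
    (h : ∀ᶠ q in 𝓝 p, q.1.re < (l : ℝ) → f q = lerchExt q + lerchJump l q) (hf : ContinuousAt f p)
    (hre : p.1.re = l) (him : p.1.im < 0) :
    Filter.Tendsto (fun ε : ℝ => lerchExt (p.1 - ε, p.2)) (𝓝[>] 0)
      (𝓝 (f p - lerchJump l p)) := by
  have h1 : Filter.Tendsto (fun q => f q - lerchJump l q) (𝓝 p) (𝓝 (f p - lerchJump l p)) :=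
    (hf.sub (analyticAt_lerchJump him).continuousAt).tendsto
  refine (h1.comp (tendsto_sub_left p)).congr' ?_
  filter_upwards [(tendsto_sub_left p).eventually h, self_mem_nhdsWithin] with ε h2 h3
  have : ((p.1 - ε, p.2) : ℂ × ℂ × ℂ).1.re < l := by
    have : (0 : ℝ) < ε := h3
    simp [hre, this]
  rw [Function.comp_apply, h2 this, add_sub_cancel_right]

/-- Points on the cut behave like points to its left, whence the non-strict inequality. This agrees
with the value of `vertLog 1` on its cut. -/
lemma exists_lerchLeft_crossing {l : ℤ} {x w : ℂ} (s : ℂ) (hre : x.re = l) (him : x.im < 0)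
    (hw : 0 < w.re) : ∃ f, AnalyticAt ℂ f (x, w, s) ∧ ∀ᶠ p in 𝓝 (x, w, s),
      ((l : ℝ) < p.1.re → lerchLeft p = f p) ∧
      (p.1.re ≤ (l : ℝ) → lerchLeft p = f p - lerchJump l p) := by
  obtain ⟨f, hf, h⟩ := exists_lerchExt_crossing s hre him hw
  refine ⟨f, hf, ?_⟩
  filter_upwards [h.eventually_nhds, hf.eventually_analyticAt, eventually_mem_cutPlane (w, s) hre,
    (continuous_re.comp (continuous_fst.comp continuous_snd)).continuousAt.eventually_const_lt hw,
    (continuous_im.comp continuous_fst).continuousAt.eventually_lt continuousAt_const him]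
    with p h1 h2 h3 h4 h5
  refine ⟨fun hlt => ?_, fun hle => ?_⟩
  · rw [lerchLeft_of_mem (h3 hlt.ne') h4, h1.self_of_nhds.1 hlt]
  · rcases hle.lt_or_eq with hlt | heq
    · rw [lerchLeft_of_mem (h3 hlt.ne) h4, h1.self_of_nhds.2 hlt, add_sub_cancel_right]
    · exact (tendsto_lerchExt_of_crossesCut (h1.mono fun q hq => hq.2) h2.continuousAt
        heq h5).limUnder_eq

lemma mem_cutPlane_or {x : ℂ} (hx : x ∈ puncturedPlane Set.univ) :
    x ∈ cutPlane 1 Set.univ ∨ ∃ l : ℤ, x.re = l ∧ x.im < 0 := by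
  by_contra! h
  refine h.1 fun l _ hl => ?_
  rw [one_mul] at hl
  have h2 : x.im = 0 := le_antisymm hl.2 (h.2 l hl.1)
  exact hx l trivial (Complex.ext (by simpa using hl.1) (by simpa using h2))

lemma tendsto_lerchLeft {x w : ℂ} (s : ℂ) (hx : x ∈ puncturedPlane Set.univ) (hw : 0 < w.re) :
    Filter.Tendsto (fun ε : ℝ => lerchExt (x - ε, w, s)) (𝓝[>] 0) (𝓝 (lerchLeft (x, w, s))) := by
  refine tendsto_nhds_limUnder (g := fun ε : ℝ => lerchExt (x - ε, w, s)) ?_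
  rcases mem_cutPlane_or hx with h | ⟨l, hre, him⟩
  · exact ⟨_, tendsto_lerchExt_of_mem (p := (x, w, s)) h hw⟩
  · obtain ⟨f, hf, h⟩ := exists_lerchExt_crossing s hre him hw
    exact ⟨f (x, w, s) - lerchJump l (x, w, s), tendsto_lerchExt_of_crossesCut (p := (x, w, s))
      (h.mono fun q hq => hq.2) hf.continuousAt hre him⟩

lemma eventually_sub_mem_cutPlane {x : ℂ} (hx : x ∈ puncturedPlane Set.univ) :
    ∀ᶠ ε : ℝ in 𝓝[>] 0, x - ε ∈ cutPlane 1 Set.univ := by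
  have ht := tendsto_sub_ofReal x
  rcases mem_cutPlane_or hx with h | ⟨l, hre, him⟩
  · exact ht.eventually ((isOpen_cutPlane 1 Set.univ).mem_nhds h)
  · filter_upwards [(tendsto_sub_left (x, 0, 0)).eventually (eventually_mem_cutPlane (0, 0) hre),
      self_mem_nhdsWithin] with ε h1 h2
    have : (0 : ℝ) < ε := h2
    exact h1 (by simp [hre, this.ne'])

lemma lerchLeft_succ {x w : ℂ} (s : ℂ) (hx : x ∈ puncturedPlane Set.univ) (hw : 0 < w.re) :
    lerchLeft (x, w, s) = exp (-(s * log w)) +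
      exp (2 * Real.pi * I * x) * lerchLeft (x, w + 1, s) := by
  have hw1 : 0 < (w + 1).re := by simp; linarith
  have ht := tendsto_sub_ofReal x
  have hexp : Filter.Tendsto (fun ε : ℝ => exp (2 * Real.pi * I * (x - ε))) (𝓝[>] 0)
      (𝓝 (exp (2 * Real.pi * I * x))) :=
    ((by fun_prop : Continuous fun y : ℂ => exp (2 * Real.pi * I * y)).tendsto x).comp ht
  refine tendsto_nhds_unique (tendsto_lerchLeft s hx hw) ((tendsto_const_nhds.add
    (hexp.mul (tendsto_lerchLeft s hx hw1))).congr' ?_)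
  filter_upwards [eventually_sub_mem_cutPlane hx] with ε hε
  exact (lerchExt_succ s hε hw).symm

end CrossingExt

/-! ### The Lerch function continued in `x`, for `Re w > 0`. -/

section Multivalued

open Metric

/-- The ratio differs from `1` by less than `1` in norm. -/
lemma ratio_mem_slitPlane {x₀ x c : ℂ} (h : dist x x₀ < dist x₀ c) :
    (x - c) / (x₀ - c) ∈ slitPlane := by
  have h0 : x₀ - c ≠ 0 := by
    intro h0
    rw [dist_eq, dist_eq, h0, norm_zero] at h
    exact absurd h (not_lt.2 (norm_nonneg _))
  have : (x - c) / (x₀ - c) = 1 + (x - x₀) / (x₀ - c) := by field_simp; ring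
  rw [this]
  refine mem_slitPlane_of_norm_lt_one ?_
  rw [norm_div, div_lt_one (norm_pos_iff.2 h0)]
  rwa [dist_eq, dist_eq] at h

lemma hasDerivAt_log_ratio {x₀ x c : ℂ} (h : dist x x₀ < dist x₀ c) :
    HasDerivAt (fun x => log ((x - c) / (x₀ - c))) (x - c)⁻¹ x := by
  have hs := ratio_mem_slitPlane h
  have h1 : x₀ - c ≠ 0 := fun h0 => slitPlane_ne_zero hs (by rw [h0, div_zero])
  have h2 : x - c ≠ 0 := fun h0 => slitPlane_ne_zero hs (by rw [h0, zero_div])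
  have h := (((hasDerivAt_id x).sub_const c).div_const (x₀ - c)).clog hs
  refine h.congr_deriv ?_
  simp only [id]
  field_simp

/-- A branch of `log (x - c)` is determined by its value at the centre of a disc. -/
lemma eq_add_log_ratio {g : ℂ → ℂ} {x₀ c : ℂ} {δ : ℝ} (hδ : δ ≤ dist x₀ c)
    (hg : ∀ x ∈ ball x₀ δ, HasDerivAt g (x - c)⁻¹ x) {x : ℂ} (hx : x ∈ ball x₀ δ) :
    g x = g x₀ + log ((x - c) / (x₀ - c)) := by
  have hr : ∀ x ∈ ball x₀ δ, HasDerivAt (fun x => g x₀ + log ((x - c) / (x₀ - c)))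
      (x - c)⁻¹ x := fun x hx =>
    (hasDerivAt_log_ratio ((mem_ball.1 hx).trans_le hδ)).const_add _
  have hx₀ : x₀ ∈ ball x₀ δ := mem_ball_self (dist_nonneg.trans_lt (mem_ball.1 hx))
  have h0 : x₀ - c ≠ 0 := by
    have h1 : 0 < dist x₀ c := (dist_nonneg.trans_lt (mem_ball.1 hx)).trans_le hδ
    rw [dist_eq] at h1
    exact norm_pos_iff.1 h1
  exact isOpen_ball.eqOn_of_deriv_eq (convex_ball x₀ δ).isPreconnected
    (fun y hy => (hg y hy).differentiableAt.differentiableWithinAt)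
    (fun y hy => (hr y hy).differentiableAt.differentiableWithinAt)
    (fun y hy => by rw [(hg y hy).deriv, (hr y hy).deriv]) hx₀ (by simp [div_self h0]) hx

/-- The values at `x` of the logarithms of `x - l` continued from their values `ℓ` at `x₀`. -/
noncomputable def contLog (x₀ : ℂ) (ℓ : ℤ → ℂ) (x : ℂ) (l : ℤ) : ℂ :=
  ℓ l + log ((x - l) / (x₀ - l))

lemma sub_mem_of_mem_cutPlane {T : Set ℤ} {x : ℂ} (hx : x ∈ cutPlane 1 T) {l : ℤ} (hl : l ∈ T) :
    -((1 : ℝ) * I) * (x - l) ∈ slitPlane := by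
  refine vertLog_mem_slitPlane one_ne_zero fun h => hx l hl ⟨?_, ?_⟩
  · have := h.1
    simp at this
    linarith
  · simpa using h.2

lemma hasDerivAt_vertLog {T : Set ℤ} {x : ℂ} (hx : x ∈ cutPlane 1 T) {l : ℤ} (hl : l ∈ T) :
    HasDerivAt (fun x => vertLog 1 (x - l)) (x - l)⁻¹ x := by
  have h1 := sub_mem_of_mem_cutPlane hx hl
  have h2 : x - l ≠ 0 := fun h0 => slitPlane_ne_zero h1 (by rw [h0, mul_zero])
  have h := ((((hasDerivAt_id x).sub_const (l : ℂ)).const_mul (-((1 : ℝ) * I))).clog h1).add_const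
    (((1 : ℝ) : ℂ) * I * (Real.pi / 2))
  refine h.congr_deriv ?_
  simp only [id, ofReal_one, one_mul, mul_one]
  field_simp

lemma le_dist_of_ball_subset {T : Set ℤ} {x₀ : ℂ} {δ : ℝ} (h : ball x₀ δ ⊆ puncturedPlane T)
    {l : ℤ} (hl : l ∈ T) : δ ≤ dist x₀ l := by
  by_contra! hc
  exact h (mem_ball'.2 hc) l hl rfl

lemma vertLog_eq_of_mem_ball {T : Set ℤ} {x₀ x : ℂ} {δ : ℝ} (h : ball x₀ δ ⊆ cutPlane 1 T)
    (hx : x ∈ ball x₀ δ) {l : ℤ} (hl : l ∈ T) :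
    vertLog 1 (x - l) = vertLog 1 (x₀ - l) + log ((x - l) / (x₀ - l)) :=
  eq_add_log_ratio (g := fun x => vertLog 1 (x - l))
    (le_dist_of_ball_subset (h.trans cutPlane_subset) hl)
    (fun _ hy => hasDerivAt_vertLog (h hy) hl) hx

/-- The number of turns which separates a logarithm `ℓ` of `u` from `vertLog 1 u`. -/
noncomputable def sheetNum (ℓ u : ℂ) : ℤ := round ((ℓ - vertLog 1 u) / (2 * Real.pi * I)).re

lemma sheetNum_eq {ℓ u : ℂ} {n : ℤ} (h : ℓ = vertLog 1 u + n * (2 * Real.pi * I)) :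
    sheetNum ℓ u = n := by
  rw [sheetNum, h, add_sub_cancel_left, mul_div_cancel_right₀ _ two_pi_I_ne_zero, intCast_re,
    round_intCast]

lemma eq_vertLog_add_sheetNum {ℓ u : ℂ} (hu : u ≠ 0) (h : exp ℓ = u) :
    ℓ = vertLog 1 u + sheetNum ℓ u * (2 * Real.pi * I) := by
  obtain ⟨n, hn⟩ := exp_eq_exp_iff_exists_int.1 (h.trans (exp_vertLog (Or.inl rfl) hu).symm)
  rw [sheetNum_eq hn]
  exact hn

/-- The `q`-integer `(q ^ n - 1) / (q - 1)` with `q = e ^ (2πis)`. -/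
noncomputable def qInt (n : ℤ) (s : ℂ) : ℂ :=
  ∑ i ∈ Finset.Ico 0 n, exp (i * (2 * Real.pi * I) * s) -
    ∑ i ∈ Finset.Ico n 0, exp (i * (2 * Real.pi * I) * s)

lemma qInt_zero (s : ℂ) : qInt 0 s = 0 := by simp [qInt]

lemma qInt_succ (n : ℤ) (s : ℂ) : qInt (n + 1) s = qInt n s + exp (n * (2 * Real.pi * I) * s) := by
  rcases le_or_gt 0 n with h | h
  · have h1 : Finset.Ico 0 (n + 1) = insert n (Finset.Ico 0 n) := by
      ext i; simp; omega
    rw [qInt, qInt, h1, Finset.sum_insert (by simp), Finset.Ico_eq_empty (show ¬n < 0 by omega),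
      Finset.Ico_eq_empty (show ¬n + 1 < 0 by omega)]
    simp only [Finset.sum_empty]
    ring
  · have h1 : Finset.Ico n 0 = insert n (Finset.Ico (n + 1) 0) := by
      ext i; simp; omega
    rw [qInt, qInt, h1, Finset.sum_insert (by simp), Finset.Ico_eq_empty (show ¬0 < n + 1 by omega),
      Finset.Ico_eq_empty (show ¬0 < n by omega)]
    simp only [Finset.sum_empty]
    ring

/-- Here the term `1` is split off at the bottom of the sum, as crossing a cut requires; `qInt_succ`
splits off the top term, as an extra turn requires. -/
lemma qInt_succ' (n : ℤ) (s : ℂ) : qInt (n + 1) s = 1 + exp (2 * Real.pi * I * s) * qInt n s := by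
  have e (n : ℤ) : exp ((n + 1 : ℤ) * (2 * Real.pi * I) * s) =
      exp (2 * Real.pi * I * s) * exp (n * (2 * Real.pi * I) * s) := by
    rw [← exp_add]; push_cast; ring_nf
  induction n using Int.induction_on with
  | zero => rw [qInt_succ, qInt_zero]; simp
  | succ n ih =>
    linear_combination qInt_succ (n + 1) s + e n + ih - exp (2 * Real.pi * I * s) * qInt_succ n s
  | pred n ih =>
    have h1 := qInt_succ (-n - 1) s
    rw [sub_add_cancel] at h1 ⊢
    have h2 := e (-n - 1)
    rw [sub_add_cancel] at h2
    rw [qInt_succ] at ih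
    push_cast at *
    linear_combination ih + exp (2 * Real.pi * I * s) * h1 - h2

lemma analyticAt_qInt (n : ℤ) (p : ℂ × ℂ × ℂ) :
    AnalyticAt ℂ (fun q : ℂ × ℂ × ℂ => qInt n q.2.2) p := by
  have h : AnalyticAt ℂ (qInt n) p.2.2 := by
    refine Differentiable.analyticAt ?_ _
    unfold qInt
    fun_prop
  exact AnalyticAt.comp (g := qInt n) h (analyticAt_snd.comp analyticAt_snd)

/-- The jump of the Lerch function at `l`, for the logarithm `lam` of `x - l`. -/
noncomputable def lerchRes (l : ℤ) (lam : ℂ) (p : ℂ × ℂ × ℂ) : ℂ :=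
  2 * Real.pi * I * (Gamma p.2.2)⁻¹ *
    (exp ((p.2.2 - 1) * (lam + (Real.log (2 * Real.pi) + I * (Real.pi / 2)))) *
      exp (-p.2.1 * poleVar l p.1))

/-- The exponent `s - 1` may be read as `s`, since `e^{-2πin} = 1`. -/
lemma lerchRes_add (l n : ℤ) (lam : ℂ) (p : ℂ × ℂ × ℂ) :
    lerchRes l (lam + n * (2 * Real.pi * I)) p =
      exp (n * (2 * Real.pi * I) * p.2.2) * lerchRes l lam p := by
  have h : exp ((p.2.2 - 1) * (lam + n * (2 * Real.pi * I) +
      (Real.log (2 * Real.pi) + I * (Real.pi / 2)))) =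
      exp (n * (2 * Real.pi * I) * p.2.2) *
        exp ((p.2.2 - 1) * (lam + (Real.log (2 * Real.pi) + I * (Real.pi / 2)))) := by
    rw [← exp_add, exp_eq_exp_iff_exists_int]
    exact ⟨-n, by push_cast; ring⟩
  rw [lerchRes, lerchRes, h]
  ring

lemma lerchRes_succ (l : ℤ) (lam x w s : ℂ) :
    exp (2 * Real.pi * I * x) * lerchRes l lam (x, w + 1, s) = lerchRes l lam (x, w, s) := by
  have h : exp (-w * poleVar l x) = exp (2 * Real.pi * I * x) * exp (-(w + 1) * poleVar l x) := by
    rw [← exp_add, exp_eq_exp_iff_exists_int]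
    exact ⟨-l, by rw [poleVar]; push_cast; ring⟩
  simp only [lerchRes]
  rw [h]
  ring

lemma analyticAt_lerchRes {l : ℤ} {lam : ℂ × ℂ × ℂ → ℂ} {p : ℂ × ℂ × ℂ}
    (h : AnalyticAt ℂ lam p) : AnalyticAt ℂ (fun q => lerchRes l (lam q) q) p := by
  have h1 : AnalyticAt ℂ (fun q : ℂ × ℂ × ℂ => q.2.1) p := analyticAt_fst.comp analyticAt_snd
  have h2 : AnalyticAt ℂ (fun q : ℂ × ℂ × ℂ => q.2.2) p := analyticAt_snd.comp analyticAt_snd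
  exact (analyticAt_const.mul (analyticAt_inv_Gamma p)).mul
    ((((h2.sub analyticAt_const).mul (h.add analyticAt_const)).cexp).mul
      ((h1.neg.mul (analyticAt_poleVar l p)).cexp))

/-- The branch of the logarithm of `x - l` that is continuous below `l`. -/
noncomputable def cutLog (l : ℤ) (x : ℂ) : ℂ :=
  log (poleVar l x) - (Real.log (2 * Real.pi) + I * (Real.pi / 2))

lemma lerchRes_cutLog (l : ℤ) (p : ℂ × ℂ × ℂ) :
    lerchRes l (cutLog l p.1) p = lerchJump l p := by
  rw [lerchRes, lerchJump, gammaKer, cutLog, sub_add_cancel]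

lemma poleVar_mem_slitPlane {l : ℤ} {x : ℂ} (hx : x.im < 0) : poleVar l x ∈ slitPlane :=
  Or.inl (by rw [poleVar_re]; nlinarith [Real.pi_pos])

lemma hasDerivAt_cutLog {l : ℤ} {x : ℂ} (hx : x.im < 0) :
    HasDerivAt (cutLog l) (x - l)⁻¹ x := by
  have h1 := poleVar_mem_slitPlane (l := l) hx
  have h2 : x - l ≠ 0 := fun h0 => slitPlane_ne_zero h1 (by rw [poleVar, h0, mul_zero])
  have h := ((((hasDerivAt_id x).sub_const (l : ℂ)).const_mul (2 * Real.pi * I)).clog h1).sub_const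
    ((Real.log (2 * Real.pi) : ℂ) + I * (Real.pi / 2))
  refine h.congr_deriv ?_
  simp only [id, mul_one]
  have := two_pi_I_ne_zero
  field_simp

lemma vertLog_eq_log_neg_poleVar (l : ℤ) {x : ℂ} (hx : x ≠ l) :
    vertLog 1 (x - l) = log (-poleVar l x) - Real.log (2 * Real.pi) + I * (Real.pi / 2) := by
  have h : -poleVar l x = (2 * Real.pi : ℝ) * (-(((1 : ℝ) : ℂ) * I) * (x - l)) := by
    rw [poleVar]; push_cast; ring
  have h0 : -(((1 : ℝ) : ℂ) * I) * (x - l) ≠ 0 := by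
    simp [sub_ne_zero.2 hx]
  rw [h, log_ofReal_mul (by positivity) h0, vertLog]
  push_cast
  ring

lemma vertLog_of_lt {l : ℤ} {x : ℂ} (h : (l : ℝ) < x.re) : vertLog 1 (x - l) = cutLog l x := by
  have hx : x ≠ l := by rintro rfl; simp at h
  rw [vertLog_eq_log_neg_poleVar l hx, log_neg_of_im_pos, cutLog]
  · ring
  · rw [poleVar_im]
    have := sub_pos.2 h
    positivity

/-- Including `Re x = l` is correct because the principal logarithm has argument `π` on the negative
axis, which is the left-hand limit of `vertLog 1`. -/
lemma vertLog_of_le {l : ℤ} {x : ℂ} (h : x.re ≤ l) (him : x.im < 0) :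
    vertLog 1 (x - l) = cutLog l x + (1 : ℤ) * (2 * Real.pi * I) := by
  have hx : x ≠ l := by rintro rfl; simp at him
  have h1 : log (-poleVar l x) = log (poleVar l x) + Real.pi * I := by
    rcases h.lt_or_eq with h | h
    · exact log_neg_of_im_neg (by
        rw [poleVar_im]; exact mul_neg_of_pos_of_neg (by positivity) (sub_neg.2 h))
    · have hy : poleVar l x = ((-(2 * Real.pi * x.im) : ℝ) : ℂ) :=
        Complex.ext (by rw [poleVar_re, ofReal_re])
          (by rw [poleVar_im, h, sub_self, mul_zero, ofReal_im])
      have hpos : 0 < -(2 * Real.pi * x.im) := by nlinarith [Real.pi_pos]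
      rw [hy, ← ofReal_neg, log, log, arg_ofReal_of_neg (by linarith),
        arg_ofReal_of_nonneg hpos.le, ofReal_neg, norm_neg]
      simp
  rw [vertLog_eq_log_neg_poleVar l hx, h1, cutLog]
  push_cast
  ring

/-- The Lerch function for `0 < Re w`, continued along paths of `x`: `ℓ l` is the value of the
continued logarithm of `x - l`. -/
noncomputable def lerchMulti (x : ℂ) (ℓ : ℤ → ℂ) (w s : ℂ) : ℂ :=
  lerchLeft (x, w, s) - ∑ᶠ l : ℤ, qInt (sheetNum (ℓ l) (x - l)) s *
    lerchRes l (vertLog 1 (x - l)) (x, w, s)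

/-- `ℓ` is a family of logarithms of the numbers `x - l`, almost all of which are given by
`vertLog 1`. -/
structure IsLogFamily (x : ℂ) (ℓ : ℤ → ℂ) : Prop where
  exp_eq : ∀ l : ℤ, exp (ℓ l) = x - l
  finite : {l : ℤ | ℓ l ≠ vertLog 1 (x - l)}.Finite

lemma IsLogFamily.ne {x : ℂ} {ℓ : ℤ → ℂ} (h : IsLogFamily x ℓ) (l : ℤ) : x - l ≠ 0 :=
  h.exp_eq l ▸ exp_ne_zero _

lemma IsLogFamily.mem {x : ℂ} {ℓ : ℤ → ℂ} (h : IsLogFamily x ℓ) : x ∈ puncturedPlane Set.univ :=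
  fun l _ => sub_ne_zero.1 (h.ne l)

lemma sheetNum_vertLog (u : ℂ) : sheetNum (vertLog 1 u) u = 0 := sheetNum_eq (by simp)

lemma term_support_subset (x : ℂ) (ℓ : ℤ → ℂ) (w s : ℂ) :
    (Function.support fun l : ℤ => qInt (sheetNum (ℓ l) (x - l)) s *
      lerchRes l (vertLog 1 (x - l)) (x, w, s)) ⊆ {l | ℓ l ≠ vertLog 1 (x - l)} := by
  intro l hl h
  refine hl ?_
  simp only [h, sheetNum_vertLog, qInt_zero, zero_mul]

lemma lerchMulti_eq_sum {x : ℂ} {ℓ : ℤ → ℂ} {S : Finset ℤ}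
    (hS : ∀ l, l ∉ S → ℓ l = vertLog 1 (x - l)) (w s : ℂ) :
    lerchMulti x ℓ w s = lerchLeft (x, w, s) - ∑ l ∈ S, qInt (sheetNum (ℓ l) (x - l)) s *
      lerchRes l (vertLog 1 (x - l)) (x, w, s) := by
  rw [lerchMulti, finsum_eq_sum_of_support_subset]
  refine (term_support_subset x ℓ w s).trans fun l hl => ?_
  by_contra h
  exact hl (hS l h)

lemma sheetNum_contLog {T : Set ℤ} {x₀ x : ℂ} {δ : ℝ} (h : ball x₀ δ ⊆ cutPlane 1 T)
    (hx : x ∈ ball x₀ δ) {l : ℤ} (hl : l ∈ T) (ℓ : ℤ → ℂ) :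
    sheetNum (contLog x₀ ℓ x l) (x - l) = sheetNum (ℓ l) (x₀ - l) := by
  rw [sheetNum, sheetNum, vertLog_eq_of_mem_ball h hx hl, contLog, add_sub_add_right_eq_sub]

lemma analyticAt_vertLog {T : Set ℤ} {x : ℂ} (q : ℂ × ℂ) (hx : x ∈ cutPlane 1 T) {l : ℤ}
    (hl : l ∈ T) : AnalyticAt ℂ (fun p : ℂ × ℂ × ℂ => vertLog 1 (p.1 - l)) (x, q) := by
  refine AnalyticAt.add (AnalyticAt.clog ?_ (sub_mem_of_mem_cutPlane hx hl)) analyticAt_const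
  exact analyticAt_const.mul (analyticAt_fst.sub analyticAt_const)

/-- In a disc off the cuts the sheet numbers are constant, and all but a fixed finite set of them
vanish. -/
lemma analyticAt_lerchMulti_of_mem {x₀ w₀ : ℂ} (s₀ : ℂ) {ℓ : ℤ → ℂ} (hℓ : IsLogFamily x₀ ℓ)
    (hx : x₀ ∈ cutPlane 1 Set.univ) (hw : 0 < w₀.re) :
    AnalyticAt ℂ (fun p : ℂ × ℂ × ℂ => lerchMulti p.1 (contLog x₀ ℓ p.1) p.2.1 p.2.2)
      (x₀, w₀, s₀) := by
  obtain ⟨δ, hδ, hball⟩ := Metric.isOpen_iff.1 (isOpen_cutPlane 1 Set.univ) x₀ hx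
  have h : AnalyticAt ℂ (fun p : ℂ × ℂ × ℂ => lerchLeft p - ∑ l ∈ hℓ.finite.toFinset,
      qInt (sheetNum (ℓ l) (x₀ - l)) p.2.2 * lerchRes l (vertLog 1 (p.1 - l)) p)
      (x₀, w₀, s₀) := by
    refine (analyticAt_lerchLeft (p := (x₀, w₀, s₀)) hx hw).sub
      (Finset.analyticAt_fun_sum _ fun l _ => ?_)
    exact (analyticAt_qInt _ _).mul (analyticAt_lerchRes (analyticAt_vertLog _ hx trivial))
  refine h.congr ?_
  filter_upwards [continuous_fst.continuousAt.preimage_mem_nhds (ball_mem_nhds x₀ hδ)] with p hp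
  rw [lerchMulti_eq_sum (S := hℓ.finite.toFinset)]
  · simp only [sheetNum_contLog hball hp (Set.mem_univ _)]
  · intro l hl
    have : ℓ l = vertLog 1 (x₀ - l) := by simpa using hl
    rw [contLog, this, vertLog_eq_of_mem_ball hball hp (Set.mem_univ l)]

lemma mem_cutPlane_compl {l : ℤ} {x : ℂ} (h : |x.re - l| < 1) : x ∈ cutPlane 1 {l}ᶜ := by
  rintro m hm ⟨h3, -⟩
  rw [h3] at h
  have h4 : |m - l| < 1 := by exact_mod_cast h
  rw [Int.abs_lt_one_iff] at h4
  exact hm (by rw [Set.mem_singleton_iff]; linarith)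

/-- Only the `l₀`-th term is discontinuous. With `n` counted from `cutLog`, which is analytic across
the cut, the analytic candidate is `f` minus `qInt n` times the jump, minus the remaining terms. -/
lemma analyticAt_lerchMulti_of_cut {l₀ : ℤ} {x₀ w₀ : ℂ} (s₀ : ℂ) {ℓ : ℤ → ℂ}
    (hℓ : IsLogFamily x₀ ℓ) (hre : x₀.re = l₀) (him : x₀.im < 0) (hw : 0 < w₀.re) :
    AnalyticAt ℂ (fun p : ℂ × ℂ × ℂ => lerchMulti p.1 (contLog x₀ ℓ p.1) p.2.1 p.2.2)
      (x₀, w₀, s₀) := by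
  have hx : x₀ ∈ cutPlane 1 {l₀}ᶜ := mem_cutPlane_compl (by simp [hre])
  obtain ⟨δ, hδ, hball'⟩ := Metric.isOpen_iff.1 ((isOpen_cutPlane 1 {l₀}ᶜ).inter
    (isOpen_lt continuous_im continuous_const)) x₀ ⟨hx, him⟩
  have hball : ball x₀ δ ⊆ cutPlane 1 {l₀}ᶜ := fun x h => (hball' h).1
  have hballim {x : ℂ} (h : x ∈ ball x₀ δ) : x.im < 0 := (hball' h).2
  obtain ⟨f, hf, hcross⟩ := exists_lerchLeft_crossing s₀ hre him hw
  have hδ0 : δ ≤ dist x₀ (l₀ : ℂ) := by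
    by_contra! hc
    have := hballim (mem_ball'.2 hc)
    simp at this
  have hcut {x : ℂ} (hx : x ∈ ball x₀ δ) :
      cutLog l₀ x = cutLog l₀ x₀ + log ((x - l₀) / (x₀ - l₀)) :=
    eq_add_log_ratio hδ0 (fun y hy => hasDerivAt_cutLog (hballim hy)) hx
  obtain ⟨n, hn⟩ : ∃ n : ℤ, ℓ l₀ = cutLog l₀ x₀ + n * (2 * Real.pi * I) := by
    have h1 := eq_vertLog_add_sheetNum (hℓ.ne l₀) (hℓ.exp_eq l₀)
    rw [vertLog_of_le hre.le him] at h1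
    exact ⟨1 + sheetNum (ℓ l₀) (x₀ - l₀), h1.trans (by push_cast; ring)⟩
  set S := hℓ.finite.toFinset.erase l₀ with hS
  have hST : ∀ l ∈ S, l ∈ ({l₀}ᶜ : Set ℤ) := fun l hl => (Finset.mem_erase.1 hl).1
  have h : AnalyticAt ℂ (fun p : ℂ × ℂ × ℂ => f p - qInt n p.2.2 * lerchJump l₀ p - ∑ l ∈ S,
      qInt (sheetNum (ℓ l) (x₀ - l)) p.2.2 * lerchRes l (vertLog 1 (p.1 - l)) p)
      (x₀, w₀, s₀) := by
    refine (hf.sub ((analyticAt_qInt _ _).mul (analyticAt_lerchJump him))).sub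
      (Finset.analyticAt_fun_sum _ fun l hl => ?_)
    exact (analyticAt_qInt _ _).mul (analyticAt_lerchRes (analyticAt_vertLog _ hx (hST l hl)))
  refine h.congr ?_
  filter_upwards [continuous_fst.continuousAt.preimage_mem_nhds (ball_mem_nhds x₀ hδ),
    hcross] with p hp hp2
  have hsum : lerchMulti p.1 (contLog x₀ ℓ p.1) p.2.1 p.2.2 = lerchLeft p -
      (qInt (sheetNum (contLog x₀ ℓ p.1 l₀) (p.1 - l₀)) p.2.2 *
        lerchRes l₀ (vertLog 1 (p.1 - l₀)) p +
      ∑ l ∈ S, qInt (sheetNum (ℓ l) (x₀ - l)) p.2.2 * lerchRes l (vertLog 1 (p.1 - l)) p) := by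
    rw [lerchMulti_eq_sum (S := insert l₀ S), Finset.sum_insert (by simp [hS])]
    · congr 2
      refine Finset.sum_congr rfl fun l hl => ?_
      rw [sheetNum_contLog hball hp (hST l hl)]
    · intro l hl
      simp only [Finset.mem_insert, not_or, hS, Finset.mem_erase, Set.Finite.mem_toFinset,
        not_and] at hl
      have : ℓ l = vertLog 1 (x₀ - l) := by simpa using hl.2 hl.1
      rw [contLog, this, vertLog_eq_of_mem_ball hball hp (l := l) hl.1]
  have hc : contLog x₀ ℓ p.1 l₀ = cutLog l₀ p.1 + n * (2 * Real.pi * I) := by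
    rw [contLog, hn, hcut hp]; ring
  rw [hsum, hc]
  rcases lt_or_ge (l₀ : ℝ) p.1.re with hlt | hle
  · rw [vertLog_of_lt hlt, sheetNum_eq (n := n) (by rw [vertLog_of_lt hlt]), lerchRes_cutLog,
      hp2.1 hlt]
    ring
  · have hpim := hballim hp
    -- On the left the sheet number is one less and the residue gains the factor `q = e^{2πis}`; the
    -- missing `1` in `qInt n = 1 + q * qInt (n - 1)` is the jump of `lerchLeft`.
    rw [sheetNum_eq (n := n - 1) (by rw [vertLog_of_le hle hpim]; push_cast; ring),
      vertLog_of_le hle hpim, lerchRes_add, lerchRes_cutLog, hp2.2 hle]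
    have := qInt_succ' (n - 1) p.2.2
    rw [sub_add_cancel] at this
    rw [this]
    push_cast
    rw [one_mul]
    ring

lemma analyticAt_lerchMulti {x₀ w₀ : ℂ} (s₀ : ℂ) {ℓ : ℤ → ℂ} (hℓ : IsLogFamily x₀ ℓ)
    (hw : 0 < w₀.re) :
    AnalyticAt ℂ (fun p : ℂ × ℂ × ℂ => lerchMulti p.1 (contLog x₀ ℓ p.1) p.2.1 p.2.2)
      (x₀, w₀, s₀) := by
  rcases mem_cutPlane_or hℓ.mem with h | ⟨l, hre, him⟩
  · exact analyticAt_lerchMulti_of_mem s₀ hℓ h hw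
  · exact analyticAt_lerchMulti_of_cut s₀ hℓ hre him hw

lemma lerchMulti_succ {x w : ℂ} (s : ℂ) {ℓ : ℤ → ℂ} (hℓ : IsLogFamily x ℓ) (hw : 0 < w.re) :
    lerchMulti x ℓ w s = exp (-(s * log w)) +
      exp (2 * Real.pi * I * x) * lerchMulti x ℓ (w + 1) s := by
  have hS : ∀ l, l ∉ hℓ.finite.toFinset → ℓ l = vertLog 1 (x - l) := fun l hl => by simpa using hl
  rw [lerchMulti_eq_sum hS, lerchMulti_eq_sum hS, lerchLeft_succ s hℓ.mem hw, mul_sub,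
    Finset.mul_sum, add_sub_assoc]
  congr 2
  refine Finset.sum_congr rfl fun l _ => ?_
  rw [← lerchRes_succ]
  ring

/-- Only the `l`-th `q`-integer changes, gaining `e^{2πins}`; this factor turns the residue for
`vertLog 1` into the one for `ℓ l`. -/
lemma lerchMulti_monodromy {x : ℂ} {ℓ ℓ' : ℤ → ℂ} (hℓ : IsLogFamily x ℓ) {l : ℤ}
    (hl : ℓ' l = ℓ l + 2 * Real.pi * I) (hne : ∀ m, m ≠ l → ℓ' m = ℓ m) (w s : ℂ) :
    lerchMulti x ℓ' w s - lerchMulti x ℓ w s = -lerchRes l (ℓ l) (x, w, s) := by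
  set S := insert l hℓ.finite.toFinset with hS
  have h1 : ∀ m, m ∉ S → ℓ m = vertLog 1 (x - m) := fun m hm => by
    simp only [hS, Finset.mem_insert, not_or] at hm
    simpa using hm.2
  have h2 : ∀ m, m ∉ S → ℓ' m = vertLog 1 (x - m) := fun m hm => by
    rw [hne m (fun h => hm (h ▸ Finset.mem_insert_self _ _)), h1 m hm]
  have hl2 := eq_vertLog_add_sheetNum (hℓ.ne l) (hℓ.exp_eq l)
  set n := sheetNum (ℓ l) (x - l) with hn
  have hn' : sheetNum (ℓ' l) (x - l) = n + 1 :=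
    sheetNum_eq (by rw [hl]; nth_rewrite 1 [hl2]; push_cast; ring)
  rw [lerchMulti_eq_sum h1, lerchMulti_eq_sum h2, sub_sub_sub_cancel_left, ← Finset.sum_sub_distrib,
    Finset.sum_eq_single l]
  · rw [hn', qInt_succ, ← hn]
    conv_rhs => rw [hl2, lerchRes_add]
    ring
  · intro m _ hm
    rw [hne m hm, sub_self]
  · intro h
    exact absurd (Finset.mem_insert_self _ _) h

end Multivalued

/-! ### The Lerch function continued in both `x` and `w`. -/

section MultivaluedLerch

open Metric

/-- From the index `N` on, `m p` is the principal logarithm of `w + p`, and `0 < Re (w + p)`. -/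
def PrincipalFrom (w : ℂ) (m : ℕ → ℂ) (N : ℕ) : Prop :=
  ∀ p, N ≤ p → 0 < (w + p).re ∧ m p = log (w + p)

/-- The Lerch function, computed by splitting off the first `N` terms of the series. -/
noncomputable def lerchSplit (N : ℕ) (x : ℂ) (ℓ : ℤ → ℂ) (w : ℂ) (m : ℕ → ℂ) (s : ℂ) : ℂ :=
  ∑ p ∈ Finset.range N, exp (2 * Real.pi * I * p * x) * exp (-(s * m p)) +
    exp (2 * Real.pi * I * N * x) * lerchMulti x ℓ (w + N) s

lemma lerchSplit_succ {N : ℕ} {x w s : ℂ} {ℓ : ℤ → ℂ} {m : ℕ → ℂ} (hℓ : IsLogFamily x ℓ)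
    (hm : PrincipalFrom w m N) : lerchSplit (N + 1) x ℓ w m s = lerchSplit N x ℓ w m s := by
  obtain ⟨h1, h2⟩ := hm N le_rfl
  rw [lerchSplit, lerchSplit, Finset.sum_range_succ, lerchMulti_succ s hℓ h1, h2,
    Nat.cast_succ, ← add_assoc w]
  have : exp (2 * Real.pi * I * (N + 1) * x) =
      exp (2 * Real.pi * I * N * x) * exp (2 * Real.pi * I * x) := by
    rw [← exp_add]; ring_nf
  rw [this]
  ring

lemma PrincipalFrom.mono {w : ℂ} {m : ℕ → ℂ} {N N' : ℕ} (h : PrincipalFrom w m N) (hN : N ≤ N') :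
    PrincipalFrom w m N' := fun p hp => h p (hN.trans hp)

lemma lerchSplit_eq_of_le {N N' : ℕ} {x w s : ℂ} {ℓ : ℤ → ℂ} {m : ℕ → ℂ} (hℓ : IsLogFamily x ℓ)
    (hm : PrincipalFrom w m N) (hN : N ≤ N') :
    lerchSplit N' x ℓ w m s = lerchSplit N x ℓ w m s := by
  induction N', hN using Nat.le_induction with
  | base => rfl
  | succ n hn ih => rw [lerchSplit_succ hℓ (hm.mono hn), ih]

/-- The Lerch function continued along paths of `x` and `w`: `ℓ l` is the continued logarithm of
`x - l` and `m p` is the continued logarithm of `w + p`. -/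
noncomputable def lerchFull (x : ℂ) (ℓ : ℤ → ℂ) (w : ℂ) (m : ℕ → ℂ) (s : ℂ) : ℂ :=
  lerchSplit (sInf {N | PrincipalFrom w m N}) x ℓ w m s

/-- The infimum is only a canonical choice: every admissible `N` gives the same value. -/
lemma lerchFull_eq {N : ℕ} {x w s : ℂ} {ℓ : ℤ → ℂ} {m : ℕ → ℂ} (hℓ : IsLogFamily x ℓ)
    (hm : PrincipalFrom w m N) : lerchFull x ℓ w m s = lerchSplit N x ℓ w m s :=
  (lerchSplit_eq_of_le hℓ (Nat.sInf_mem (s := {N | PrincipalFrom w m N}) ⟨N, hm⟩)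
    (Nat.sInf_le hm)).symm

lemma lerchFull_monodromy_left {N : ℕ} {x w s : ℂ} {ℓ ℓ' : ℤ → ℂ} {m : ℕ → ℂ}
    (hℓ : IsLogFamily x ℓ) (hℓ' : IsLogFamily x ℓ') (hm : PrincipalFrom w m N) {l : ℤ}
    (hl : ℓ' l = ℓ l + 2 * Real.pi * I) (hne : ∀ m, m ≠ l → ℓ' m = ℓ m) :
    lerchFull x ℓ' w m s - lerchFull x ℓ w m s = -lerchRes l (ℓ l) (x, w, s) := by
  rw [lerchFull_eq hℓ hm, lerchFull_eq hℓ' hm, lerchSplit, lerchSplit, add_sub_add_left_eq_sub,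
    ← mul_sub, lerchMulti_monodromy hℓ hl hne]
  -- The factor `e^{2πiNx}` absorbs the shift from `w` to `w + N`, because `e^{2πiNl} = 1`.
  have h : exp (-w * poleVar l x) =
      exp (2 * Real.pi * I * N * x) * exp (-(w + N) * poleVar l x) := by
    rw [← exp_add, exp_eq_exp_iff_exists_int]
    exact ⟨-(N * l), by rw [poleVar]; push_cast; ring⟩
  simp only [lerchRes]
  rw [h]
  ring

lemma lerchFull_monodromy_right {N : ℕ} {x w s : ℂ} {ℓ : ℤ → ℂ} {m m' : ℕ → ℂ}
    (hℓ : IsLogFamily x ℓ) (hm : PrincipalFrom w m N) {p : ℕ}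
    (hp : m' p = m p + 2 * Real.pi * I) (hne : ∀ n, n ≠ p → m' n = m n) :
    lerchFull x ℓ w m' s - lerchFull x ℓ w m s =
      exp (2 * Real.pi * I * p * x) * exp (-(s * m p)) * (exp (-(2 * Real.pi * I * s)) - 1) := by
  -- With at least `p + 1` terms split off, the changed logarithm occurs only in the finite sum.
  have hm1 : PrincipalFrom w m (max N (p + 1)) := hm.mono (le_max_left _ _)
  have hm2 : PrincipalFrom w m' (max N (p + 1)) := by
    intro n hn
    rw [hne n (by have := (le_max_right N (p + 1)).trans hn; omega)]
    exact hm1 n hn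
  rw [lerchFull_eq hℓ hm1, lerchFull_eq hℓ hm2, lerchSplit, lerchSplit, add_sub_add_right_eq_sub,
    ← Finset.sum_sub_distrib, Finset.sum_eq_single p]
  · have : exp (-(s * m' p)) = exp (-(s * m p)) * exp (-(2 * Real.pi * I * s)) := by
      rw [← exp_add, hp]; ring_nf
    rw [this]
    ring
  · intro n _ hn
    rw [hne n hn, sub_self]
  · intro h
    exact absurd (Finset.mem_range.2 (lt_of_lt_of_le (Nat.lt_succ_self p) (le_max_right _ _))) h

lemma hasSum_lerchFull {x w s : ℂ} {ℓ : ℤ → ℂ} {m : ℕ → ℂ}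
    (hℓ : IsLogFamily x ℓ) (hℓ' : ∀ l : ℤ, ℓ l = vertLog 1 (x - l)) (hx : 0 < x.im)
    (hm : PrincipalFrom w m 0) (hs : 0 < s.re) :
    HasSum (fun n : ℕ => exp (2 * Real.pi * I * n * x) * exp (-(s * m n)))
      (lerchFull x ℓ w m s) := by
  have hw : 0 < w.re := by simpa using (hm 0 le_rfl).1
  have hxc : x ∈ cutPlane 1 Set.univ := fun l _ h => by linarith [h.2]
  have h1 : lerchFull x ℓ w m s = lerchInt (x, w, s) := by
    rw [lerchFull_eq hℓ hm, lerchSplit, lerchMulti_eq_sum (S := ∅) (fun l _ => hℓ' l)]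
    simp only [Finset.range_zero, Finset.sum_empty, Nat.cast_zero, mul_zero, zero_mul, exp_zero,
      one_mul, zero_add, add_zero, sub_zero]
    rw [lerchLeft_of_mem (p := (x, w, s)) hxc hw, lerchExt_eq_lerchInt hxc hw hs]
  rw [h1]
  refine (hasSum_lerchInt hx hw hs).congr_fun fun n => ?_
  rw [(hm n (Nat.zero_le n)).2]

/-- The values at `w` of the logarithms of `w + p` continued from their values `m` at `w₀`. -/
noncomputable def contLogNat (w₀ : ℂ) (m : ℕ → ℂ) (w : ℂ) (p : ℕ) : ℂ :=
  m p + log ((w + p) / (w₀ + p))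

/-- On this disc `Re (w + p) > 0` for all `p ≥ N`, so the principal logarithm is the continued one.
-/
lemma principalFrom_contLogNat {w₀ w : ℂ} {m : ℕ → ℂ} {N : ℕ} (hm : PrincipalFrom w₀ m N)
    (hw : w ∈ ball w₀ (w₀ + N).re) : PrincipalFrom w (contLogNat w₀ m w) N := by
  intro p hp
  have hle : (w₀ + N).re ≤ (w₀ + p).re := by
    simpa using hp
  have hre {v : ℂ} (hv : v ∈ ball w₀ (w₀ + N).re) : 0 < (v + p).re := by
    rw [mem_ball, dist_eq] at hv
    have := (abs_lt.1 ((abs_re_le_norm _).trans_lt hv)).1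
    have h2 : (v + p).re = (v - w₀).re + (w₀ + p).re := by simp; ring
    rw [h2]
    linarith
  refine ⟨hre hw, ?_⟩
  have hd : (w₀ + N).re ≤ dist w₀ (-(p : ℂ)) := by
    rw [dist_eq, sub_neg_eq_add]
    exact hle.trans (re_le_norm _)
  have h := eq_add_log_ratio (g := fun v => log (v + p)) (c := -(p : ℂ)) hd (fun v hv => by
    have := ((hasDerivAt_id v).add_const (p : ℂ)).clog (Or.inl (hre hv))
    rw [sub_neg_eq_add, ← one_div]
    exact this) hw
  rw [contLogNat, (hm p hp).2, h, sub_neg_eq_add, sub_neg_eq_add]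

lemma isLogFamily_contLog {x₀ : ℂ} {ℓ : ℤ → ℂ} (h : IsLogFamily x₀ ℓ) :
    ∀ᶠ x in 𝓝 x₀, IsLogFamily x (contLog x₀ ℓ x) := by
  have hopen : ∃ T : Set ℤ, Tᶜ.Finite ∧ x₀ ∈ cutPlane 1 T := by
    rcases mem_cutPlane_or h.mem with h | ⟨l, hre, him⟩
    · exact ⟨Set.univ, by simp, h⟩
    · exact ⟨{l}ᶜ, by simp, mem_cutPlane_compl (by simp [hre])⟩
  obtain ⟨T, hT, hx⟩ := hopen
  obtain ⟨δ, hδ, hball⟩ := Metric.isOpen_iff.1 (isOpen_cutPlane 1 T) x₀ hx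
  have hex : ∀ᶠ x in 𝓝 x₀, x ∈ puncturedPlane Set.univ := by
    filter_upwards [ball_mem_nhds x₀ hδ, (Filter.eventually_all_finite hT).2 fun l _ =>
      eventually_ne_nhds (sub_ne_zero.1 (h.ne l))] with x h1 h2 l _
    by_cases hl : l ∈ T
    · exact cutPlane_subset (hball h1) l hl
    · exact h2 l hl
  filter_upwards [ball_mem_nhds x₀ hδ, hex] with x hxb hx2
  refine ⟨fun l => ?_, (h.finite.union hT).subset fun l hl => ?_⟩
  · have h1 := h.ne l
    rw [contLog, exp_add, h.exp_eq, exp_log (div_ne_zero (sub_ne_zero.2 (hx2 l trivial)) h1)]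
    field_simp
  · by_contra hc
    simp only [Set.mem_union, Set.mem_ofPred_eq, Set.mem_compl_iff, not_or, not_not] at hc
    exact hl (by rw [contLog, hc.1, vertLog_eq_of_mem_ball hball hxb hc.2])

lemma analyticAt_lerchFull {x₀ w₀ : ℂ} (s₀ : ℂ) {ℓ : ℤ → ℂ} {m : ℕ → ℂ} {N : ℕ}
    (hℓ : IsLogFamily x₀ ℓ) (hm : PrincipalFrom w₀ m N) (hne : ∀ p : ℕ, w₀ + p ≠ 0) :
    AnalyticAt ℂ (fun q : ℂ × ℂ × ℂ => lerchFull q.1 (contLog x₀ ℓ q.1) q.2.1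
      (contLogNat w₀ m q.2.1) q.2.2) (x₀, w₀, s₀) := by
  have hfst : AnalyticAt ℂ (fun q : ℂ × ℂ × ℂ => q.1) (x₀, w₀, s₀) := analyticAt_fst
  have hsnd : AnalyticAt ℂ (fun q : ℂ × ℂ × ℂ => q.2.1) (x₀, w₀, s₀) :=
    analyticAt_fst.comp analyticAt_snd
  have hthd : AnalyticAt ℂ (fun q : ℂ × ℂ × ℂ => q.2.2) (x₀, w₀, s₀) :=
    analyticAt_snd.comp analyticAt_snd
  have hN := (hm N le_rfl).1
  have h : AnalyticAt ℂ (fun q : ℂ × ℂ × ℂ => lerchSplit N q.1 (contLog x₀ ℓ q.1) q.2.1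
      (contLogNat w₀ m q.2.1) q.2.2) (x₀, w₀, s₀) := by
    refine AnalyticAt.add (Finset.analyticAt_fun_sum _ fun p _ => ?_) ?_
    · refine ((analyticAt_const.mul hfst).cexp).mul (((hthd.mul (analyticAt_const.add ?_)).neg).cexp)
      refine AnalyticAt.clog ((hsnd.add analyticAt_const).div_const) ?_
      change (w₀ + p) / (w₀ + p) ∈ slitPlane
      rw [div_self (hne p)]
      exact one_mem_slitPlane
    · refine ((analyticAt_const.mul hfst).cexp).mul ?_
      have h1 := analyticAt_lerchMulti s₀ hℓ hN
      have h2 : AnalyticAt ℂ (fun q : ℂ × ℂ × ℂ => (q.1, q.2.1 + N, q.2.2)) (x₀, w₀, s₀) :=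
        hfst.prod ((hsnd.add analyticAt_const).prod hthd)
      exact AnalyticAt.comp (g := fun p : ℂ × ℂ × ℂ =>
        lerchMulti p.1 (contLog x₀ ℓ p.1) p.2.1 p.2.2)
        (f := fun q : ℂ × ℂ × ℂ => (q.1, q.2.1 + N, q.2.2)) h1 h2
  refine h.congr ?_
  filter_upwards [hfst.continuousAt.eventually (isLogFamily_contLog hℓ),
    hsnd.continuousAt.preimage_mem_nhds (ball_mem_nhds w₀ hN)] with q h1 h2
  exact (lerchFull_eq h1 (principalFrom_contLogNat hm h2)).symm

end MultivaluedLerch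

/-! ### Computing logarithms along paths and circles. -/

section LogAlongPaths

variable {X : Type*} [TopologicalSpace X] {x₀ x : X} (f : C(X, {z : ℂ // z ≠ 0}))

lemma vertLog_of_im_pos {u : ℂ} (hu : 0 < u.im) : vertLog 1 u = log u := by
  have hre : (-(((1 : ℝ) : ℂ) * I) * u).re = u.im := by simp
  have h0 : -(((1 : ℝ) : ℂ) * I) * u ≠ 0 := by
    intro h
    rw [h, zero_re] at hre
    linarith
  have harg := abs_lt.1 (abs_arg_lt_pi_div_two_iff.2 (Or.inl (hre.symm ▸ hu :
    0 < (-(((1 : ℝ) : ℂ) * I) * u).re)))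
  have hpi := Real.pi_pos
  have h := log_mul I_ne_zero h0 (by rw [arg_I]; constructor <;> linarith)
  have hu' : I * (-(((1 : ℝ) : ℂ) * I) * u) = u := by
    rw [ofReal_one]
    linear_combination (-u) * I_mul_I
  rw [hu', log_I] at h
  rw [h, vertLog]
  push_cast
  ring

lemma logInc_of_ratio {y : X} (γ : Path x y)
    (h : ∀ t, (f (γ t)).1 / (f x).1 ∈ slitPlane) : logInc f γ = log ((f y).1 / (f x).1) := by
  rw [logInc_eq f (θ := fun t => log ((f (γ t)).1 / (f x).1) + log (f x).1)]
  · simp [div_self (f x).2]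
  · exact (Continuous.clog (by
      simp_rw [div_eq_mul_inv]
      exact (continuous_subtype_val.comp (f.continuous.comp γ.continuous)).mul
        continuous_const) h).add continuous_const
  · intro t
    rw [exp_add, exp_log (slitPlane_ne_zero (h t)), exp_log (f x).2, div_mul_cancel₀ _ (f x).2]

/-- Divided by `A`, the circle stays in the disc of radius `1` around `1`, where the principal
logarithm is continuous. -/
lemma logInc_of_circle (ω : Path x x) {A B : ℂ}
    (h : ∀ t : unitInterval, (f (ω t)).1 = A + B * exp (2 * Real.pi * I * t)) (hAB : ‖B‖ < ‖A‖) :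
    logInc f ω = 0 := by
  have hA : A ≠ 0 := norm_pos_iff.1 ((norm_nonneg B).trans_lt hAB)
  have hs (t : unitInterval) : 1 + B / A * exp (2 * Real.pi * I * t) ∈ slitPlane := by
    refine mem_slitPlane_of_norm_lt_one ?_
    have : ‖exp (2 * Real.pi * I * t)‖ = 1 := by
      rw [show 2 * Real.pi * I * ((t : ℝ) : ℂ) = ((2 * Real.pi * (t : ℝ) : ℝ) : ℂ) * I by
        push_cast; ring, norm_exp_ofReal_mul_I]
    rw [norm_mul, this, mul_one, norm_div, div_lt_one (norm_pos_iff.2 hA)]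
    exact hAB
  rw [logInc_eq f (θ := fun t : unitInterval => log (1 + B / A * exp (2 * Real.pi * I * t)) + log A)]
  · simp
  · exact (Continuous.clog (by fun_prop) hs).add continuous_const
  · intro t
    rw [exp_add, exp_log (slitPlane_ne_zero (hs t)), exp_log hA, h t]
    field_simp

lemma logInc_of_circle_zero (ω : Path x x) {B : ℂ}
    (h : ∀ t : unitInterval, (f (ω t)).1 = B * exp (2 * Real.pi * I * t)) :
    logInc f ω = 2 * Real.pi * I := by
  have hB : B ≠ 0 := by
    rintro rfl
    exact (f (ω 0)).2 (by rw [h, zero_mul])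
  rw [logInc_eq f (θ := fun t : unitInterval => log B + 2 * Real.pi * I * t)]
  · simp
  · fun_prop
  · intro t
    rw [exp_add, exp_log hB, h t]

lemma logInc_conj {y : X} (τ : Path x y) (ω : Path y y) :
    logInc f ((τ.trans ω).trans τ.symm) = logInc f ω := by
  rw [logInc_trans, logInc_trans, logInc_symm]
  ring

namespace AbelianCover

@[elab_as_elim]
lemma ofPath_induction {p : AbelianCover x₀ → Prop} (h : ∀ {x : X} (γ : Path x₀ x), p (ofPath γ))
    (P : AbelianCover x₀) : p P := by
  obtain ⟨x, c⟩ := P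
  obtain ⟨γ, rfl⟩ := Quotient.exists_rep c
  exact h γ

lemma logAlong_ofPath_of_theta (γ : Path x₀ x) {θ : unitInterval → ℂ} (hθ : Continuous θ)
    (h : ∀ t, exp (θ t) = (f (γ t)).1) (h0 : θ 0 = log (f x₀).1) :
    logAlong f (ofPath γ) = θ 1 := by
  rw [logAlong_ofPath, logInc_eq f hθ h, h0]
  ring

lemma logAlong_eq_vertLog (γ : Path x₀ x) (h0 : 0 < (f x₀).1.im)
    (h : ∀ t, ¬((f (γ t)).1.re = 0 ∧ (f (γ t)).1.im ≤ 0)) :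
    logAlong f (ofPath γ) = vertLog 1 (f x).1 := by
  rw [logAlong_ofPath_of_theta f γ (θ := fun t => vertLog 1 (f (γ t)).1), γ.target]
  · refine Continuous.add (Continuous.clog (continuous_const.mul
      (continuous_subtype_val.comp (f.continuous.comp γ.continuous))) fun t => ?_) continuous_const
    exact vertLog_mem_slitPlane one_ne_zero (by simpa using h t)
  · exact fun t => exp_vertLog (Or.inl rfl) (f (γ t)).2
  · simp only [γ.source]
    exact vertLog_of_im_pos h0

lemma logAlong_eq_log (γ : Path x₀ x) (h : ∀ t, (f (γ t)).1 ∈ slitPlane) :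
    logAlong f (ofPath γ) = log (f x).1 := by
  rw [logAlong_ofPath_of_theta f γ (θ := fun t => log (f (γ t)).1), γ.target]
  · exact Continuous.clog (continuous_subtype_val.comp (f.continuous.comp γ.continuous)) h
  · exact fun t => exp_log (f (γ t)).2
  · simp only [γ.source]

end AbelianCover

end LogAlongPaths

lemma exists_norm_coord_le {k : ℕ} {U : Set (Fin k → ℂ)} {x y : U} (γ : Path x y) (j : Fin k) :
    ∃ R : ℝ, ∀ t, ‖(γ t).1 j‖ ≤ R := by
  have hc : Continuous fun t => (γ t).1 j :=
    (continuous_apply j).comp (continuous_subtype_val.comp γ.continuous)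
  obtain ⟨R, hR⟩ := (isCompact_range hc).isBounded.exists_norm_le
  exact ⟨R, fun t => hR _ ⟨t, rfl⟩⟩

/-! ### Reduction of `A_k` and `Z_k` to products of punctured planes. -/

section Domains

variable {k : ℕ} [NeZero k]

lemma natCast_ne_zero' : (k : ℂ) ≠ 0 := Nat.cast_ne_zero.2 (NeZero.ne k)

variable (k) in
/-- The coordinates `k a_j` identify `A_k` with a product of punctured planes. -/
noncomputable def aHomeo : aDomain k ≃ₜ ∀ _ : Fin k, puncturedPlane Set.univ where
  toFun a j := ⟨k * a.1 j, fun l _ h => a.2 j l (by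
    rw [eq_div_iff natCast_ne_zero', mul_comm, h])⟩
  invFun b := ⟨fun j => (b j).1 / k, fun j l h => (b j).2 l trivial (by
    rw [div_left_inj' natCast_ne_zero'] at h; exact h)⟩
  left_inv a := by
    ext j
    exact mul_div_cancel_left₀ _ natCast_ne_zero'
  right_inv b := by
    ext j
    exact mul_div_cancel₀ _ natCast_ne_zero'
  continuous_toFun := by
    refine continuous_pi fun j => Continuous.subtype_mk ?_ _
    exact continuous_const.mul ((continuous_apply j).comp continuous_subtype_val)
  continuous_invFun := by
    refine Continuous.subtype_mk (continuous_pi fun j => ?_) _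
    exact (continuous_subtype_val.comp (continuous_apply j)).div_const _

variable (k) in
/-- The coordinates `(z_j + j) / k` identify `Z_k` with a product of punctured planes. -/
noncomputable def zHomeo : zDomain k ≃ₜ ∀ _ : Fin k, puncturedPlane {l | l ≤ 0} where
  toFun z j := ⟨(z.1 j + (j + 1)) / k, fun l hl h => z.2 j (-l).toNat (by
    rw [div_eq_iff natCast_ne_zero'] at h
    have h1 : (((-l).toNat : ℤ) : ℂ) = ((-l : ℤ) : ℂ) := by
      rw [Int.toNat_of_nonneg (by have : l ≤ 0 := hl; omega)]
    rw [Int.cast_natCast] at h1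
    rw [h1]
    push_cast
    linear_combination h)⟩
  invFun b := ⟨fun j => k * (b j).1 - (j + 1), fun j p h => (b j).2 (-p) (by simp) (by
    have : (k : ℂ) * (b j).1 = k * ((-p : ℤ) : ℂ) := by push_cast; linear_combination h
    exact mul_left_cancel₀ natCast_ne_zero' this)⟩
  left_inv z := by
    ext j
    change (k : ℂ) * ((z.1 j + (j + 1)) / k) - (j + 1) = z.1 j
    rw [mul_div_cancel₀ _ natCast_ne_zero', add_sub_cancel_right]
  right_inv b := by
    ext j
    change ((k : ℂ) * (b j).1 - (j + 1) + (j + 1)) / k = (b j).1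
    rw [sub_add_cancel, mul_div_cancel_left₀ _ natCast_ne_zero']
  continuous_toFun := by
    refine continuous_pi fun j => Continuous.subtype_mk ?_ _
    exact (((continuous_apply j).comp continuous_subtype_val).add continuous_const).div_const _
  continuous_invFun := by
    refine Continuous.subtype_mk (continuous_pi fun j => ?_) _
    exact (continuous_const.mul (continuous_subtype_val.comp (continuous_apply j))).sub
      continuous_const

/-- The function `k a_j - l` on `A_k`. -/
noncomputable def aFun (j : Fin k) (l : ℤ) : C(aDomain k, {z : ℂ // z ≠ 0}) :=
  (puncturedFun (Set.mem_univ l)).comp (homeoProj (aHomeo k) j)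

/-- The function `(z_j + j) / k + p` on `Z_k`. -/
noncomputable def zFun (j : Fin k) (p : ℕ) : C(zDomain k, {z : ℂ // z ≠ 0}) :=
  (puncturedFun (T := {l | l ≤ 0}) (l := -p) (by simp)).comp (homeoProj (zHomeo k) j)

lemma aFun_apply (j : Fin k) (l : ℤ) (a : aDomain k) : (aFun j l a).1 = k * a.1 j - l := rfl

lemma zFun_apply (j : Fin k) (p : ℕ) (z : zDomain k) :
    (zFun j p z).1 = (z.1 j + (j + 1)) / k + p := by
  change (z.1 j + (j + 1)) / k - ((-p : ℤ) : ℂ) = _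
  push_cast; ring

variable {a₀ : aDomain k} {z₀ : zDomain k}

/-- The logarithm of `k a_j - l` on the cover of `A_k`. -/
noncomputable def aLog (P : AbelianCover a₀) (j : Fin k) (l : ℤ) : ℂ :=
  AbelianCover.logAlong (aFun j l) P

/-- The logarithm of `(z_j + j) / k + p` on the cover of `Z_k`. -/
noncomputable def zLog (Q : AbelianCover z₀) (j : Fin k) (p : ℕ) : ℂ :=
  AbelianCover.logAlong (zFun j p) Q

/-- A path is bounded, so it meets the cuts below only finitely many integers. For all others the
logarithm, which starts in the upper half-plane, remains on the branch `vertLog 1`. -/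
lemma isLogFamily_aLog (ha₀ : ∀ j, 0 < (a₀.1 j).im) (P : AbelianCover a₀) (j : Fin k) :
    IsLogFamily (k * P.pt.1 j) (aLog P j) := by
  refine ⟨fun l => AbelianCover.exp_logAlong _ P, ?_⟩
  induction P using AbelianCover.ofPath_induction with | _ γ => ?_
  obtain ⟨R, hR⟩ := exists_norm_coord_le γ j
  refine (Set.finite_Icc (-⌈k * R⌉) ⌈k * R⌉).subset fun l hl => ?_
  by_contra hc
  refine hl (AbelianCover.logAlong_eq_vertLog (aFun j l) γ ?_ fun t ht => hc ?_)
  · rw [aFun_apply]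
    simpa using mul_pos (Nat.cast_pos.2 (NeZero.pos k)) (ha₀ j)
  · have h1 := ht.1
    rw [aFun_apply] at h1
    have h2 : (l : ℝ) = k * ((γ t).1 j).re := by
      simp at h1; linarith
    have h3 := abs_le.1 ((abs_re_le_norm _).trans (hR t))
    have hk : (0 : ℝ) ≤ k := Nat.cast_nonneg k
    have h4 := Int.le_ceil (k * R)
    constructor
    · have : (-⌈k * R⌉ : ℝ) ≤ l := by rw [h2]; nlinarith
      exact_mod_cast this
    · have : (l : ℝ) ≤ ⌈k * R⌉ := by rw [h2]; nlinarith
      exact_mod_cast this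

/-- If `|z_j| ≤ R` along the path, then `(z_j + j)/k + p` stays in the right half-plane for `p ≥ R`,
and its logarithm stays principal. -/
lemma exists_principalFrom_zLog (Q : AbelianCover z₀) (j : Fin k) :
    ∃ N, PrincipalFrom ((Q.pt.1 j + (j + 1)) / k) (zLog Q j) N := by
  induction Q using AbelianCover.ofPath_induction with | _ γ => ?_
  obtain ⟨R, hR⟩ := exists_norm_coord_le γ j
  have hk : (1 : ℝ) ≤ k := Nat.one_le_cast.2 (NeZero.pos k)
  refine ⟨⌈R⌉₊, fun p hp => ?_⟩
  have key (t : unitInterval) : 0 < (zFun j p (γ t)).1.re := by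
    have h3 := abs_le.1 ((abs_re_le_norm _).trans (hR t))
    have h4 : R ≤ p := (Nat.le_ceil R).trans (Nat.cast_le.2 hp)
    have h5 : (zFun j p (γ t)).1.re = (((γ t).1 j).re + (j + 1)) / k + p := by
      rw [zFun_apply, add_re, natCast_re, div_natCast_re]
      simp
    have hR0 : 0 ≤ R := (norm_nonneg _).trans (hR t)
    have hj : (0 : ℝ) ≤ (j : ℕ) := Nat.cast_nonneg _
    have h6 : ((γ t).1 j).re + (j + 1) ≥ -R + 1 := by linarith [h3.1]
    rw [h5]
    have h7 : (-R + 1) / k ≤ (((γ t).1 j).re + (j + 1)) / k := by gcongr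
    have h8 : -R < (-R + 1) / k := by
      rw [lt_div_iff₀ (by linarith)]
      nlinarith
    linarith
  constructor
  · have := key 1
    rwa [γ.target, zFun_apply] at this
  · have := AbelianCover.logAlong_eq_log (zFun j p) γ fun t => Or.inl (key t)
    rwa [zFun_apply] at this

/-- The continuation of the function `ζ_k` to the product of the covers and `ℂ`. -/
noncomputable def zetaCont (R : AbelianCover a₀ × AbelianCover z₀ × ℂ) : ℂ :=
  exp (-(R.2.2 * log k)) * ∑ j : Fin k, exp (2 * Real.pi * I * (j + 1) * R.1.pt.1 j) *
    lerchFull (k * R.1.pt.1 j) (aLog R.1 j) ((R.2.1.pt.1 j + (j + 1)) / k) (zLog R.2.1 j) R.2.2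

end Domains

/-! ### Comparison with the series. -/

section Series

variable {k : ℕ} [NeZero k] {a₀ : aDomain k} {z₀ : zDomain k}

lemma kpos : (0 : ℝ) < k := Nat.cast_pos.2 (NeZero.pos k)

lemma log_natCast_mul {u : ℂ} (hu : u ≠ 0) : log (k * u) = log k + log u := by
  have h := log_ofReal_mul (kpos (k := k)) hu
  rw [ofReal_log kpos.le, ofReal_natCast] at h
  exact h

lemma mul_add_eq (j : Fin k) (z : ℂ) (p : ℕ) :
    (p * k + (j + 1) : ℂ) + z = k * ((z + (j + 1)) / k + p) := by
  have := natCast_ne_zero' (k := k)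
  field_simp
  ring

lemma mod_add (j : Fin k) (p : ℕ) : Fin.ofNat k (p * k + j) = j := by
  ext
  simp [Fin.ofNat, Nat.mod_eq_of_lt j.2]

lemma lerchLipschitzTerm_eq (a z : Fin k → ℂ) (s : ℂ) (j : Fin k) (p : ℕ)
    (h : (z j + (j + 1)) / k + p ≠ 0) :
    lerchLipschitzTerm k a z s (p * k + j) = exp (-(s * log k)) *
      (exp (2 * Real.pi * I * (j + 1) * a j) * (exp (2 * Real.pi * I * p * (k * a j)) *
        exp (-(s * log ((z j + (j + 1)) / k + p))))) := by
  rw [lerchLipschitzTerm, mod_add]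
  have h1 : ((p * k + j : ℕ) : ℂ) + 1 + z j = k * ((z j + (j + 1)) / k + p) := by
    rw [← mul_add_eq]; push_cast; ring
  rw [h1, cpow_def_of_ne_zero (mul_ne_zero natCast_ne_zero' h), log_natCast_mul h, div_eq_mul_inv,
    ← exp_neg, ← exp_add, ← exp_add, ← exp_add, ← exp_add]
  push_cast
  ring_nf

lemma hasSum_of_residues {f : ℕ → ℂ} {c : Fin k → ℂ}
    (h : ∀ j : Fin k, HasSum (fun p : ℕ => f (p * k + j)) (c j)) : HasSum f (∑ j, c j) := by
  have h1 (j : Fin k) : HasSum (fun n => if Fin.ofNat k n = j then f n else 0) (c j) := by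
    have hinj : Function.Injective fun p : ℕ => p * k + (j : ℕ) := fun p q hpq =>
      Nat.eq_of_mul_eq_mul_right (NeZero.pos k) (by simpa using hpq)
    rw [← hinj.hasSum_iff]
    · refine (h j).congr_fun fun p => ?_
      simp only [Function.comp_apply, mod_add, if_true]
    · intro n hn
      rw [if_neg]
      rintro rfl
      exact hn ⟨n / k, by simp [Fin.ofNat, Nat.div_add_mod']⟩
  refine (hasSum_sum fun j _ => h1 j).congr_fun fun n => ?_
  simp

/-- Along such paths no cut is met, so all sheet numbers vanish and all logarithms of `w + p` are
principal. `Re s > 0` suffices, by the exponential decay in `Im a_j > 0`. -/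
lemma hasSum_zetaCont {a : aDomain k} {z : zDomain k} (ha₀ : ∀ j, 0 < (a₀.1 j).im)
    (α : Path a₀ a) (β : Path z₀ z) {s : ℂ} (hα : ∀ t j, 0 < ((α t).1 j).im)
    (hβ : ∀ t j, 0 < ((β t).1 j).re) (hs : 0 < s.re) :
    HasSum (lerchLipschitzTerm k a.1 z.1 s)
      (zetaCont (AbelianCover.ofPath α, AbelianCover.ofPath β, s)) := by
  rw [zetaCont, Finset.mul_sum]
  refine hasSum_of_residues fun j => ?_
  have him (t : unitInterval) (l : ℤ) : 0 < (aFun j l (α t)).1.im := by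
    rw [aFun_apply]
    simpa using mul_pos kpos (hα t j)
  have hre (t : unitInterval) (p : ℕ) : 0 < (zFun j p (β t)).1.re := by
    rw [zFun_apply, add_re, natCast_re, div_natCast_re]
    have := hβ t j
    have := kpos (k := k)
    simp
    positivity
  have ha : 0 < (k * a.1 j).im := by simpa [aFun_apply] using him 1 0
  have hA (l : ℤ) : aLog (AbelianCover.ofPath α) j l = vertLog 1 (k * a.1 j - l) :=
    AbelianCover.logAlong_eq_vertLog (aFun j l) α (by simpa using him 0 l)
      fun t h => absurd h.2 (not_le.2 (him t l))
  have hZ : PrincipalFrom ((z.1 j + (j + 1)) / k) (zLog (AbelianCover.ofPath β) j) 0 := by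
    intro p _
    have h1 := AbelianCover.logAlong_eq_log (zFun j p) β fun t => Or.inl (hre t p)
    have h2 := hre 1 p
    rw [zFun_apply] at h1
    rw [β.target, zFun_apply] at h2
    exact ⟨h2, h1⟩
  have h := hasSum_lerchFull (isLogFamily_aLog ha₀ (AbelianCover.ofPath α) j) hA ha hZ hs
  refine ((h.mul_left (exp (2 * Real.pi * I * (j + 1) * a.1 j))).mul_left
    (exp (-(s * log k)))).congr_fun fun p => ?_
  obtain ⟨h1, h2⟩ := hZ p (Nat.zero_le p)
  have h0 : (z.1 j + (j + 1)) / k + p ≠ 0 := fun h => by simp [h] at h1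
  rw [lerchLipschitzTerm_eq _ _ _ _ _ h0, h2]
  rfl

end Series

/-! ### Monodromy of `zetaCont`. -/

section Monodromy

variable {k : ℕ} [NeZero k] {a₀ : aDomain k} {z₀ : zDomain k}

/-- In the variable `k a_j` the circle has centre `l` and radius less than `1`, so it encloses no
other integer. -/
lemma logInc_aFun_circle {a : aDomain k} {j : Fin k} {l : ℤ} {ω : Path a a}
    (hω : IsCircleAround j (l / k) (1 / k) ω) (j' : Fin k) (l' : ℤ) :
    logInc (aFun j' l') ω = if j' = j ∧ l' = l then 2 * Real.pi * I else 0 := by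
  have hk := natCast_ne_zero' (k := k)
  obtain ⟨hr, hω⟩ := hω
  by_cases hj : j' = j
  · subst hj
    have hval (t : unitInterval) : (aFun j' l' (ω t)).1 = (l - l' : ℤ) +
        k * (a.1 j' - l / k) * exp (2 * Real.pi * I * t) := by
      rw [aFun_apply, hω t, Function.update_self]
      push_cast
      field_simp
      ring
    by_cases hl : l' = l
    · subst hl
      rw [if_pos ⟨rfl, rfl⟩]
      refine logInc_of_circle_zero _ ω (B := k * (a.1 j' - l' / k)) fun t => (hval t).trans ?_
      simp
    · rw [if_neg fun h => hl h.2]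
      refine logInc_of_circle _ ω hval ?_
      have h1 : ‖(k : ℂ) * (a.1 j' - l / k)‖ < 1 := by
        rw [norm_mul, Complex.norm_natCast, mul_comm, ← lt_div_iff₀ kpos]
        exact hr
      refine h1.trans_le ?_
      rw [norm_intCast]
      exact_mod_cast Int.one_le_abs (sub_ne_zero.2 (Ne.symm hl))
  · rw [if_neg fun h => hj h.1]
    refine logInc_of_circle _ ω (A := (aFun j' l' a).1) (B := 0) (fun t => ?_) ?_
    · rw [aFun_apply, aFun_apply, hω t, Function.update_of_ne hj]
      simp
    · rw [norm_zero]
      exact norm_pos_iff.2 (aFun j' l' a).2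

lemma logInc_zFun_circle {z : zDomain k} {j : Fin k} {p : ℕ} {ω : Path z z}
    (hω : IsCircleAround j (-(p * k : ℂ) - (j + 1 : ℂ)) k ω) (j' : Fin k) (p' : ℕ) :
    logInc (zFun j' p') ω = if j' = j ∧ p' = p then 2 * Real.pi * I else 0 := by
  have hk := natCast_ne_zero' (k := k)
  obtain ⟨hr, hω⟩ := hω
  by_cases hj : j' = j
  · subst hj
    have hval (t : unitInterval) : (zFun j' p' (ω t)).1 = (p' - p : ℤ) +
        (z.1 j' - (-(p * k : ℂ) - (j' + 1 : ℂ))) / k * exp (2 * Real.pi * I * t) := by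
      rw [zFun_apply, hω t, Function.update_self]
      push_cast
      field_simp
      ring
    by_cases hl : p' = p
    · subst hl
      rw [if_pos ⟨rfl, rfl⟩]
      refine logInc_of_circle_zero _ ω
        (B := (z.1 j' - (-(p' * k : ℂ) - (j' + 1 : ℂ))) / k) fun t => (hval t).trans ?_
      simp
    · rw [if_neg fun h => hl h.2]
      refine logInc_of_circle _ ω hval ?_
      have h1 : ‖(z.1 j' - (-(p * k : ℂ) - (j' + 1 : ℂ))) / k‖ < 1 := by
        rw [norm_div, Complex.norm_natCast, div_lt_one kpos]
        exact hr
      refine h1.trans_le ?_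
      rw [norm_intCast]
      exact_mod_cast Int.one_le_abs (by omega : (p' : ℤ) - p ≠ 0)
  · rw [if_neg fun h => hj h.1]
    refine logInc_of_circle _ ω (A := (zFun j' p' z).1) (B := 0) (fun t => ?_) ?_
    · rw [zFun_apply, zFun_apply, hω t, Function.update_of_ne hj]
      simp
    · rw [norm_zero]
      exact norm_pos_iff.2 (zFun j' p' z).2

lemma logInc_aFun_meridian {a : aDomain k} {j : Fin k} {l : ℤ} {σ : Path a a}
    (hσ : IsMeridian j (l / k) (1 / k) σ) (j' : Fin k) (l' : ℤ) :
    logInc (aFun j' l') σ = if j' = j ∧ l' = l then 2 * Real.pi * I else 0 := by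
  obtain ⟨y, τ, ω, hω, rfl⟩ := hσ
  rw [logInc_conj, logInc_aFun_circle hω]

lemma logInc_zFun_meridian {z : zDomain k} {j : Fin k} {p : ℕ} {σ : Path z z}
    (hσ : IsMeridian j (-(p * k : ℂ) - (j + 1 : ℂ)) k σ) (j' : Fin k) (p' : ℕ) :
    logInc (zFun j' p') σ = if j' = j ∧ p' = p then 2 * Real.pi * I else 0 := by
  obtain ⟨y, τ, ω, hω, rfl⟩ := hσ
  rw [logInc_conj, logInc_zFun_circle hω]

/-- The change of `zetaCont` under a monodromy of the logarithm of `k a_j - l`. -/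
lemma zetaCont_append_left (ha₀ : ∀ j, 0 < (a₀.1 j).im) (P : AbelianCover a₀)
    (Q : AbelianCover z₀) (s : ℂ) {σ : Path P.pt P.pt} {j : Fin k} {l : ℤ}
    (hσ : ∀ j' l', logInc (aFun j' l') σ = if j' = j ∧ l' = l then 2 * Real.pi * I else 0) :
    zetaCont (P.append σ, Q, s) - zetaCont (P, Q, s) =
      -(2 * Real.pi * I * exp (2 * Real.pi * I * (j + 1) * P.pt.1 j) * (Gamma s)⁻¹) *
        (exp ((s - 1) * (Real.log (2 * Real.pi) + (aLog P j l - log k))) *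
          exp (I * (Real.pi / 2) * (s - 1)) *
          exp (-(2 * Real.pi * I) * (P.pt.1 j - l / k) * ((j + 1) + Q.pt.1 j)) / k) := by
  have hk := natCast_ne_zero' (k := k)
  have hlog (j' : Fin k) (l' : ℤ) : aLog (P.append σ) j' l' = aLog P j' l' +
      if j' = j ∧ l' = l then 2 * Real.pi * I else 0 := by
    rw [aLog, AbelianCover.logAlong_append, hσ]
    rfl
  obtain ⟨N, hN⟩ := exists_principalFrom_zLog Q j
  have hdiff := lerchFull_monodromy_left (s := s) (isLogFamily_aLog ha₀ P j)
    (isLogFamily_aLog ha₀ (P.append σ) j) hN (l := l) (by rw [hlog, if_pos ⟨rfl, rfl⟩])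
    (fun m hm => by rw [hlog, if_neg fun h => hm h.2, add_zero])
  have hsum : zetaCont (P.append σ, Q, s) - zetaCont (P, Q, s) = exp (-(s * log k)) *
      (exp (2 * Real.pi * I * (j + 1) * P.pt.1 j) *
        -lerchRes l (aLog P j l) (k * P.pt.1 j, (Q.pt.1 j + (j + 1)) / k, s)) := by
    rw [zetaCont, zetaCont, ← mul_sub, ← Finset.sum_sub_distrib, Finset.sum_eq_single j]
    · rw [← hdiff]
      exact congrArg _ (mul_sub _ _ _).symm
    · intro j' _ hj'
      have : aLog (P.append σ) j' = aLog P j' := by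
        funext l'
        rw [hlog, if_neg fun h => hj' h.1, add_zero]
      simp only [this]
      exact sub_self _
    · simp
  -- The residue contains `log (k a_j - l) = log k + log (a_j - l/k)`. The resulting `k^{s-1}` and
  -- the factor `k^{-s}` of `zetaCont` leave `1/k`.
  have e1 : exp ((s - 1) * (aLog P j l + (Real.log (2 * Real.pi) + I * (Real.pi / 2)))) =
      exp (s * log k) / k * (exp ((s - 1) * (Real.log (2 * Real.pi) + (aLog P j l - log k))) *
        exp (I * (Real.pi / 2) * (s - 1))) := by
    nth_rewrite 2 [← exp_log hk]
    rw [← exp_sub, ← exp_add, ← exp_add]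
    ring_nf
  have e2 : exp (-((Q.pt.1 j + (j + 1)) / k) * poleVar l (k * P.pt.1 j)) =
      exp (-(2 * Real.pi * I) * (P.pt.1 j - l / k) * ((j + 1) + Q.pt.1 j)) := by
    congr 1
    rw [poleVar]
    field_simp
    ring
  have e3 : exp (-(s * log k)) * exp (s * log k) = 1 := by
    rw [← exp_add, neg_add_cancel, exp_zero]
  rw [hsum]
  simp only [lerchRes]
  rw [e1, e2]
  linear_combination (-(2 * Real.pi * I * exp (2 * Real.pi * I * (j + 1) * P.pt.1 j) * (Gamma s)⁻¹) *
        (exp ((s - 1) * (Real.log (2 * Real.pi) + (aLog P j l - log k))) *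
          exp (I * (Real.pi / 2) * (s - 1)) *
          exp (-(2 * Real.pi * I) * (P.pt.1 j - l / k) * ((j + 1) + Q.pt.1 j)) / k)) * e3

/-- The change of `zetaCont` under a monodromy of the logarithm of `(z_j + j) / k + p`. -/
lemma zetaCont_append_right (ha₀ : ∀ j, 0 < (a₀.1 j).im) (P : AbelianCover a₀)
    (Q : AbelianCover z₀) (s : ℂ) {σ : Path Q.pt Q.pt} {j : Fin k} {p : ℕ}
    (hσ : ∀ j' p', logInc (zFun j' p') σ = if j' = j ∧ p' = p then 2 * Real.pi * I else 0) :
    zetaCont (P, Q.append σ, s) - zetaCont (P, Q, s) =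
      exp (2 * Real.pi * I * (p * k + (j + 1)) * P.pt.1 j) *
        exp (-(s * (log k + zLog Q j p))) * (exp (-(2 * Real.pi * I * s)) - 1) := by
  have hlog (j' : Fin k) (p' : ℕ) : zLog (Q.append σ) j' p' = zLog Q j' p' +
      if j' = j ∧ p' = p then 2 * Real.pi * I else 0 := by
    rw [zLog, AbelianCover.logAlong_append, hσ]
    rfl
  obtain ⟨N, hN⟩ := exists_principalFrom_zLog Q j
  have hdiff := lerchFull_monodromy_right (s := s) (isLogFamily_aLog ha₀ P j) hN (p := p)
    (m' := zLog (Q.append σ) j) (by rw [hlog, if_pos ⟨rfl, rfl⟩])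
    (fun m hm => by rw [hlog, if_neg fun h => hm h.2, add_zero])
  have hsum : zetaCont (P, Q.append σ, s) - zetaCont (P, Q, s) = exp (-(s * log k)) *
      (exp (2 * Real.pi * I * (j + 1) * P.pt.1 j) *
        (exp (2 * Real.pi * I * p * (k * P.pt.1 j)) * exp (-(s * zLog Q j p)) *
          (exp (-(2 * Real.pi * I * s)) - 1))) := by
    rw [zetaCont, zetaCont, ← mul_sub, ← Finset.sum_sub_distrib, Finset.sum_eq_single j]
    · rw [← hdiff]
      exact congrArg _ (mul_sub _ _ _).symm
    · intro j' _ hj'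
      have : zLog (Q.append σ) j' = zLog Q j' := by
        funext l'
        rw [hlog, if_neg fun h => hj' h.1, add_zero]
      simp only [this]
      exact sub_self _
    · simp
  rw [hsum]
  simp only [← mul_assoc]
  congr 1
  rw [← exp_add, ← exp_add, ← exp_add, ← exp_add]
  congr 1
  ring

lemma aLog_ofPath {a : aDomain k} {j : Fin k} {l : ℤ} {α : Path a₀ a} {θ : C(unitInterval, ℂ)}
    (h : IsLogAlong j (l / k) α θ) : aLog (AbelianCover.ofPath α) j l = log k + θ 1 := by
  have hk := natCast_ne_zero' (k := k)
  refine AbelianCover.logAlong_ofPath_of_theta (aFun j l) α (θ := fun t => log k + θ t)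
    (by fun_prop) (fun t => ?_) ?_
  · rw [exp_add, exp_log hk, h.2 t, aFun_apply]
    field_simp
  · rw [h.1, aFun_apply, ← log_natCast_mul (sub_ne_zero.2 (a₀.2 j l))]
    congr 1
    field_simp

lemma zLog_ofPath {z : zDomain k} {j : Fin k} {p : ℕ} {β : Path z₀ z} {φ : C(unitInterval, ℂ)}
    (h : IsLogAlong j (-(p * k : ℂ) - (j + 1 : ℂ)) β φ) :
    log k + zLog (AbelianCover.ofPath β) j p = φ 1 := by
  have hk := natCast_ne_zero' (k := k)
  have h1 : zLog (AbelianCover.ofPath β) j p = φ 1 - log k := by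
    refine AbelianCover.logAlong_ofPath_of_theta (zFun j p) β (θ := fun t => φ t - log k)
      (by fun_prop) (fun t => ?_) ?_
    · rw [exp_sub, exp_log hk, h.2 t, zFun_apply]
      field_simp
      ring
    · rw [h.1, sub_eq_iff_eq_add', ← log_natCast_mul (zFun j p z₀).2, zFun_apply]
      congr 1
      field_simp
      ring
  rw [h1]
  ring

end Monodromy

/-! ### Holomorphy of `zetaCont` in product charts. -/

section Holomorphic

open Metric

variable {k : ℕ} {a₀ : aDomain k} {z₀ : zDomain k}

lemma isOpen_puncturedPlane (T : Set ℤ) : IsOpen (puncturedPlane T) := by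
  rw [puncturedPlane_eq_union]
  exact (isOpen_cutPlane 1 T).union (isOpen_cutPlane (-1) T)

lemma update_mem_ball {v w : Fin k → ℂ} {r : ℝ} (hw : w ∈ ball v r) {j : Fin k} {c : ℂ}
    (hc : dist c (v j) ≤ dist (w j) (v j)) : Function.update v j c ∈ ball v r := by
  rw [mem_ball] at hw ⊢
  refine ((dist_pi_le_iff dist_nonneg).2 fun i => ?_).trans_lt hw
  by_cases hi : i = j
  · subst hi
    rw [Function.update_self]
    exact hc.trans (dist_le_pi_dist w v i)
  · rw [Function.update_of_ne hi, dist_self]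
    exact dist_nonneg

/-- The product chart of the product of the covers and `ℂ`. -/
noncomputable def prodChart (R : AbelianCover a₀ × AbelianCover z₀ × ℂ) {r : ℝ} (hr : 0 < r)
    (ha : ball R.1.pt.1 r ⊆ aDomain k) (hz : ball R.2.1.pt.1 r ⊆ zDomain k) :
    OpenPartialHomeomorph (AbelianCover a₀ × AbelianCover z₀ × ℂ)
      ((Fin k → ℂ) × (Fin k → ℂ) × ℂ) :=
  (R.1.chart hr ha).prod ((R.2.1.chart hr hz).prod (OpenPartialHomeomorph.refl ℂ))

lemma isSpreadChart_prodChart (R : AbelianCover a₀ × AbelianCover z₀ × ℂ) {r : ℝ} (hr : 0 < r)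
    (ha : ball R.1.pt.1 r ⊆ aDomain k) (hz : ball R.2.1.pt.1 r ⊆ zDomain k) :
    IsSpreadChart (coverProj a₀ z₀) R (prodChart R hr ha hz) :=
  ⟨⟨AbelianCover.mem_chart_source _ hr ha, AbelianCover.mem_chart_source _ hr hz, trivial⟩,
    fun _ _ => rfl⟩

lemma analyticAt_coord_left (j : Fin k) (v : (Fin k → ℂ) × (Fin k → ℂ) × ℂ) :
    AnalyticAt ℂ (fun q : (Fin k → ℂ) × (Fin k → ℂ) × ℂ => q.1 j) v :=
  ((ContinuousLinearMap.proj (R := ℂ) (φ := fun _ : Fin k => ℂ) j).analyticAt _).comp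
    analyticAt_fst

lemma analyticAt_coord_right (j : Fin k) (v : (Fin k → ℂ) × (Fin k → ℂ) × ℂ) :
    AnalyticAt ℂ (fun q : (Fin k → ℂ) × (Fin k → ℂ) × ℂ => q.2.1 j) v :=
  ((ContinuousLinearMap.proj (R := ℂ) (φ := fun _ : Fin k => ℂ) j).analyticAt _).comp
    (analyticAt_fst.comp analyticAt_snd)

variable [NeZero k]

variable (k) in
lemma isOpen_aDomain : IsOpen (aDomain k) := by
  have h : aDomain k = ⋂ j : Fin k, {a : Fin k → ℂ | k * a j ∈ puncturedPlane Set.univ} := by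
    ext a
    simp only [Set.mem_iInter]
    refine ⟨fun ha j l _ h => ha j l (by rw [eq_div_iff natCast_ne_zero', mul_comm, h]),
      fun ha j l h => ha j l trivial (by rw [h, mul_div_cancel₀ _ natCast_ne_zero'])⟩
  rw [h]
  exact isOpen_iInter_of_finite fun j =>
    (isOpen_puncturedPlane _).preimage (continuous_const.mul (continuous_apply j))

variable (k) in
lemma isOpen_zDomain : IsOpen (zDomain k) := by
  have h : zDomain k = ⋂ j : Fin k, {z : Fin k → ℂ | (z j + (j + 1)) / k ∈ puncturedPlane {l | l ≤ 0}} := by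
    ext z
    simp only [Set.mem_iInter]
    exact ⟨fun hz j => (zHomeo k ⟨z, hz⟩ j).2, fun hz =>
      (show (fun j => k * ((z j + (j + 1)) / k) - (j + 1)) = z by
        funext j; rw [mul_div_cancel₀ _ natCast_ne_zero', add_sub_cancel_right]) ▸
        ((zHomeo k).symm fun j => ⟨_, hz j⟩).2⟩
  rw [h]
  exact isOpen_iInter_of_finite fun j => (isOpen_puncturedPlane _).preimage
    (((continuous_apply j).add continuous_const).div_const _)

lemma aLog_chart_symm (P : AbelianCover a₀) {r : ℝ} (hr : 0 < r) (hU : ball P.pt.1 r ⊆ aDomain k)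
    {a : Fin k → ℂ} (ha : a ∈ ball P.pt.1 r) (j : Fin k) :
    aLog ((P.chart hr hU).symm a) j = contLog (k * P.pt.1 j) (aLog P j) (k * a j) := by
  have hk := natCast_ne_zero' (k := k)
  funext l
  rw [AbelianCover.chart_symm_apply P hr hU ha, aLog, AbelianCover.logAlong_append,
    logInc_of_ratio]
  · rfl
  · intro t
    have hs := AbelianCover.segPath_mem (y := ⟨a, hU ha⟩) (convex_ball P.pt.1 r) hU
      (mem_ball_self hr) ha t
    rw [aFun_apply, aFun_apply]
    refine ratio_mem_slitPlane ?_
    by_contra! hc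
    -- If the segment were as far from the centre as the puncture is, replacing the `j`-th
    -- coordinate of the centre by `l/k` would give a point of the ball outside `A_k`.
    refine hU (update_mem_ball hs (j := j) (c := l / k) ?_) j l (by rw [Function.update_self])
    have h1 (u v : ℂ) : dist (k * u) (k * v) = k * dist u v := by
      rw [dist_eq, dist_eq, ← mul_sub, norm_mul, Complex.norm_natCast]
    have h2 : (l : ℂ) = k * (l / k) := by rw [mul_div_cancel₀ _ hk]
    rw [h2, h1, h1] at hc
    rw [dist_comm]
    exact le_of_mul_le_mul_left hc kpos

lemma zLog_chart_symm (Q : AbelianCover z₀) {r : ℝ} (hr : 0 < r) (hU : ball Q.pt.1 r ⊆ zDomain k)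
    {z : Fin k → ℂ} (hz : z ∈ ball Q.pt.1 r) (j : Fin k) :
    zLog ((Q.chart hr hU).symm z) j =
      contLogNat ((Q.pt.1 j + (j + 1)) / k) (zLog Q j) ((z j + (j + 1)) / k) := by
  have hk := natCast_ne_zero' (k := k)
  funext p
  rw [AbelianCover.chart_symm_apply Q hr hU hz, zLog, AbelianCover.logAlong_append,
    logInc_of_ratio]
  · rw [zFun_apply, zFun_apply]
    rfl
  · intro t
    have hs := AbelianCover.segPath_mem (y := ⟨z, hU hz⟩) (convex_ball Q.pt.1 r) hU
      (mem_ball_self hr) hz t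
    have h3 (u : ℂ) : (u + (j + 1)) / k + p = (u - (-(p * k : ℂ) - (j + 1 : ℂ))) / k := by
      field_simp; ring
    rw [zFun_apply, zFun_apply, h3, h3, div_div_div_cancel_right₀ hk]
    refine ratio_mem_slitPlane ?_
    by_contra! hc
    refine hU (update_mem_ball hs (j := j) (c := -(p * k : ℂ) - (j + 1 : ℂ)) ?_) j p
      (by rw [Function.update_self])
    rwa [dist_comm]

lemma exists_ball_subset (R : AbelianCover a₀ × AbelianCover z₀ × ℂ) :
    ∃ r > 0, ball R.1.pt.1 r ⊆ aDomain k ∧ ball R.2.1.pt.1 r ⊆ zDomain k := by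
  obtain ⟨r₁, h1, h2⟩ := Metric.isOpen_iff.1 (isOpen_aDomain k) _ R.1.pt.2
  obtain ⟨r₂, h3, h4⟩ := Metric.isOpen_iff.1 (isOpen_zDomain k) _ R.2.1.pt.2
  exact ⟨min r₁ r₂, lt_min h1 h3, (ball_subset_ball (min_le_left _ _)).trans h2,
    (ball_subset_ball (min_le_right _ _)).trans h4⟩

lemma analyticAt_zetaCont (ha₀ : ∀ j, 0 < (a₀.1 j).im)
    (R : AbelianCover a₀ × AbelianCover z₀ × ℂ) {r : ℝ} (hr : 0 < r)
    (ha : ball R.1.pt.1 r ⊆ aDomain k) (hz : ball R.2.1.pt.1 r ⊆ zDomain k) :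
    AnalyticAt ℂ (zetaCont ∘ (prodChart R hr ha hz).symm) (coverProj a₀ z₀ R) := by
  obtain ⟨P, Q, s⟩ := R
  set v : (Fin k → ℂ) × (Fin k → ℂ) × ℂ := coverProj a₀ z₀ (P, Q, s) with hv
  have hthd : AnalyticAt ℂ (fun q : (Fin k → ℂ) × (Fin k → ℂ) × ℂ => q.2.2) v :=
    analyticAt_snd.comp analyticAt_snd
  have h : AnalyticAt ℂ (fun q : (Fin k → ℂ) × (Fin k → ℂ) × ℂ => exp (-(q.2.2 * log k)) *
      ∑ j : Fin k, exp (2 * Real.pi * I * (j + 1) * q.1 j) *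
        lerchFull (k * q.1 j) (contLog (k * P.pt.1 j) (aLog P j) (k * q.1 j))
          ((q.2.1 j + (j + 1)) / k)
          (contLogNat ((Q.pt.1 j + (j + 1)) / k) (zLog Q j) ((q.2.1 j + (j + 1)) / k)) q.2.2) v := by
    refine ((hthd.mul analyticAt_const).neg.cexp).mul (Finset.analyticAt_fun_sum _ fun j _ => ?_)
    refine ((analyticAt_const.mul (analyticAt_coord_left j v)).cexp).mul ?_
    obtain ⟨N, hN⟩ := exists_principalFrom_zLog Q j
    have h1 := analyticAt_lerchFull s (isLogFamily_aLog ha₀ P j) hN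
      (fun p h0 => (zFun j p Q.pt).2 ((zFun_apply j p Q.pt).trans h0))
    have h2 : AnalyticAt ℂ (fun q : (Fin k → ℂ) × (Fin k → ℂ) × ℂ =>
        ((k * q.1 j, (q.2.1 j + (j + 1)) / k, q.2.2) : ℂ × ℂ × ℂ)) v :=
      (analyticAt_const.mul (analyticAt_coord_left j v)).prod
        ((((analyticAt_coord_right j v).add analyticAt_const).div_const).prod hthd)
    exact AnalyticAt.comp (g := fun q : ℂ × ℂ × ℂ => lerchFull q.1
      (contLog (k * P.pt.1 j) (aLog P j) q.1) q.2.1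
      (contLogNat ((Q.pt.1 j + (j + 1)) / k) (zLog Q j) q.2.1) q.2.2)
      (f := fun q : (Fin k → ℂ) × (Fin k → ℂ) × ℂ =>
        ((k * q.1 j, (q.2.1 j + (j + 1)) / k, q.2.2) : ℂ × ℂ × ℂ)) h1 h2
  refine h.congr ?_
  filter_upwards [continuous_fst.continuousAt.preimage_mem_nhds (ball_mem_nhds P.pt.1 hr),
    (continuous_fst.comp continuous_snd).continuousAt.preimage_mem_nhds
      (ball_mem_nhds Q.pt.1 hr)] with q hq1 hq2
  have e1 : (prodChart (P, Q, s) hr ha hz).symm q =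
    ((P.chart hr ha).symm q.1, (Q.chart hr hz).symm q.2.1, q.2.2) := rfl
  have e2 : ((P.chart hr ha).symm q.1).pt.1 = q.1 := (P.chart hr ha).right_inv hq1
  have e3 : ((Q.chart hr hz).symm q.2.1).pt.1 = q.2.1 := (Q.chart hr hz).right_inv hq2
  rw [Function.comp_apply, e1, zetaCont]
  simp only [e2, e3, aLog_chart_symm P hr ha hq1, zLog_chart_symm Q hr hz (z := q.2.1) hq2]

lemma isHolomorphicOver_zetaCont (ha₀ : ∀ j, 0 < (a₀.1 j).im) :
    IsHolomorphicOver (coverProj a₀ z₀) zetaCont := by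
  intro R
  obtain ⟨r, hr, ha, hz⟩ := exists_ball_subset R
  exact ⟨prodChart R hr ha hz, isSpreadChart_prodChart R hr ha hz, analyticAt_zetaCont ha₀ R hr ha hz⟩

end Holomorphic

/-! ### Germs on a space spread over `E`, and their continuation along paths. -/

section Spread

open Metric

variable {M E : Type*} [TopologicalSpace M] [NormedAddCommGroup E] {π : M → E} {F : M → ℂ}

lemma IsSpreadChart.apply_self {P : M} {e : OpenPartialHomeomorph M E} (h : IsSpreadChart π P e) :
    e P = π P := h.2 h.1

lemma IsSpreadChart.mem_target {P : M} {e : OpenPartialHomeomorph M E} (h : IsSpreadChart π P e) :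
    π P ∈ e.target := h.apply_self ▸ e.map_source h.1

lemma IsSpreadChart.symm_apply_self {P : M} {e : OpenPartialHomeomorph M E}
    (h : IsSpreadChart π P e) : e.symm (π P) = P := by
  rw [← h.apply_self, e.left_inv h.1]

lemma IsSpreadChart.of_mem {P Q : M} {e : OpenPartialHomeomorph M E} (h : IsSpreadChart π P e)
    (hQ : Q ∈ e.source) : IsSpreadChart π Q e := ⟨hQ, h.2⟩

lemma IsSpreadChart.apply_symm {P : M} {e : OpenPartialHomeomorph M E} (h : IsSpreadChart π P e)
    {v : E} (hv : v ∈ e.target) : π (e.symm v) = v := by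
  rw [← h.2 (e.map_target hv), e.right_inv hv]

/-- Two local sections of a local homeomorphism through the same point agree nearby; so the germ of
`F` does not depend on the chart. -/
lemma IsSpreadChart.eventuallyEq {P : M} {e e' : OpenPartialHomeomorph M E}
    (h : IsSpreadChart π P e) (h' : IsSpreadChart π P e') : e.symm =ᶠ[𝓝 (π P)] e'.symm := by
  have h1 : ∀ᶠ v in 𝓝 (π P), e.symm v ∈ e'.source := by
    have := (e.continuousAt_symm h.mem_target).tendsto
    rw [h.symm_apply_self] at this
    exact this (e'.open_source.mem_nhds h'.1)
  filter_upwards [h1, e.open_target.mem_nhds h.mem_target] with v h2 h3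
  rw [← e'.left_inv h2, h'.2 h2, h.apply_symm h3]

variable [NormedSpace ℂ E]

lemma IsHolomorphicOver.analyticAt (hF : IsHolomorphicOver π F) {P : M}
    {e : OpenPartialHomeomorph M E} (h : IsSpreadChart π P e) :
    AnalyticAt ℂ (F ∘ e.symm) (π P) := by
  obtain ⟨e', h', ha⟩ := hF P
  exact ha.congr ((h'.eventuallyEq h).fun_comp F)

lemma IsHolomorphicOver.analyticOnNhd (hF : IsHolomorphicOver π F) {P : M}
    {e : OpenPartialHomeomorph M E} (h : IsSpreadChart π P e) :
    AnalyticOnNhd ℂ (F ∘ e.symm) e.target := by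
  intro v hv
  have := hF.analyticAt (h.of_mem (e.map_target hv))
  rwa [h.apply_symm hv] at this

/-- The germ of `F` at a point, as a function on a neighbourhood of the projection. -/
noncomputable def IsHolomorphicOver.germ (hF : IsHolomorphicOver π F) (P : M) : E → ℂ :=
  F ∘ (hF P).choose.symm

lemma IsHolomorphicOver.germ_eventuallyEq (hF : IsHolomorphicOver π F) {P : M}
    {e : OpenPartialHomeomorph M E} (h : IsSpreadChart π P e) :
    hF.germ P =ᶠ[𝓝 (π P)] F ∘ e.symm :=
  ((hF P).choose_spec.1.eventuallyEq h).fun_comp F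

lemma IsHolomorphicOver.analyticAt_germ (hF : IsHolomorphicOver π F) (P : M) :
    AnalyticAt ℂ (hF.germ P) (π P) := (hF P).choose_spec.2

lemma IsHolomorphicOver.germ_apply_self (hF : IsHolomorphicOver π F) (P : M) :
    hF.germ P (π P) = F P := by
  rw [IsHolomorphicOver.germ, Function.comp_apply, (hF P).choose_spec.1.symm_apply_self]

lemma IsHolomorphicOver.continuous (hF : IsHolomorphicOver π F) : Continuous π := by
  refine continuous_iff_continuousAt.2 fun P => ?_
  obtain ⟨e, h, -⟩ := hF P
  refine (e.continuousAt h.1).congr ?_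
  filter_upwards [e.open_source.mem_nhds h.1] with Q hQ
  exact h.2 hQ

/-- Along a continuous path in the spread space, the germs of `F` vary coherently. -/
lemma IsHolomorphicOver.germ_coherent (hF : IsHolomorphicOver π F) {X : Type*} [TopologicalSpace X]
    {c : X → M} (hc : Continuous c) (t₀ : X) :
    ∀ᶠ t in 𝓝 t₀, hF.germ (c t) =ᶠ[𝓝 (π (c t))] hF.germ (c t₀) := by
  obtain ⟨e, h, -⟩ := hF (c t₀)
  have h0 : ∀ᶠ v in 𝓝 (π (c t₀)), hF.germ (c t₀) =ᶠ[𝓝 v] F ∘ e.symm :=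
    (hF.germ_eventuallyEq h).eventually_nhds
  filter_upwards [hc.continuousAt.preimage_mem_nhds (e.open_source.mem_nhds h.1),
    (hF.continuous.comp hc).continuousAt.eventually h0] with t h1 h2
  exact (hF.germ_eventuallyEq (h.of_mem h1)).trans h2.symm

/-- The parameters with vanishing germ form a clopen set; closedness is the identity theorem on a
ball. -/
lemma eventuallyEq_zero_of_continuation {x : unitInterval → E} (hx : Continuous x)
    {D : unitInterval → E → ℂ} (hD : ∀ t, AnalyticAt ℂ (D t) (x t))
    (hco : ∀ t₀, ∀ᶠ t in 𝓝 t₀, D t =ᶠ[𝓝 (x t)] D t₀) (h0 : D 0 =ᶠ[𝓝 (x 0)] 0) :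
    D 1 =ᶠ[𝓝 (x 1)] 0 := by
  have hclopen : IsClopen {t | D t =ᶠ[𝓝 (x t)] 0} := by
    constructor
    · rw [← isOpen_compl_iff, isOpen_iff_mem_nhds]
      intro t₀ ht₀
      obtain ⟨r, hr, hball⟩ := (hD t₀).exists_ball_analyticOnNhd
      filter_upwards [hco t₀, hx.continuousAt.preimage_mem_nhds (ball_mem_nhds (x t₀) hr)]
        with t h1 h2 h3
      have h3 : D t =ᶠ[𝓝 (x t)] 0 := h3
      have h4 := hball.eqOn_zero_of_preconnected_of_eventuallyEq_zero
        (convex_ball (x t₀) r).isPreconnected h2 (h1.symm.trans h3)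
      exact ht₀ (h4.eventuallyEq_of_mem (ball_mem_nhds _ hr))
    · rw [isOpen_iff_mem_nhds]
      intro t₀ ht₀
      have ht₀ : D t₀ =ᶠ[𝓝 (x t₀)] 0 := ht₀
      filter_upwards [hco t₀, hx.continuousAt.eventually ht₀.eventually_nhds] with t h1 h2
      exact h1.trans h2
  have h1 : (1 : unitInterval) ∈ {t | D t =ᶠ[𝓝 (x t)] 0} :=
    hclopen.eq_univ ⟨0, h0⟩ ▸ Set.mem_univ (1 : unitInterval)
  exact h1

end Spread

/-! ### Loops that wind once around a single hyperplane. -/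

lemma exists_loop_of_homeo {ι : Type*} {X : Type*} [TopologicalSpace X]
    {T : ι → Set ℤ} (Ψ : X ≃ₜ ∀ j, puncturedPlane (T j)) {x₀ : X}
    (h₀ : ∀ j, (Ψ x₀ j).1 ∈ cutPlane 1 (T j)) (j : ι) (l : ℤ) :
    ∃ σ : Path x₀ x₀, ∀ (j' : ι) (l' : ℤ) (hl' : l' ∈ T j'),
      (j' ≠ j → logInc ((puncturedFun hl').comp (homeoProj Ψ j')) σ = 0) ∧
      (j' = j → logInc ((puncturedFun hl').comp (homeoProj Ψ j')) σ =
        if l = l' then 2 * Real.pi * I else 0) := by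
  classical
  let q (j' : ι) : Path (homeoProj Ψ j' x₀) (homeoProj Ψ j' x₀) :=
    if j' = j then puncturedGen (h₀ j') l else Path.refl _
  obtain ⟨g, hg⟩ := fundamentalGroupPi_surjective Ψ x₀ fun j' =>
    FundamentalGroup.fromPath (Path.Homotopic.Quotient.mk (q j'))
  obtain ⟨σ, rfl⟩ := Path.Homotopic.Quotient.mk_surjective g
  have key (j' : ι) (l' : ℤ) (hl' : l' ∈ T j') :
      logInc ((puncturedFun hl').comp (homeoProj Ψ j')) σ = logInc (puncturedFun hl') (q j') := by
    have h1 := congrArg (logIncHom (puncturedFun hl') _) (congrFun hg j')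
    exact h1
  refine ⟨σ, fun j' l' hl' => ⟨fun hj => ?_, fun hj => ?_⟩⟩
  · rw [key]
    simp only [q, if_neg hj, logInc_refl]
  · rw [key]
    subst hj
    simp only [q, if_true]
    exact logInc_puncturedGen _ hl' l

section Loops

variable {k : ℕ} [NeZero k] {a₀ : aDomain k} {z₀ : zDomain k}

lemma aHomeo_mem_cutPlane (ha₀ : ∀ j, 0 < (a₀.1 j).im) (j : Fin k) :
    (aHomeo k a₀ j).1 ∈ cutPlane 1 Set.univ := by
  intro l _ h
  have h1 : 0 < (aHomeo k a₀ j).1.im := by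
    change 0 < (k * a₀.1 j : ℂ).im
    simpa using mul_pos kpos (ha₀ j)
  linarith [h.2]

lemma zHomeo_mem_cutPlane (hz₀ : ∀ j, 0 < (z₀.1 j).re) (j : Fin k) :
    (zHomeo k z₀ j).1 ∈ cutPlane 1 {l | l ≤ 0} := by
  intro l hl h
  have h1 : 0 < (zHomeo k z₀ j).1.re := by
    change 0 < ((z₀.1 j + (j + 1)) / k : ℂ).re
    rw [div_natCast_re]
    have := hz₀ j
    have := kpos (k := k)
    simp
    positivity
  rw [h.1] at h1
  have : (l : ℝ) ≤ 0 := by exact_mod_cast hl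
  linarith

lemma exists_loop_left (ha₀ : ∀ j, 0 < (a₀.1 j).im) (P : AbelianCover a₀) (j : Fin k) (l : ℤ) :
    ∃ σ : Path P.pt P.pt, ∀ j' l',
      logInc (aFun j' l') σ = if j' = j ∧ l' = l then 2 * Real.pi * I else 0 := by
  induction P using AbelianCover.ofPath_induction with | _ α => ?_
  obtain ⟨σ, hσ⟩ := exists_loop_of_homeo (aHomeo k) (aHomeo_mem_cutPlane ha₀) j l
  refine ⟨(α.symm.trans σ).trans α.symm.symm, fun j' l' => ?_⟩
  refine (logInc_conj (aFun j' l') α.symm σ).trans ?_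
  by_cases hj : j' = j
  · refine ((hσ j' l' trivial).2 hj).trans ?_
    simp only [hj, true_and, eq_comm]
  · exact ((hσ j' l' trivial).1 hj).trans (if_neg fun h => hj h.1).symm

lemma exists_loop_right (hz₀ : ∀ j, 0 < (z₀.1 j).re) (Q : AbelianCover z₀) (j : Fin k) (p : ℕ) :
    ∃ σ : Path Q.pt Q.pt, ∀ j' p',
      logInc (zFun j' p') σ = if j' = j ∧ p' = p then 2 * Real.pi * I else 0 := by
  induction Q using AbelianCover.ofPath_induction with | _ β => ?_
  obtain ⟨σ, hσ⟩ := exists_loop_of_homeo (zHomeo k) (zHomeo_mem_cutPlane hz₀) j (-p)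
  refine ⟨(β.symm.trans σ).trans β.symm.symm, fun j' p' => ?_⟩
  refine (logInc_conj (zFun j' p') β.symm σ).trans ?_
  by_cases hj : j' = j
  · refine ((hσ j' (-p') (by simp)).2 hj).trans ?_
    simp only [hj, true_and, neg_inj, Nat.cast_inj, eq_comm]
  · exact ((hσ j' (-p') (by simp)).1 hj).trans (if_neg fun h => hj h.1).symm

end Loops

/-! ### Different points of a fibre carry different germs. -/

section Separation

variable {k : ℕ} {a₀ : aDomain k} {z₀ : zDomain k}
  {F : AbelianCover a₀ × AbelianCover z₀ × ℂ → ℂ}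

/-- Non-real exponents are wanted because there `1/Γ(s)` and `e^{-2πis} - 1` do not vanish and
`e^{sλ}` tells the logarithms `λ` of a number apart. -/
lemma exists_im_ne_zero {s : ℂ} {p : ℂ → Prop} (h : ∀ᶠ s' in 𝓝 s, p s') :
    ∃ s', p s' ∧ s'.im ≠ 0 := by
  by_cases hs : s.im = 0
  · have hc : Filter.Tendsto (fun ε : ℝ => s + ε * I) (𝓝[≠] 0) (𝓝 s) := by
      have h1 : Continuous fun ε : ℝ => s + ε * I := by fun_prop
      have h2 := h1.tendsto 0
      simp only [ofReal_zero, zero_mul, add_zero] at h2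
      exact h2.mono_left nhdsWithin_le_nhds
    obtain ⟨ε, h1, h2⟩ := ((hc.eventually h).and self_mem_nhdsWithin).exists
    exact ⟨_, h1, by simpa [hs] using h2⟩
  · exact ⟨s, h.self_of_nhds, hs⟩

lemma eventually_germ_apply (hF : IsHolomorphicOver (coverProj a₀ z₀) F)
    (R : AbelianCover a₀ × AbelianCover z₀ × ℂ) [NeZero k] :
    ∀ᶠ s in 𝓝 R.2.2, hF.germ R (R.1.pt.1, R.2.1.pt.1, s) = F (R.1, R.2.1, s) := by
  obtain ⟨P, Q, s₀⟩ := R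
  obtain ⟨r, hr, ha, hz⟩ := exists_ball_subset (P, Q, s₀)
  have h := hF.germ_eventuallyEq (isSpreadChart_prodChart (P, Q, s₀) hr ha hz)
  have hc : ContinuousAt (fun s : ℂ => (P.pt.1, Q.pt.1, s)) s₀ := by fun_prop
  filter_upwards [hc.eventually h] with s hs
  refine hs.trans (congrArg F ?_)
  exact Prod.ext ((P.chart hr ha).left_inv (AbelianCover.mem_chart_source P hr ha))
    (Prod.ext ((Q.chart hr hz).left_inv (AbelianCover.mem_chart_source Q hr hz)) rfl)

variable (hF : IsHolomorphicOver (coverProj a₀ z₀) F)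

/-- Equal germs are continued along the two lifts of the same loop, and their difference stays zero.
-/
lemma germ_append_left {x : aDomain k} {y : zDomain k} {c c' : Quotient (abelianSetoid a₀ x)}
    {d d' : Quotient (abelianSetoid z₀ y)} {s : ℂ} (σ : Path x x)
    (h : hF.germ (⟨x, c⟩, ⟨y, d⟩, s) =ᶠ[𝓝 (x.1, y.1, s)] hF.germ (⟨x, c'⟩, ⟨y, d'⟩, s)) :
    hF.germ (AbelianCover.append ⟨x, c⟩ σ, ⟨y, d⟩, s) =ᶠ[𝓝 (x.1, y.1, s)]
      hF.germ (AbelianCover.append ⟨x, c'⟩ σ, ⟨y, d'⟩, s) := by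
  let P : AbelianCover a₀ := ⟨x, c⟩
  let P' : AbelianCover a₀ := ⟨x, c'⟩
  let Q : AbelianCover z₀ := ⟨y, d⟩
  let Q' : AbelianCover z₀ := ⟨y, d'⟩
  have hx : Continuous fun t => ((σ t).1, y.1, s) := by fun_prop
  have hc : Continuous fun t => (P.liftPath σ t, Q, s) :=
    (P.continuous_liftPath σ).prodMk continuous_const
  have hc' : Continuous fun t => (P'.liftPath σ t, Q', s) :=
    (P'.continuous_liftPath σ).prodMk continuous_const
  have key := eventuallyEq_zero_of_continuation hx
    (D := fun t v => hF.germ (P.liftPath σ t, Q, s) v - hF.germ (P'.liftPath σ t, Q', s) v)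
    (fun t => (hF.analyticAt_germ (P.liftPath σ t, Q, s)).sub
      (hF.analyticAt_germ (P'.liftPath σ t, Q', s)))
    (fun t₀ => by
      filter_upwards [hF.germ_coherent hc t₀, hF.germ_coherent hc' t₀] with t h1 h2
      exact h1.sub h2) ?_
  · have key' : ∀ᶠ v in 𝓝 (x.1, y.1, s), hF.germ (P.liftPath σ 1, Q, s) v -
        hF.germ (P'.liftPath σ 1, Q', s) v = 0 := by
      have key2 := key
      simp only [σ.target] at key2
      exact key2
    rw [AbelianCover.liftPath_one, AbelianCover.liftPath_one] at key'
    exact key'.mono fun v hv => sub_eq_zero.1 hv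
  · have h' : ∀ᶠ v in 𝓝 ((σ 0).1, y.1, s), hF.germ (P.liftPath σ 0, Q, s) v -
        hF.germ (P'.liftPath σ 0, Q', s) v = 0 := by
      rw [AbelianCover.liftPath_zero, AbelianCover.liftPath_zero, σ.source]
      exact h.mono fun v hv => sub_eq_zero.2 hv
    exact h'

lemma germ_append_right {x : aDomain k} {y : zDomain k} {c c' : Quotient (abelianSetoid a₀ x)}
    {d d' : Quotient (abelianSetoid z₀ y)} {s : ℂ} (σ : Path y y)
    (h : hF.germ (⟨x, c⟩, ⟨y, d⟩, s) =ᶠ[𝓝 (x.1, y.1, s)] hF.germ (⟨x, c'⟩, ⟨y, d'⟩, s)) :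
    hF.germ (⟨x, c⟩, AbelianCover.append ⟨y, d⟩ σ, s) =ᶠ[𝓝 (x.1, y.1, s)]
      hF.germ (⟨x, c'⟩, AbelianCover.append ⟨y, d'⟩ σ, s) := by
  let P : AbelianCover a₀ := ⟨x, c⟩
  let P' : AbelianCover a₀ := ⟨x, c'⟩
  let Q : AbelianCover z₀ := ⟨y, d⟩
  let Q' : AbelianCover z₀ := ⟨y, d'⟩
  have hx : Continuous fun t => (x.1, (σ t).1, s) := by fun_prop
  have hc : Continuous fun t => (P, Q.liftPath σ t, s) :=
    continuous_const.prodMk ((Q.continuous_liftPath σ).prodMk continuous_const)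
  have hc' : Continuous fun t => (P', Q'.liftPath σ t, s) :=
    continuous_const.prodMk ((Q'.continuous_liftPath σ).prodMk continuous_const)
  have key := eventuallyEq_zero_of_continuation hx
    (D := fun t v => hF.germ (P, Q.liftPath σ t, s) v - hF.germ (P', Q'.liftPath σ t, s) v)
    (fun t => (hF.analyticAt_germ (P, Q.liftPath σ t, s)).sub
      (hF.analyticAt_germ (P', Q'.liftPath σ t, s)))
    (fun t₀ => by
      filter_upwards [hF.germ_coherent hc t₀, hF.germ_coherent hc' t₀] with t h1 h2
      exact h1.sub h2) ?_
  · have key' : ∀ᶠ v in 𝓝 (x.1, y.1, s), hF.germ (P, Q.liftPath σ 1, s) v -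
        hF.germ (P', Q'.liftPath σ 1, s) v = 0 := by
      have key2 := key
      simp only [σ.target] at key2
      exact key2
    rw [AbelianCover.liftPath_one, AbelianCover.liftPath_one] at key'
    exact key'.mono fun v hv => sub_eq_zero.1 hv
  · have h' : ∀ᶠ v in 𝓝 (x.1, (σ 0).1, s), hF.germ (P, Q.liftPath σ 0, s) v -
        hF.germ (P', Q'.liftPath σ 0, s) v = 0 := by
      rw [AbelianCover.liftPath_zero, AbelianCover.liftPath_zero, σ.source]
      exact h.mono fun v hv => sub_eq_zero.2 hv
    exact h'

end Separation

section Separation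

variable {k : ℕ} [NeZero k] {a₀ : aDomain k} {z₀ : zDomain k}

/-- Two logarithms of one number differ by `2πin`; equality of the powers makes `sn` an integer, so
`n = 0` for non-real `s`. -/
lemma eq_of_exp_mul_eq {A B s u v : ℂ} (hAB : exp A = exp B) (hs : s.im ≠ 0)
    (h : exp (s * (u + (A - v))) = exp (s * (u + (B - v)))) : A = B := by
  obtain ⟨n, hn⟩ := exp_eq_exp_iff_exists_int.1 hAB
  obtain ⟨m, hm⟩ := exp_eq_exp_iff_exists_int.1 h
  have h1 : (s * n - m) * (2 * Real.pi * I) = 0 := by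
    rw [hn] at hm
    linear_combination hm
  have h2 : s * n - m = 0 := by
    rcases mul_eq_zero.1 h1 with h | h
    · exact h
    · exact absurd h two_pi_I_ne_zero
  have h3 : s.im * n = 0 := by
    have := congrArg Complex.im h2
    simpa using this
  have h4 : (n : ℝ) = 0 := (mul_eq_zero.1 h3).resolve_left hs
  have h5 : n = 0 := by exact_mod_cast h4
  rw [hn, h5]
  simp

lemma exp_neg_two_pi_I_mul_ne_one {s : ℂ} (hs : s.im ≠ 0) : exp (-(2 * Real.pi * I * s)) ≠ 1 := by
  intro h
  obtain ⟨n, hn⟩ := exp_eq_one_iff.1 h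
  have h1 : (s + n) * (2 * Real.pi * I) = 0 := by linear_combination -hn
  have h2 : s + n = 0 := (mul_eq_zero.1 h1).resolve_right two_pi_I_ne_zero
  exact hs (by simpa using congrArg Complex.im h2)

lemma Gamma_inv_ne_zero_of_im {s : ℂ} (hs : s.im ≠ 0) : (Gamma s)⁻¹ ≠ 0 := by
  refine inv_ne_zero (Gamma_ne_zero fun m h => hs ?_)
  simp [h]

lemma exp_aLog (P : AbelianCover a₀) (j : Fin k) (l : ℤ) :
    exp (aLog P j l) = k * P.pt.1 j - l := AbelianCover.exp_logAlong _ P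

lemma exp_zLog (Q : AbelianCover z₀) (j : Fin k) (p : ℕ) :
    exp (zLog Q j p) = (Q.pt.1 j + (j + 1)) / k + p :=
  (AbelianCover.exp_logAlong _ Q).trans (zFun_apply j p Q.pt)

variable (hF : IsHolomorphicOver (coverProj a₀ z₀) (zetaCont (k := k)))

/-- Equal germs remain equal after a loop around `a_j = l/k`, so the two monodromies agree; all
their factors except the power of `a_j - l/k` are common and nonzero. -/
lemma aLog_eq_of_germ_eq (ha₀ : ∀ j, 0 < (a₀.1 j).im) {x : aDomain k} {y : zDomain k}
    {c c' : Quotient (abelianSetoid a₀ x)} {d d' : Quotient (abelianSetoid z₀ y)} {s : ℂ}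
    (h : hF.germ (⟨x, c⟩, ⟨y, d⟩, s) =ᶠ[𝓝 (x.1, y.1, s)] hF.germ (⟨x, c'⟩, ⟨y, d'⟩, s))
    (j : Fin k) (l : ℤ) : aLog (⟨x, c⟩ : AbelianCover a₀) j l = aLog ⟨x, c'⟩ j l := by
  obtain ⟨σ, hσ⟩ := exists_loop_left ha₀ (⟨x, c⟩ : AbelianCover a₀) j l
  have hc : Filter.Tendsto (fun s' : ℂ => (x.1, y.1, s')) (𝓝 s) (𝓝 (x.1, y.1, s)) :=
    Continuous.tendsto (by fun_prop) s
  obtain ⟨s', ⟨h1, h2, h3, h4, h5, h6⟩, hs'⟩ := exists_im_ne_zero <|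
    (hc.eventually h).and <| (hc.eventually (germ_append_left hF σ h)).and <|
      (eventually_germ_apply hF (⟨x, c⟩, ⟨y, d⟩, s)).and <|
      (eventually_germ_apply hF (⟨x, c'⟩, ⟨y, d'⟩, s)).and <|
      (eventually_germ_apply hF (AbelianCover.append ⟨x, c⟩ σ, ⟨y, d⟩, s)).and
      (eventually_germ_apply hF (AbelianCover.append ⟨x, c'⟩ σ, ⟨y, d'⟩, s))
  have e1 := h3.symm.trans (h1.trans h4)
  have e2 := h5.symm.trans (h2.trans h6)
  have m1 := zetaCont_append_left ha₀ ⟨x, c⟩ ⟨y, d⟩ s' hσ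
  have m2 := zetaCont_append_left ha₀ ⟨x, c'⟩ ⟨y, d'⟩ s' hσ
  have e3 := m1.symm.trans ((congrArg₂ (· - ·) e2 e1).trans m2)
  refine eq_of_exp_mul_eq (s := s' - 1) (u := Real.log (2 * Real.pi)) (v := log k)
    ((exp_aLog ⟨x, c⟩ j l).trans (exp_aLog (⟨x, c'⟩ : AbelianCover a₀) j l).symm) (by simpa using hs') ?_
  have hk := natCast_ne_zero' (k := k)
  have hG := Gamma_inv_ne_zero_of_im hs'
  have e4 := mul_left_cancel₀ (neg_ne_zero.2 (mul_ne_zero (mul_ne_zero two_pi_I_ne_zero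
    (exp_ne_zero _)) hG)) e3
  exact mul_right_cancel₀ (exp_ne_zero _) (mul_right_cancel₀ (exp_ne_zero _)
    ((div_left_inj' hk).1 e4))

lemma zLog_eq_of_germ_eq (ha₀ : ∀ j, 0 < (a₀.1 j).im) (hz₀ : ∀ j, 0 < (z₀.1 j).re)
    {x : aDomain k} {y : zDomain k}
    {c c' : Quotient (abelianSetoid a₀ x)} {d d' : Quotient (abelianSetoid z₀ y)} {s : ℂ}
    (h : hF.germ (⟨x, c⟩, ⟨y, d⟩, s) =ᶠ[𝓝 (x.1, y.1, s)] hF.germ (⟨x, c'⟩, ⟨y, d'⟩, s))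
    (j : Fin k) (p : ℕ) : zLog (⟨y, d⟩ : AbelianCover z₀) j p = zLog ⟨y, d'⟩ j p := by
  obtain ⟨σ, hσ⟩ := exists_loop_right hz₀ (⟨y, d⟩ : AbelianCover z₀) j p
  have hc : Filter.Tendsto (fun s' : ℂ => (x.1, y.1, s')) (𝓝 s) (𝓝 (x.1, y.1, s)) :=
    Continuous.tendsto (by fun_prop) s
  obtain ⟨s', ⟨h1, h2, h3, h4, h5, h6⟩, hs'⟩ := exists_im_ne_zero <|
    (hc.eventually h).and <| (hc.eventually (germ_append_right hF σ h)).and <|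
      (eventually_germ_apply hF (⟨x, c⟩, ⟨y, d⟩, s)).and <|
      (eventually_germ_apply hF (⟨x, c'⟩, ⟨y, d'⟩, s)).and <|
      (eventually_germ_apply hF (⟨x, c⟩, AbelianCover.append ⟨y, d⟩ σ, s)).and
      (eventually_germ_apply hF (⟨x, c'⟩, AbelianCover.append ⟨y, d'⟩ σ, s))
  have e1 := h3.symm.trans (h1.trans h4)
  have e2 := h5.symm.trans (h2.trans h6)
  have m1 := zetaCont_append_right ha₀ ⟨x, c⟩ ⟨y, d⟩ s' hσ
  have m2 := zetaCont_append_right ha₀ ⟨x, c'⟩ ⟨y, d'⟩ s' hσ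
  have e3 := m1.symm.trans ((congrArg₂ (· - ·) e2 e1).trans m2)
  refine eq_of_exp_mul_eq (s := -s') (u := log k) (v := 0)
    ((exp_zLog ⟨y, d⟩ j p).trans (exp_zLog (⟨y, d'⟩ : AbelianCover z₀) j p).symm) (by simpa using hs') ?_
  have e4 := mul_left_cancel₀ (exp_ne_zero _)
    (mul_right_cancel₀ (sub_ne_zero.2 (exp_neg_two_pi_I_mul_ne_one hs')) e3)
  simpa only [sub_zero, neg_mul] using e4

theorem separatesFibres_zetaCont (ha₀ : ∀ j, 0 < (a₀.1 j).im) (hz₀ : ∀ j, 0 < (z₀.1 j).re) :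
    SeparatesFibres (coverProj a₀ z₀) (zetaCont (k := k)) := by
  rintro ⟨⟨⟨x, hx⟩, c⟩, ⟨⟨y, hy⟩, d⟩, s⟩ ⟨⟨⟨x', hx'⟩, c'⟩, ⟨⟨y', hy'⟩, d'⟩, s'⟩ e e' he he' hπ hg
  have hF := isHolomorphicOver_zetaCont (z₀ := z₀) ha₀
  simp only [coverProj, Prod.mk.injEq] at hπ
  obtain ⟨rfl, rfl, rfl⟩ := hπ
  have h := (hF.germ_eventuallyEq he).trans (hg.trans (hF.germ_eventuallyEq he').symm)
  have hP : (⟨⟨x, hx⟩, c⟩ : AbelianCover a₀) = ⟨⟨x, hx'⟩, c'⟩ :=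
    AbelianCover.ext_of_logAlong (aHomeo k) (aHomeo_mem_cutPlane ha₀) rfl fun j l _ =>
      aLog_eq_of_germ_eq hF ha₀ h j l
  have hQ : (⟨⟨y, hy⟩, d⟩ : AbelianCover z₀) = ⟨⟨y, hy'⟩, d'⟩ := by
    refine AbelianCover.ext_of_logAlong (zHomeo k) (zHomeo_mem_cutPlane hz₀) rfl
      fun j l hl => ?_
    obtain ⟨p, rfl⟩ : ∃ p : ℕ, l = -(p : ℤ) := ⟨(-l).toNat, by
      have : l ≤ 0 := hl
      omega⟩
    exact zLog_eq_of_germ_eq hF ha₀ hz₀ h j p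
  rw [hP, hQ]

end Separation

/-! ### Germs that coincide with a given quotient `g / h`. -/

section Continuation

open Metric

variable {M E : Type*} [TopologicalSpace M] [NormedAddCommGroup E] [NormedSpace ℂ E] {π : M → E}
  {F : M → ℂ} {V : Set E} {g h : E → ℂ}

/-- The points of `V` at which some germ of `F` coincides with `g / h`. -/
def IsHolomorphicOver.quotientSet (hF : IsHolomorphicOver π F) (V : Set E) (g h : E → ℂ) : Set E :=
  {v | v ∈ V ∧ ∃ R, π R = v ∧ ∀ᶠ w in 𝓝 v, h w * hF.germ R w = g w}

/-- By the identity theorem `h · F = g` spreads from one point over a connected part of a chart. -/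
lemma IsHolomorphicOver.subset_quotientSet (hF : IsHolomorphicOver π F) {R : M}
    {e : OpenPartialHomeomorph M E} (he : IsSpreadChart π R e) {B : Set E} (hBo : IsOpen B)
    (hB : IsPreconnected B) (hBV : B ⊆ V) (hBe : B ⊆ e.target) (hR : π R ∈ B)
    (hg : AnalyticOnNhd ℂ g V) (hh : AnalyticOnNhd ℂ h V)
    (hgerm : ∀ᶠ w in 𝓝 (π R), h w * hF.germ R w = g w) : B ⊆ hF.quotientSet V g h := by
  have h1 : Set.EqOn (fun w => h w * (F ∘ e.symm) w) g B := by
    refine AnalyticOnNhd.eqOn_of_preconnected_of_eventuallyEq (fun w hw => ?_) (hg.mono hBV) hB hR ?_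
    · exact (hh w (hBV hw)).mul (hF.analyticOnNhd he w (hBe hw))
    · filter_upwards [hgerm, hF.germ_eventuallyEq he] with w h1 h2
      rw [← h2, h1]
  intro v hv
  have hev := he.apply_symm (hBe hv)
  refine ⟨hBV hv, e.symm v, hev, ?_⟩
  have h2 := hF.germ_eventuallyEq (he.of_mem (e.map_target (hBe hv)))
  rw [hev] at h2
  filter_upwards [h2, hBo.mem_nhds hv] with w h3 h4
  rw [h3]
  exact h1 h4

lemma IsHolomorphicOver.isOpen_quotientSet (hF : IsHolomorphicOver π F) (hV : IsOpen V)
    (hg : AnalyticOnNhd ℂ g V) (hh : AnalyticOnNhd ℂ h V) : IsOpen (hF.quotientSet V g h) := by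
  refine isOpen_iff_mem_nhds.2 ?_
  rintro _ ⟨hv, R, rfl, hgerm⟩
  obtain ⟨e, he, -⟩ := hF R
  obtain ⟨r, hr, hball⟩ := isOpen_iff.1 (hV.inter e.open_target) _ ⟨hv, he.mem_target⟩
  refine Filter.mem_of_superset (ball_mem_nhds _ hr) ?_
  exact hF.subset_quotientSet he isOpen_ball (convex_ball _ _).isPreconnected
    (fun w hw => (hball hw).1) (fun w hw => (hball hw).2) (mem_ball_self hr) hg hh hgerm

lemma IsHolomorphicOver.mul_eq_of_continuation (hF : IsHolomorphicOver π F)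
    {c : unitInterval → M} (hc : Continuous c) (hcV : ∀ t, π (c t) ∈ V)
    (hg : AnalyticOnNhd ℂ g V) (hh : AnalyticOnNhd ℂ h V)
    (hgerm : ∀ᶠ w in 𝓝 (π (c 0)), h w * hF.germ (c 0) w = g w) :
    h (π (c 1)) * F (c 1) = g (π (c 1)) := by
  have key := eventuallyEq_zero_of_continuation (hF.continuous.comp hc)
    (D := fun t w => h w * hF.germ (c t) w - g w)
    (fun t => ((hh _ (hcV t)).mul (hF.analyticAt_germ (c t))).sub (hg _ (hcV t)))
    (fun t₀ => by
      filter_upwards [hF.germ_coherent hc t₀] with t ht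
      filter_upwards [ht] with w hw
      simp only [hw])
    (hgerm.mono fun w hw => sub_eq_zero.2 hw)
  have h1 : h (π (c 1)) * hF.germ (c 1) (π (c 1)) - g (π (c 1)) = 0 := key.self_of_nhds
  rw [hF.germ_apply_self] at h1
  exact sub_eq_zero.1 h1

end Continuation

/-! ### Small circles around the removed hyperplanes. -/

section Circles

open Metric

variable {k : ℕ}

lemma dist_update_lt {u x : Fin k → ℂ} {r : ℝ} (hx : dist x u < r) {j : Fin k} {w : ℂ}
    (hw : dist w (u j) ≤ dist (x j) (u j)) : dist (Function.update x j w) u < r := by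
  refine ((dist_pi_le_iff dist_nonneg).2 fun i => ?_).trans_lt hx
  by_cases hi : i = j
  · subst hi
    rw [Function.update_self]
    exact hw.trans (dist_le_pi_dist x u i)
  · rw [Function.update_of_ne hi]
    exact dist_le_pi_dist x u i

lemma norm_exp_two_pi_I_mul (t : ℝ) : ‖exp (2 * Real.pi * I * t)‖ = 1 := by
  have : (2 * Real.pi * I * t : ℂ) = (2 * Real.pi * t : ℝ) * I := by push_cast; ring
  rw [this, norm_exp_ofReal_mul_I]

lemma exists_isCircleAround {U : Set (Fin k → ℂ)} (x : U) (j : Fin k) (c : ℂ) {R : ℝ}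
    (hR : ‖x.1 j - c‖ < R)
    (hU : ∀ w : ℂ, ‖w - c‖ = ‖x.1 j - c‖ → Function.update x.1 j w ∈ U) :
    ∃ ω : Path x x, IsCircleAround j c R ω := by
  have hcirc (t : unitInterval) :
      ‖c + (x.1 j - c) * exp (2 * Real.pi * I * t) - c‖ = ‖x.1 j - c‖ := by
    rw [add_sub_cancel_left, norm_mul, norm_exp_two_pi_I_mul, mul_one]
  have hend : Function.update x.1 j (c + (x.1 j - c) * 1) = x.1 := by
    rw [mul_one, add_sub_cancel, Function.update_eq_self]
  refine ⟨{ toFun := fun t => ⟨_, hU _ (hcirc t)⟩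
            continuous_toFun := ?_
            source' := ?_
            target' := ?_ }, hR, fun t => rfl⟩
  · refine Continuous.subtype_mk (continuous_const.update j ?_) _
    fun_prop
  · refine Subtype.ext ?_
    simp
  · refine Subtype.ext ?_
    have h1 : exp (2 * Real.pi * I * ((1 : unitInterval) : ℝ)) = 1 := by simp
    simpa only [h1] using hend

variable [NeZero k]

lemma update_mem_aDomain {x : Fin k → ℂ} (hx : x ∈ aDomain k) {j : Fin k} {l : ℤ}
    (hr : ‖x j - l / k‖ < 1 / k) {w : ℂ} (hw : ‖w - l / k‖ = ‖x j - l / k‖) :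
    Function.update x j w ∈ aDomain k := by
  intro j' l' h
  by_cases hj : j' = j
  · subst hj
    rw [Function.update_self] at h
    have h1 : ‖((l' - l : ℤ) : ℂ)‖ / k = ‖x j' - l / k‖ := by
      rw [← hw, h, ← Complex.norm_natCast k, ← norm_div]
      congr 1
      push_cast
      ring
    by_cases hl : l' = l
    · rw [hl, sub_self, Int.cast_zero, norm_zero, zero_div, eq_comm, norm_eq_zero, sub_eq_zero] at h1
      exact hx j' l h1
    · rw [← h1, div_lt_div_iff_of_pos_right kpos, norm_intCast] at hr
      have h2 : (1 : ℝ) ≤ |((l' - l : ℤ) : ℝ)| := by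
        exact_mod_cast Int.one_le_abs (sub_ne_zero.2 hl)
      linarith
  · rw [Function.update_of_ne hj] at h
    exact hx j' l' h

lemma update_mem_zDomain {x : Fin k → ℂ} (hx : x ∈ zDomain k) {j : Fin k} {p : ℕ}
    (hr : ‖x j - (-(p * k : ℂ) - (j + 1 : ℂ))‖ < k) {w : ℂ}
    (hw : ‖w - (-(p * k : ℂ) - (j + 1 : ℂ))‖ = ‖x j - (-(p * k : ℂ) - (j + 1 : ℂ))‖) :
    Function.update x j w ∈ zDomain k := by
  intro j' p' h
  by_cases hj : j' = j
  · subst hj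
    rw [Function.update_self] at h
    have h1 : ‖((p - p' : ℤ) : ℂ)‖ * k = ‖x j' - (-(p * k : ℂ) - (j' + 1 : ℂ))‖ := by
      rw [← hw, h, ← Complex.norm_natCast k, ← norm_mul]
      congr 1
      push_cast
      ring
    by_cases hp : p' = p
    · rw [hp, sub_self, Int.cast_zero, norm_zero, zero_mul, eq_comm, norm_eq_zero, sub_eq_zero] at h1
      exact hx j' p h1
    · have hk := kpos (k := k)
      have h2 : (1 : ℤ) ≤ |(p - p' : ℤ)| := Int.one_le_abs (by omega)
      have h3 : (1 : ℝ) ≤ |((p - p' : ℤ) : ℝ)| := by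
        rw [← Int.cast_abs]
        exact_mod_cast h2
      rw [← h1, norm_intCast] at hr
      nlinarith
  · rw [Function.update_of_ne hj] at h
    exact hx j' p' h

end Circles

/-! ### No meromorphic continuation across the removed hyperplanes. -/

section Boundary

open Metric

variable {k : ℕ} {a₀ : aDomain k} {z₀ : zDomain k}
  {V : Set ((Fin k → ℂ) × (Fin k → ℂ) × ℂ)} {g h : (Fin k → ℂ) × (Fin k → ℂ) × ℂ → ℂ}

/-- The function `h` cannot vanish on a nonempty open part of the connected set `V`; then `s` alone
is moved off the real axis. -/
lemma exists_mem_ne_zero_im_ne_zero {O : Set ((Fin k → ℂ) × (Fin k → ℂ) × ℂ)}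
    (hV : IsPreconnected V) (hh : AnalyticOnNhd ℂ h V) (hne : ∃ v ∈ V, h v ≠ 0) (hO : IsOpen O)
    (hOV : O ⊆ V) (hOne : O.Nonempty) : ∃ v ∈ O, h v ≠ 0 ∧ v.2.2.im ≠ 0 := by
  obtain ⟨v, hv, hv0⟩ : ∃ v ∈ O, h v ≠ 0 := by
    by_contra! hc
    obtain ⟨w, hw⟩ := hOne
    obtain ⟨u, hu, hu0⟩ := hne
    refine hu0 (hh.eqOn_zero_of_preconnected_of_eventuallyEq_zero hV (hOV hw) ?_ hu)
    filter_upwards [hO.mem_nhds hw] with q hq using hc q hq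
  have h1 : ∀ᶠ w in 𝓝 v, w ∈ O ∧ h w ≠ 0 :=
    (hO.eventually_mem hv).and ((hh v (hOV hv)).continuousAt.eventually_ne hv0)
  have hc : Filter.Tendsto (fun s : ℂ => (v.1, v.2.1, s)) (𝓝 v.2.2) (𝓝 v) :=
    Continuous.tendsto (by fun_prop) v.2.2
  obtain ⟨s, hs, hs'⟩ := exists_im_ne_zero (hc.eventually h1)
  exact ⟨_, hs.1, hs.2, hs'⟩

variable [NeZero k] (hF : IsHolomorphicOver (coverProj a₀ z₀) (zetaCont (k := k)))

/-- Suppose `a_j = l/k` at the limit point. A nearby germ equal to `g / h` is continued along a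
small circle around the hyperplane inside `V`; `h · F = g` persists, so `F` returns to its value,
although its monodromy is nonzero. -/
lemma fst_mem_aDomain_of_mem_closure (ha₀ : ∀ j, 0 < (a₀.1 j).im) (hVo : IsOpen V) (hV : IsPreconnected V)
    (hg : AnalyticOnNhd ℂ g V) (hh : AnalyticOnNhd ℂ h V) (hne : ∃ v ∈ V, h v ≠ 0)
    {v : (Fin k → ℂ) × (Fin k → ℂ) × ℂ} (hv : v ∈ V)
    (hvW : v ∈ closure (hF.quotientSet V g h)) : v.1 ∈ aDomain k := by
  intro j l hjl
  obtain ⟨r, hr, hball⟩ := isOpen_iff.1 hVo v hv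
  -- The bound `r` keeps the circle inside `V`, the bound `1 / k` makes it enclose only `l/k`.
  set r' := min r (1 / k)
  have hr' : 0 < r' := lt_min hr (one_div_pos.2 kpos)
  obtain ⟨_, ⟨⟨-, ⟨P, Q, s⟩, rfl, hgerm⟩, hu⟩, hu0, hs⟩ :=
    exists_mem_ne_zero_im_ne_zero hV hh hne
      ((hF.isOpen_quotientSet hVo hg hh).inter (isOpen_ball (x := v) (ε := r')))
      (fun w hw => hw.1.1)
      ((mem_closure_iff.1 hvW _ isOpen_ball (mem_ball_self hr')).mono fun w hw => ⟨hw.2, hw.1⟩)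
  have hd := mem_ball.1 hu
  rw [Prod.dist_eq, Prod.dist_eq, max_lt_iff, max_lt_iff] at hd
  have hR : ‖P.pt.1 j - l / k‖ < 1 / k := by
    rw [← hjl, ← dist_eq_norm]
    exact (dist_le_pi_dist _ _ _).trans_lt (hd.1.trans_le (min_le_right _ _))
  obtain ⟨ω, hω⟩ := exists_isCircleAround P.pt j (l / k) hR
    fun w hw => update_mem_aDomain P.pt.2 hR hw
  have hmul := hF.mul_eq_of_continuation (c := fun t => (P.liftPath ω t, Q, s)) (V := V)
    (g := g) (h := h) ((P.continuous_liftPath ω).prodMk continuous_const) (fun t => hball ?_) hg hh ?_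
  · have h0 := hgerm.self_of_nhds
    rw [hF.germ_apply_self] at h0
    rw [AbelianCover.liftPath_one] at hmul
    have h1 := mul_left_cancel₀ hu0 (hmul.trans h0.symm)
    have h2 := zetaCont_append_left ha₀ P Q s (logInc_aFun_circle hω)
    rw [h1, sub_self, eq_comm] at h2
    refine mul_ne_zero (neg_ne_zero.2 (mul_ne_zero (mul_ne_zero two_pi_I_ne_zero
      (exp_ne_zero _)) (Gamma_inv_ne_zero_of_im hs))) (div_ne_zero (mul_ne_zero (mul_ne_zero
        (exp_ne_zero _) (exp_ne_zero _)) (exp_ne_zero _)) natCast_ne_zero') h2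
  · refine mem_ball.2 ?_
    rw [Prod.dist_eq, Prod.dist_eq, max_lt_iff, max_lt_iff]
    refine ⟨?_, hd.2.1.trans_le (min_le_left _ _), hd.2.2.trans_le (min_le_left _ _)⟩
    change dist (ω t).1 v.1 < r
    rw [hω.2 t]
    refine dist_update_lt (hd.1.trans_le (min_le_left _ _)) ?_
    rw [hjl, dist_eq_norm, dist_eq_norm, add_sub_cancel_left, norm_mul, norm_exp_two_pi_I_mul, mul_one]
    exact le_rfl
  · simp only [AbelianCover.liftPath_zero]
    exact hgerm

lemma snd_mem_zDomain_of_mem_closure (ha₀ : ∀ j, 0 < (a₀.1 j).im) (hVo : IsOpen V) (hV : IsPreconnected V)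
    (hg : AnalyticOnNhd ℂ g V) (hh : AnalyticOnNhd ℂ h V) (hne : ∃ v ∈ V, h v ≠ 0)
    {v : (Fin k → ℂ) × (Fin k → ℂ) × ℂ} (hv : v ∈ V)
    (hvW : v ∈ closure (hF.quotientSet V g h)) : v.2.1 ∈ zDomain k := by
  intro j p hjp
  obtain ⟨r, hr, hball⟩ := isOpen_iff.1 hVo v hv
  set r' := min r k
  have hr' : 0 < r' := lt_min hr kpos
  obtain ⟨_, ⟨⟨-, ⟨P, Q, s⟩, rfl, hgerm⟩, hu⟩, hu0, hs⟩ :=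
    exists_mem_ne_zero_im_ne_zero hV hh hne
      ((hF.isOpen_quotientSet hVo hg hh).inter (isOpen_ball (x := v) (ε := r')))
      (fun w hw => hw.1.1)
      ((mem_closure_iff.1 hvW _ isOpen_ball (mem_ball_self hr')).mono fun w hw => ⟨hw.2, hw.1⟩)
  have hd := mem_ball.1 hu
  rw [Prod.dist_eq, Prod.dist_eq, max_lt_iff, max_lt_iff] at hd
  have hR : ‖Q.pt.1 j - (-(p * k : ℂ) - (j + 1 : ℂ))‖ < k := by
    rw [← hjp, ← dist_eq_norm]
    exact (dist_le_pi_dist _ _ _).trans_lt (hd.2.1.trans_le (min_le_right _ _))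
  obtain ⟨ω, hω⟩ := exists_isCircleAround Q.pt j (-(p * k : ℂ) - (j + 1 : ℂ)) hR
    fun w hw => update_mem_zDomain Q.pt.2 hR hw
  have hmul := hF.mul_eq_of_continuation (c := fun t => (P, Q.liftPath ω t, s)) (V := V)
    (g := g) (h := h) (continuous_const.prodMk
      ((Q.continuous_liftPath ω).prodMk continuous_const)) (fun t => hball ?_) hg hh ?_
  · have h0 := hgerm.self_of_nhds
    rw [hF.germ_apply_self] at h0
    rw [AbelianCover.liftPath_one] at hmul
    have h1 := mul_left_cancel₀ hu0 (hmul.trans h0.symm)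
    have h2 := zetaCont_append_right ha₀ P Q s (logInc_zFun_circle hω)
    rw [h1, sub_self, eq_comm] at h2
    exact mul_ne_zero (mul_ne_zero (exp_ne_zero _) (exp_ne_zero _))
      (sub_ne_zero.2 (exp_neg_two_pi_I_mul_ne_one hs)) h2
  · refine mem_ball.2 ?_
    rw [Prod.dist_eq, Prod.dist_eq, max_lt_iff, max_lt_iff]
    refine ⟨hd.1.trans_le (min_le_left _ _), ?_, hd.2.2.trans_le (min_le_left _ _)⟩
    change dist (ω t).1 v.2.1 < r
    rw [hω.2 t]
    refine dist_update_lt (hd.2.1.trans_le (min_le_left _ _)) ?_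
    rw [hjp, dist_eq_norm, dist_eq_norm, add_sub_cancel_left, norm_mul, norm_exp_two_pi_I_mul, mul_one]
    exact le_rfl
  · simp only [AbelianCover.liftPath_zero]
    exact hgerm

theorem noMeromorphicContinuationBeyond_zetaCont (ha₀ : ∀ j, 0 < (a₀.1 j).im) :
    NoMeromorphicContinuationBeyond (coverProj a₀ z₀) (zetaCont (k := k))
      {x | x.1 ∈ aDomain k ∧ x.2.1 ∈ zDomain k} := by
  intro P e V g h he hVo hV hPV hg hh hne hgerm
  have hF := isHolomorphicOver_zetaCont (z₀ := z₀) ha₀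
  have hPW : coverProj a₀ z₀ P ∈ hF.quotientSet V g h := by
    refine ⟨hPV, P, rfl, ?_⟩
    filter_upwards [hgerm, hF.germ_eventuallyEq he] with w h1 h2
    rw [h2]
    exact h1
  have hsub : V ⊆ hF.quotientSet V g h := by
    -- `V` is connected, so it suffices that the open set where some germ is `g / h` is also closed
    -- in `V`. Its points lie under the cover, hence in `A_k × Z_k × ℂ`.
    refine hV.subset_of_closure_inter_subset (hF.isOpen_quotientSet hVo hg hh) ⟨_, hPV, hPW⟩ ?_
    rintro v ⟨hvW, hv⟩
    have hva := fst_mem_aDomain_of_mem_closure hF ha₀ hVo hV hg hh hne hv hvW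
    have hvz := snd_mem_zDomain_of_mem_closure hF ha₀ hVo hV hg hh hne hv hvW
    obtain ⟨r, hr, hball⟩ := isOpen_iff.1 (hVo.inter (((isOpen_aDomain k).preimage continuous_fst).inter
      ((isOpen_zDomain k).preimage (continuous_fst.comp continuous_snd)))) v ⟨hv, hva, hvz⟩
    -- With `R` over a point within `r / 2` of `v`, the chart of radius `r / 2` around `R` covers
    -- `v` and stays over the ball of radius `r`.
    obtain ⟨_, hu, ⟨-, R, rfl, hR⟩⟩ :=
      mem_closure_iff.1 hvW _ isOpen_ball (mem_ball_self (half_pos hr))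
    have hB : ball (coverProj a₀ z₀ R) (r / 2) ⊆ ball v r := by
      refine ball_subset_ball' ?_
      linarith [mem_ball.1 hu]
    have hra : ball R.1.pt.1 (r / 2) ⊆ aDomain k := fun a ha =>
      (hball (hB (show (a, R.2.1.pt.1, R.2.2) ∈ ball (R.1.pt.1, R.2.1.pt.1, R.2.2) (r / 2) by
        simpa [Prod.dist_eq, half_pos hr] using ha))).2.1
    have hrz : ball R.2.1.pt.1 (r / 2) ⊆ zDomain k := fun z hz =>
      (hball (hB (show (R.1.pt.1, z, R.2.2) ∈ ball (R.1.pt.1, R.2.1.pt.1, R.2.2) (r / 2) by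
        simpa [Prod.dist_eq, half_pos hr] using hz))).2.2
    refine hF.subset_quotientSet (isSpreadChart_prodChart R (half_pos hr) hra hrz) isOpen_ball
      (convex_ball _ _).isPreconnected (fun w hw => (hball (hB hw)).1) (fun w hw => ?_)
      (mem_ball_self (half_pos hr)) hg hh hR (mem_ball'.2 (mem_ball.1 hu))
    have hw' := mem_ball.1 hw
    rw [Prod.dist_eq, Prod.dist_eq, max_lt_iff, max_lt_iff] at hw'
    exact ⟨hw'.1, hw'.2.1, trivial⟩
  rintro v hv
  obtain ⟨-, R, rfl, -⟩ := hsub hv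
  exact ⟨R.1.pt.2, R.2.1.pt.2⟩

end Boundary

/-! ### The main theorem. -/

theorem mainTheorem2 (k : ℕ) [NeZero k] (a₀ : aDomain k) (z₀ : zDomain k)
    (ha₀ : ∀ j, 0 < (a₀.1 j).im) (hz₀ : ∀ j, 0 < (z₀.1 j).re) :
    ∃ F : AbelianCover a₀ × AbelianCover z₀ × ℂ → ℂ,
      -- `F` is holomorphic on the product of the covers and `ℂ`
      IsHolomorphicOver (coverProj a₀ z₀) F ∧
      -- `F` continues the series `ζ_k`
      (∀ (a : aDomain k) (z : zDomain k) (α : Path a₀ a) (β : Path z₀ z) (s : ℂ),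
        (∀ t j, 0 < ((α t).1 j).im) → (∀ t j, 0 < ((β t).1 j).re) → 1 < s.re →
        HasSum (lerchLipschitzTerm k a.1 z.1 s)
          (F (AbelianCover.ofPath α, AbelianCover.ofPath β, s))) ∧
      -- the monodromy around `a_j = l / k`
      (∀ (j : Fin k) (l : ℤ) (a : aDomain k) (α : Path a₀ a) (θ : C(unitInterval, ℂ))
        (σ : Path a a) (Q : AbelianCover z₀) (s : ℂ),
        IsLogAlong j (l / k) α θ → IsMeridian j (l / k) (1 / k) σ →
        F (AbelianCover.ofPath (α.trans σ), Q, s) - F (AbelianCover.ofPath α, Q, s) =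
          -(2 * Real.pi * I * exp (2 * Real.pi * I * (j + 1) * a.1 j)
              * (Gamma s)⁻¹) *
            (exp ((s - 1) * (Real.log (2 * Real.pi) + θ 1)) *
              exp (I * (Real.pi / 2) * (s - 1)) *
              exp (-(2 * Real.pi * I) * (a.1 j - l / k) * ((j + 1) + Q.pt.1 j)) / k)) ∧
      -- the monodromy around `z_j = - p k - j`
      (∀ (j : Fin k) (p : ℕ) (z : zDomain k) (β : Path z₀ z) (φ : C(unitInterval, ℂ))
        (σ : Path z z) (P : AbelianCover a₀) (s : ℂ),
        IsLogAlong j (-(p * k : ℂ) - (j + 1 : ℂ)) β φ →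
        IsMeridian j (-(p * k : ℂ) - (j + 1 : ℂ)) k σ →
        F (P, AbelianCover.ofPath (β.trans σ), s) - F (P, AbelianCover.ofPath β, s) =
          exp (2 * Real.pi * I * (p * k + (j + 1)) * P.pt.1 j) * exp (-(s * φ 1)) *
            (exp (-(2 * Real.pi * I * s)) - 1)) ∧
      -- the product of the covers and `ℂ` is the Riemann domain of the function
      SeparatesFibres (coverProj a₀ z₀) F ∧
      NoMeromorphicContinuationBeyond (coverProj a₀ z₀) F
        {x | x.1 ∈ aDomain k ∧ x.2.1 ∈ zDomain k} := by
  refine ⟨zetaCont, isHolomorphicOver_zetaCont ha₀, fun a z α β s hα hβ hs =>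
    hasSum_zetaCont ha₀ α β hα hβ (one_pos.trans hs), fun j l a α θ σ Q s hθ hσ => ?_,
    fun j p z β φ σ P s hφ hσ => ?_, separatesFibres_zetaCont ha₀ hz₀,
    noMeromorphicContinuationBeyond_zetaCont ha₀⟩
  · have h := zetaCont_append_left ha₀ (AbelianCover.ofPath α) Q s (logInc_aFun_meridian hσ)
    rw [aLog_ofPath hθ, add_sub_cancel_left] at h
    exact h
  · have h := zetaCont_append_right ha₀ P (AbelianCover.ofPath β) s (logInc_zFun_meridian hσ)
    rw [zLog_ofPath hφ] at h
    exact h
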